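/- **Vocabulary.** Let $\tau$ consist of unary predicates $P_0,P_1,P_2,P_4$, a binary relation $R$, Boolean operations $\wedge,\vee,{}^-,0,1$ and the order $\le$ on $P_1$, and unary functions $G_1:P_0\to P_1$ and $F_n:P_2\to P_1$ ($n<\omega$). All $\tau$-structures $M$ considered are partitioned by $P_0^M,P_1^M,P_2^M$; $P_1^M$ is a Boolean algebra, $R^M\subseteq P_0^M\times P_1^M$ and $P_4^M\subseteq P_1^M$. Write $P_{4,n}^M$ for the set of joins of $n$ distinct atoms of $P_1^M$. In a Boolean algebra, $\langle X\rangle$ is the subalgebra generated by $X$, and a family $(y_i)$ is *independent over $X$ modulo an ideal $I$* if $p(y_{i_0},\dots,y_{i_k})\wedge a\notin I$ for every Boolean polynomial $p$ that is not identically $0$, all distinct indices $i_0,\dots,i_k$ and all $a\in\langle X\rangle\setminus I$. "Direct limit of members of a class" means the union of a nonempty directed family of substructures belonging to the class. **$\mathbf K^{-1}_{<\aleph_0}$** is the class of finitely generated $M$ such that: $b\mapsto R(M,b)=\{a:R^M(a,b)\}$ is a Boolean homomorphism from $P_1^M$ to $\mathcal P(P_0^M)$; $P_4^M=\bigcup_nP_{4,n}^M$,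 and $P_4^M=\{c:c\le b\}$ for some $b\in P_1^M$; $G_1^M$ is a bijection from $P_0^M$ onto $P_{4,1}^M$ with $R(M,G_1^M(a))=\{a\}$; $P_2^M$ is finite; for every $a\in P_{4,1}^M$ and $c\in P_2^M$, $a\le F_n^M(c)$ for only finitely many $n$; and $P_1^M=\langle P_4^M\cup\{F_n^M(c):n<\omega,c\in P_2^M\}\cup X\rangle$ for some finite $X\subseteq P_1^M$. **$\mathbf K_{-1}$** is the class of direct limits of members of $\mathbf K^{-1}_{<\aleph_0}$ (equivalently, every finitely generated substructure of $M$ is contained in a substructure of $M$ that is in $\mathbf K^{-1}_{<\aleph_0}$). **$\mathbf K^1_{<\aleph_0}$** is the class of $M\in\mathbf K^{-1}_{<\aleph_0}$ with $P_2^M$ finite and nonempty for which there are $n_*<\omega$, $b_*\in P_1^M$ and an increasing sequence $\langle B_n:n\ge n_*\rangle$ of finite subalgebras of $P_1^M$ with union $P_1^M$ such that: $b_*=\sup P_4^M$, and for some $k$, $\bigcup_{j\le k}P_{4,j}^M=\{c:c\le b_*\}$ and $P_{4,n}^M=\emptyset$ for $n>k$; $P_4^M=\{c:c\le b_*\}\subsetneq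 B_{n_*}$; $B_{n_*}=\langle P_4^M\cup\{F_n^M(c):n<n_*,c\in P_2^M\}\rangle$, and $B_{n_*}/P_4^M$ is a free Boolean algebra; for each $c\in P^M_2$ the family $(F_n^M(c))_{n<\omega}$ is independent over $P_4^M$ modulo $P_4^M$; the family $(F_m^M(c))_{m\ge n_*,c\in P_2^M}$ is independent over $B_{n_*}$ modulo $P_4^M$, and $F_m^M(c)\wedge b_*=0$ for $m\ge n_*$; and $B_n=\langle B_{n_*}\cup\{F_m^M(c):n_*\le m<n,c\in P_2^M\}\rangle$ for $n\ge n_*$. **$\mathbf K_1$** is the class of direct limits of members of $\mathbf K^1_{<\aleph_0}$. $M\in\mathbf K_1$ is *rich* if whenever $N_1\subseteq N_2$ are in $\mathbf K^1_{<\aleph_0}$ and $N_1\subseteq M$, there is an embedding of $N_2$ into $M$ over $N_1$. **$\mathbf K_2$** is the class of rich $M\in\mathbf K_1$. $M\in\mathbf K_{-1}$ is *$P_0$-maximal* if $M\subseteq N\in\mathbf K_{-1}$ implies $P_0^M=P_0^N$. $\mathrm{uf}(M)$ is the set of ultrafilters $D$ of the Boolean algebra $P_1^M$ such that $D\cap P_{4,1}^M=\emptyset$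 and, for each $c\in P_2^M$, only finitely many of the $F_n^M(c)$ are in $D$. **Theorem.** Suppose $\lambda$ is less than the first measurable cardinal (that is, less than every measurable cardinal), $2^{\aleph_0}<\lambda$, and $\lambda=2^\mu$ for some cardinal $\mu$. Then there is a $P_0$-maximal model $M\in\mathbf K_2$ of cardinality $\lambda$; moreover $\mathrm{uf}(M)=\emptyset$. -/

import Mathlib

open Cardinal

universe u

/-- Boolean polynomials in variables indexed by `ι`. -/
inductive BTerm (ι : Type u) : Type u
  | var : ι → BTerm ι
  | zero : BTerm ι
  | one : BTerm ι
  | meet : BTerm ι → BTerm ι → BTerm ι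
  | join : BTerm ι → BTerm ι → BTerm ι
  | neg : BTerm ι → BTerm ι

namespace BTerm

/-- The value of a Boolean polynomial in a Boolean algebra. -/
def eval {ι : Type u} {B : Type*} [BooleanAlgebra B] (y : ι → B) : BTerm ι → B
  | var i => y i
  | zero => ⊥
  | one => ⊤
  | meet s t => eval y s ⊓ eval y t
  | join s t => eval y s ⊔ eval y t
  | neg s => (eval y s)ᶜ

/-- A Boolean polynomial is nontrivial if it is not identically `0`, i.e. if it takes the
value `1` at some point of the two-element Boolean algebra. -/
def Nontriv {ι : Type u} (p : BTerm ι) : Prop :=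
  ∃ v : ι → Bool, eval v p = ⊤

end BTerm

/-- The family `y` is independent (free) over `X` modulo the ideal `I`: for every nontrivial
Boolean polynomial `p` and every `a ∈ ⟨X⟩ \ I`, `p(y) ∧ a ∉ I`. (In particular different
indices have different values, as long as `1 ∉ I`.) -/
def IndepMod {ι : Type u} {B : Type*} [BooleanAlgebra B] (y : ι → B) (X I : Set B) : Prop :=
  ∀ p : BTerm ι, p.Nontriv → ∀ a ∈ BooleanSubalgebra.closure X, a ∉ I → p.eval y ⊓ a ∉ I

/-- Structures for the vocabulary `τ = {P₀, P₁, P₂, P₄, R, ∧, ∨, ≤, ⁻, 0, 1, G₁, Fₙ (n < ω)}`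
in which `P₀, P₁, P₂` partition the universe and `P₁` is a Boolean algebra. The universe is the
disjoint union of the three sorts; `G₁ : P₀ → P₁` and `Fₙ : P₂ → P₁` are functions between the
sorts, `R ⊆ P₀ × P₁` and `P₄ ⊆ P₁`. -/
structure TauStr : Type (u + 1) where
  P0 : Type u
  P1 : Type u
  P2 : Type u
  [ba : BooleanAlgebra P1]
  P4 : Set P1
  R : P0 → P1 → Prop
  G : P0 → P1
  F : ℕ → P2 → P1

attribute [instance] TauStr.ba

namespace TauStr

/-- The cardinality of (the universe of) a structure. -/
def card (M : TauStr.{u}) : Cardinal.{u} := #(M.P0 ⊕ M.P1 ⊕ M.P2)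

/-- `P_{4,n}`: the joins of `n` distinct atoms of `P₁`. -/
def P4n (M : TauStr.{u}) (n : ℕ) : Set M.P1 :=
  {b | ∃ s : Finset M.P1, s.card = n ∧ (∀ a ∈ s, IsAtom a) ∧ s.sup id = b}

/-- Embeddings of `τ`-structures. -/
structure Emb (M N : TauStr.{u}) where
  f0 : M.P0 → N.P0
  f1 : BoundedLatticeHom M.P1 N.P1
  f2 : M.P2 → N.P2
  inj0 : Function.Injective f0
  inj1 : Function.Injective f1
  inj2 : Function.Injective f2
  map_P4 : ∀ b, f1 b ∈ N.P4 ↔ b ∈ M.P4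
  map_R : ∀ a b, N.R (f0 a) (f1 b) ↔ M.R a b
  map_G : ∀ a, f1 (M.G a) = N.G (f0 a)
  map_F : ∀ n c, f1 (M.F n c) = N.F n (f2 c)

/-- (Universes of) substructures of a `τ`-structure: subsets closed under all operations. -/
structure Sub (M : TauStr.{u}) where
  S0 : Set M.P0
  S1 : BooleanSubalgebra M.P1
  S2 : Set M.P2
  G_mem : ∀ a ∈ S0, M.G a ∈ S1
  F_mem : ∀ n, ∀ c ∈ S2, M.F n c ∈ S1

namespace Sub

variable {M : TauStr.{u}}

/-- The structure induced on a substructure. -/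
def toStr (S : M.Sub) : TauStr.{u} where
  P0 := S.S0
  P1 := S.S1
  P2 := S.S2
  P4 := {b | (b : M.P1) ∈ M.P4}
  R a b := M.R a b
  G a := ⟨M.G a, S.G_mem a a.2⟩
  F n c := ⟨M.F n c, S.F_mem n c c.2⟩

/-- Inclusion of substructures. -/
def IsSub (S T : M.Sub) : Prop := S.S0 ⊆ T.S0 ∧ S.S1 ≤ T.S1 ∧ S.S2 ⊆ T.S2

end Sub

/-- `M` is finitely generated: some finite set of elements lies in no proper substructure. -/
def FinGen (M : TauStr.{u}) : Prop :=
  ∃ (A0 : Set M.P0) (A1 : Set M.P1) (A2 : Set M.P2), A0.Finite ∧ A1.Finite ∧ A2.Finite ∧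
    ∀ S : M.Sub, A0 ⊆ S.S0 → A1 ⊆ S.S1 → A2 ⊆ S.S2 →
      S.S0 = Set.univ ∧ S.S1 = ⊤ ∧ S.S2 = Set.univ

/-- `M` is the direct limit of members of the class `K`, i.e. the union of a nonempty directed
family of substructures belonging to `K`. -/
def IsDirectLimitOf (K : TauStr.{u} → Prop) (M : TauStr.{u}) : Prop :=
  ∃ 𝒮 : Set M.Sub, 𝒮.Nonempty ∧ (∀ S ∈ 𝒮, K S.toStr) ∧ DirectedOn Sub.IsSub 𝒮 ∧
    (∀ a : M.P0, ∃ S ∈ 𝒮, a ∈ S.S0) ∧ (∀ b : M.P1, ∃ S ∈ 𝒮, b ∈ S.S1) ∧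
    (∀ c : M.P2, ∃ S ∈ 𝒮, c ∈ S.S2)

/-- The class `K^{-1}_{<ℵ₀}` of finitely generated structures. -/
structure KNegOneFin (M : TauStr.{u}) : Prop where
  finGen : M.FinGen
  /-- `b ↦ R(M, b)` is a Boolean algebra homomorphism into the power set of `P₀`. -/
  R_hom : ∃ f : BoundedLatticeHom M.P1 (Set M.P0), ∀ b, f b = {a | M.R a b}
  /-- `P₄` is the set of finite joins of atoms. -/
  P4_eq : M.P4 = ⋃ n, M.P4n n
  P4_principal : ∃ b : M.P1, M.P4 = {c | c ≤ b}
  G_bij : Set.BijOn M.G Set.univ (M.P4n 1)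
  R_G : ∀ a, {x | M.R x (M.G a)} = {a}
  P2_finite : Finite M.P2
  /-- Countable incompleteness. -/
  incomplete : ∀ a ∈ M.P4n 1, ∀ c : M.P2, {n | a ≤ M.F n c}.Finite
  generated : ∃ X : Set M.P1, X.Finite ∧
    BooleanSubalgebra.closure (M.P4 ∪ {b | ∃ n c, b = M.F n c} ∪ X) = ⊤

/-- The class `K_{-1}`: direct limits of members of `K^{-1}_{<ℵ₀}`. -/
def KNegOne (M : TauStr.{u}) : Prop := M.IsDirectLimitOf KNegOneFin

/-- `⟨n, B, b⟩` witnesses that the member `M` of `K^{-1}_{<ℵ₀}` is in `K^1_{<ℵ₀}`. (Only the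
`B m` with `m ≥ n` matter.) -/
structure IsWitness (M : TauStr.{u}) (n : ℕ) (B : ℕ → BooleanSubalgebra M.P1) (b : M.P1) :
    Prop where
  isLUB : IsLUB M.P4 b
  P4_bounded : ∃ k, (⋃ j ≤ k, M.P4n j) = {c | c ≤ b} ∧ ∀ j, k < j → M.P4n j = ∅
  B_finite : ∀ m, n ≤ m → (B m : Set M.P1).Finite
  B_mono : ∀ m m', n ≤ m → m ≤ m' → B m ≤ B m'
  P4_eq : M.P4 = {c | c ≤ b}
  P4_ssubset : M.P4 ⊂ (B n : Set M.P1)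
  B_gen : BooleanSubalgebra.closure (M.P4 ∪ {x | ∃ m < n, ∃ c, x = M.F m c}) = B n
  /-- `B n` is free over the ideal `P₄`: it is generated by `P₄` and a set which is independent
  modulo `P₄`. -/
  B_free : ∃ Y : Set M.P1, IndepMod (fun y : Y => (y : M.P1)) ∅ M.P4 ∧
    BooleanSubalgebra.closure (M.P4 ∪ Y) = B n
  union : ∀ x : M.P1, ∃ m, n ≤ m ∧ x ∈ B m
  P2_finite : Finite M.P2
  P2_nonempty : Nonempty M.P2
  F_indep : ∀ c : M.P2, IndepMod (fun m : ℕ => M.F m c) M.P4 M.P4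
  /-- The `F_m(c)` with `m ≥ n` (without repetition) are free from `B n` over `P₄`. -/
  F_free : IndepMod (fun i : {m : ℕ // n ≤ m} × M.P2 => M.F i.1 i.2) (B n) M.P4
  F_inf : ∀ m, n ≤ m → ∀ c, M.F m c ⊓ b = ⊥
  B_eq : ∀ m, n ≤ m →
    B m = BooleanSubalgebra.closure ((B n : Set M.P1) ∪ {x | ∃ k, n ≤ k ∧ k < m ∧ ∃ c, x = M.F k c})

/-- The class `K^1_{<ℵ₀}`. -/
def KOneFin (M : TauStr.{u}) : Prop :=
  M.KNegOneFin ∧ ∃ n B b, M.IsWitness n B b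

/-- The class `K₁`: direct limits of members of `K^1_{<ℵ₀}`. -/
def KOne (M : TauStr.{u}) : Prop := M.IsDirectLimitOf KOneFin

/-- `M` is rich: if `N₁ ⊆ N₂` are in `K^1_{<ℵ₀}` and `N₁ ⊆ M`, then `N₂` embeds into `M`
over `N₁`. -/
def Rich (M : TauStr.{u}) : Prop :=
  ∀ N₁ N₂ : TauStr.{u}, N₁.KOneFin → N₂.KOneFin → ∀ (i : N₁.Emb N₂) (j : N₁.Emb M),
    ∃ h : N₂.Emb M, (∀ a, h.f0 (i.f0 a) = j.f0 a) ∧ (∀ b, h.f1 (i.f1 b) = j.f1 b) ∧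
      (∀ c, h.f2 (i.f2 c) = j.f2 c)

/-- The class `K₂` of rich models in `K₁`. -/
def KTwo (M : TauStr.{u}) : Prop := M.KOne ∧ M.Rich

/-- `M` is `P₀`-maximal (in `K_{-1}`): no extension of `M` in `K_{-1}` has new elements
in `P₀`. -/
def P0Maximal (M : TauStr.{u}) : Prop :=
  M.KNegOne ∧ ∀ N : TauStr.{u}, N.KNegOne → ∀ f : M.Emb N, Function.Surjective f.f0

/-- `uf(M)`: the ultrafilters of the Boolean algebra `P₁` that contain no atom of `P_{4,1}` and,
for each `c ∈ P₂`, only finitely many of the `F_n(c)`. -/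
def uf (M : TauStr.{u}) : Set (Order.PFilter M.P1) :=
  {D | (∀ b, b ∈ D ↔ bᶜ ∉ D) ∧ (∀ a ∈ M.P4n 1, a ∉ D) ∧ ∀ c : M.P2, {n | M.F n c ∈ D}.Finite}

end TauStr

/-- `κ` is a measurable cardinal: it is uncountable and carries a nonprincipal `κ`-complete
ultrafilter. -/
def IsMeasurableCardinal (κ : Cardinal.{u}) : Prop :=
  ℵ₀ < κ ∧ ∃ U : Ultrafilter κ.out, (∀ x, ({x} : Set κ.out) ∉ U) ∧
    CardinalInterFilter (U : Filter κ.out) κ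

/-! Let `X` have cardinality μ. The model is an algebra of subsets of the tree `List X`: its points
are the finite sequences, `R` is membership, `P₄` consists of the finite sets, and `P₁` is generated
by the singletons and by sets `H i m`. There are two kinds of indices: killing indices make uf(M)
empty, and the 2^μ elements of `L` serve richness.

Maximality. A new point of an extension determines an ultrafilter in uf(M), so uf(M) = ∅ suffices
(`p0Maximal`). An ultrafilter of `P₁` containing no atom extends to a nonprincipal ultrafilter D on
`List X`, so it suffices that every such D contains all the sets of one sequence. As no cardinal up
to μ is measurable, D drives some ℕ-valued function to infinity, and this function can be chosen
tame (`exists_tameFun_tendsto`). For a tame f, each node of level m of the binary tree carries two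
sets, one per direction, which cover {p | m < f p}. D picks a direction at every node it reaches,
hence a branch y, and the whole sequence of (f, y) lies in D (`exists_genSet_mem_ultrafilter`).

Independence. These sequences must not destroy the freeness demanded by K₁. The last entry of a
finite sequence can carry arbitrary finite patterns for finitely many indices at once
(`exists_independent_patterns`), and by tameness almost all one-step extensions of a typical point
do not increase f. With Dickson's lemma this gives `genSet_generic`: past some level, every infinite
cell is split freely by the tails.

Richness. Each `l : L` carries a request, a finite list of members of the algebra and a finite set
of points; its sequence starts with the list and goes on with fresh generic sets from which the
points are removed. Every request occurs infinitely often. Genericity survives this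
(`exists_cellGeneric`), and `exists_extension` then produces new sequences with any consistent
initial behaviour. This proves richness (`genModel_rich`). It also proves membership in K₁
(`exists_freeAbove`): to finitely many sequences one adjoins others whose initial patterns are
completely free and determine the old patterns, so that the quotient by `P₄` becomes a free algebra.
-/

/-! ### Boolean polynomials, cells and independence -/

/-- The cell `⋀_{i ∈ s} ± y i` with the signs prescribed by `v`. -/
def boolCell {ι B : Type*} [BooleanAlgebra B] (y : ι → B) (s : Finset ι) (v : ι → Bool) : B :=
  s.inf fun i => if v i then y i else (y i)ᶜ

namespace BTerm

theorem map_eval {ι : Type u} {A B : Type*} [BooleanAlgebra A] [BooleanAlgebra B]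
    (f : BoundedLatticeHom A B) (y : ι → A) (t : BTerm ι) :
    f (eval y t) = eval (fun i => f (y i)) t := by
  induction t with
  | var i => rfl
  | zero => simp [eval]
  | one => simp [eval]
  | meet s t hs ht => simp [eval, hs, ht]
  | join s t hs ht => simp [eval, hs, ht]
  | neg s hs => simp [eval, hs]

/-- The variables of a Boolean polynomial. -/
noncomputable def supp {ι : Type u} : BTerm ι → Finset ι
  | var i => {i}
  | zero => ∅
  | one => ∅
  | meet s t => open Classical in supp s ∪ supp t
  | join s t => open Classical in supp s ∪ supp t
  | neg s => supp s

/-- The Boolean polynomial whose value is a cell. -/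
noncomputable def cellTerm {ι : Type u} (s : Finset ι) (v : ι → Bool) : BTerm ι :=
  s.toList.foldr (fun i t => meet (if v i then var i else neg (var i)) t) one

theorem eval_cellTerm {ι : Type u} {B : Type*} [BooleanAlgebra B] (y : ι → B) (s : Finset ι)
    (v : ι → Bool) : eval y (cellTerm s v) = boolCell y s v := by
  have h : ∀ l : List ι, eval y (l.foldr (fun i t => meet (if v i then var i else neg (var i)) t)
      one) = l.foldr (fun i b => (if v i then y i else (y i)ᶜ) ⊓ b) ⊤ := by
    intro l
    induction l with
    | nil => rfl
    | cons i l ih =>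
      simp only [List.foldr_cons, eval, ih]
      split <;> rfl
  rw [cellTerm, h, boolCell, Finset.inf_def, ← Finset.coe_toList s, Finset.coe_toList]
  conv_rhs => rw [← Finset.coe_toList s]
  rw [Multiset.map_coe, Multiset.inf_coe, List.foldr_map]

theorem nontriv_cellTerm {ι : Type u} (s : Finset ι) (v : ι → Bool) : (cellTerm s v).Nontriv := by
  refine ⟨v, ?_⟩
  rw [eval_cellTerm, boolCell, Finset.inf_eq_top_iff]
  intro i _
  cases h : v i <;> simp

end BTerm

section Cells

variable {ι : Type u} {A B : Type*} [BooleanAlgebra A] [BooleanAlgebra B]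

theorem map_boolCell (f : BoundedLatticeHom A B) (y : ι → A) (s : Finset ι) (v : ι → Bool) :
    f (boolCell y s v) = boolCell (fun i => f (y i)) s v := by
  rw [← BTerm.eval_cellTerm, BTerm.map_eval, BTerm.eval_cellTerm]

theorem boolCell_le (y : ι → B) {s : Finset ι} {v : ι → Bool} {i : ι} (hi : i ∈ s) :
    boolCell y s v ≤ if v i then y i else (y i)ᶜ :=
  Finset.inf_le (f := fun i => if v i then y i else (y i)ᶜ) hi

theorem boolCell_anti (y : ι → B) {s t : Finset ι} (h : s ⊆ t) (v : ι → Bool) :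
    boolCell y t v ≤ boolCell y s v :=
  Finset.inf_mono h

theorem boolCell_congr (y : ι → B) {s : Finset ι} {v w : ι → Bool} (h : ∀ i ∈ s, v i = w i) :
    boolCell y s v = boolCell y s w :=
  Finset.inf_congr rfl fun i hi => by rw [h i hi]

theorem boolCell_mem (L : BooleanSubalgebra B) {y : ι → B} {s : Finset ι} (v : ι → Bool)
    (h : ∀ i ∈ s, y i ∈ L) : boolCell y s v ∈ L := by
  classical
  refine Finset.inf_induction (p := fun b => b ∈ L) BooleanSubalgebra.top_mem
    (fun a ha b hb => BooleanSubalgebra.inf_mem ha hb) fun i hi => ?_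
  split
  · exact h i hi
  · exact BooleanSubalgebra.compl_mem (h i hi)

theorem mem_boolCell {α : Type*} {y : ι → Set α} {s : Finset ι} {v : ι → Bool} {x : α} :
    x ∈ boolCell y s v ↔ ∀ i ∈ s, (x ∈ y i ↔ v i = true) := by
  classical
  unfold boolCell
  induction s using Finset.induction_on with
  | empty => simp
  | insert i s _ ih =>
    rw [Finset.inf_insert, Finset.forall_mem_insert, ← ih]
    refine (Set.mem_inter_iff _ _ _).trans (and_congr_left fun _ => ?_)
    cases v i <;> simp

/-- A cell fixes the sign of each of its variables, so it decides every polynomial in them. -/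
theorem boolCell_le_eval (y : ι → B) (t : BTerm ι) {s : Finset ι} (hs : t.supp ⊆ s)
    (v : ι → Bool) :
    (t.eval v = true → boolCell y s v ≤ t.eval y) ∧
      (t.eval v = false → boolCell y s v ≤ (t.eval y)ᶜ) := by
  classical
  induction t with
  | var i =>
    have h := boolCell_le y (v := v) (hs (Finset.mem_singleton_self i))
    constructor <;> intro hv <;> simp only [BTerm.eval] at hv ⊢ <;> simpa [hv] using h
  | zero => simp [BTerm.eval]
  | one => simp [BTerm.eval]
  | meet p q hp hq =>
    have h1 := hp ((Finset.subset_union_left).trans hs)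
    have h2 := hq ((Finset.subset_union_right).trans hs)
    simp only [BTerm.eval, compl_inf]
    cases h3 : p.eval v <;> cases h4 : q.eval v <;> simp only [h3, h4] at h1 h2 <;>
      simp_all [le_sup_of_le_left, le_sup_of_le_right]
  | join p q hp hq =>
    have h1 := hp ((Finset.subset_union_left).trans hs)
    have h2 := hq ((Finset.subset_union_right).trans hs)
    simp only [BTerm.eval, compl_sup]
    cases h3 : p.eval v <;> cases h4 : q.eval v <;> simp only [h3, h4] at h1 h2 <;>
      simp_all [le_sup_of_le_left, le_sup_of_le_right]
  | neg p hp =>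
    have h1 := hp hs
    simp only [BTerm.eval, compl_compl]
    cases h3 : p.eval v <;> simp only [h3] at h1 <;> simp_all

/-- An element lies in an ideal as soon as all its traces on the cells do. -/
theorem mem_of_inf_boolCell_mem {I : Set B} (hI : SupClosed I) (y : ι → B) (s : Finset ι) (a : B)
    (h : ∀ v, a ⊓ boolCell y s v ∈ I) : a ∈ I := by
  classical
  induction s using Finset.induction_on generalizing a with
  | empty => simpa [boolCell] using h fun _ => true
  | insert i s hi ih =>
    have key : ∀ b : Bool, a ⊓ (if b then y i else (y i)ᶜ) ∈ I := by
      intro b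
      refine ih _ fun v => ?_
      have := h (Function.update v i b)
      have e : boolCell y (insert i s) (Function.update v i b) =
          (if b then y i else (y i)ᶜ) ⊓ boolCell y s v := by
        rw [boolCell, Finset.inf_insert, Function.update_self]
        congr 1
        exact boolCell_congr y fun j hj => Function.update_of_ne (by rintro rfl; exact hi hj) _ _
      rwa [e, ← inf_assoc] at this
    have := hI (key true) (key false)
    simpa [← inf_sup_left] using this

/-- A polynomial is the join of the cells on which it is true. Applied to the ideals `{⊥}`, `P₄` and
the finite sets, this reduces the comparison of two algebras to a comparison of their cells. -/
theorem eval_mem_ideal_iff {I : Set B} (hlow : IsLowerSet I) (hsup : SupClosed I) (hbot : ⊥ ∈ I)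
    (y : ι → B) (t : BTerm ι) {s : Finset ι} (hs : t.supp ⊆ s) :
    t.eval y ∈ I ↔ ∀ v : ι → Bool, t.eval v = true → boolCell y s v ∈ I := by
  refine ⟨fun h v hv => hlow ((boolCell_le_eval y t hs v).1 hv) h, fun h => ?_⟩
  refine mem_of_inf_boolCell_mem hsup y s _ fun v => ?_
  cases hv : t.eval v with
  | true => exact hlow inf_le_right (h v hv)
  | false =>
    have : t.eval y ⊓ boolCell y s v ≤ ⊥ :=
      (inf_le_inf_left _ ((boolCell_le_eval y t hs v).2 hv)).trans (by simp)
    exact hlow this hbot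

theorem IndepMod.boolCell_inf_notMem {y : ι → B} {X I : Set B} (h : IndepMod y X I) {a : B}
    (ha : a ∈ BooleanSubalgebra.closure X) (haI : a ∉ I) (s : Finset ι) (v : ι → Bool) :
    boolCell y s v ⊓ a ∉ I := by
  rw [← BTerm.eval_cellTerm]
  exact h _ (BTerm.nontriv_cellTerm s v) a ha haI

theorem indepMod_of_boolCell {y : ι → B} {X I : Set B} (hlow : IsLowerSet I)
    (h : ∀ a ∈ BooleanSubalgebra.closure X, a ∉ I → ∀ s v, boolCell y s v ⊓ a ∉ I) :
    IndepMod y X I := by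
  rintro p ⟨v, hv⟩ a ha haI hm
  exact h a ha haI p.supp v
    (hlow (inf_le_inf_right _ ((boolCell_le_eval y p subset_rfl v).1 hv)) hm)

theorem exists_eval_eq {y : ι → B} {b : B}
    (hb : b ∈ BooleanSubalgebra.closure (Set.range y)) : ∃ t : BTerm ι, t.eval y = b := by
  induction hb using BooleanSubalgebra.closure_bot_sup_induction with
  | mem x hx =>
    obtain ⟨i, rfl⟩ := hx
    exact ⟨.var i, rfl⟩
  | bot => exact ⟨.zero, rfl⟩
  | sup x _ y _ hx hy =>
    obtain ⟨t, rfl⟩ := hx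
    obtain ⟨t', rfl⟩ := hy
    exact ⟨.join t t', rfl⟩
  | compl x _ hx =>
    obtain ⟨t, rfl⟩ := hx
    exact ⟨.neg t, rfl⟩

/-- Sikorski's extension criterion: a map on generators extends to a homomorphism if it respects
the vanishing of Boolean polynomials. -/
theorem exists_boundedLatticeHom_eval (g : ι → A) (f : ι → B)
    (hg : BooleanSubalgebra.closure (Set.range g) = ⊤)
    (h : ∀ t : BTerm ι, t.eval g = ⊥ → t.eval f = ⊥) :
    ∃ φ : BoundedLatticeHom A B, ∀ t : BTerm ι, φ (t.eval g) = t.eval f := by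
  have hle : ∀ t t' : BTerm ι, t.eval g ≤ t'.eval g → t.eval f ≤ t'.eval f := by
    intro t t' htt
    have := h (.meet t (.neg t')) (by
      simp only [BTerm.eval]
      rw [← sdiff_eq, sdiff_eq_bot_iff]
      exact htt)
    simp only [BTerm.eval] at this
    rwa [← sdiff_eq, sdiff_eq_bot_iff] at this
  have hs : ∀ a : A, ∃ t : BTerm ι, t.eval g = a := fun a =>
    exists_eval_eq (by rw [hg]; exact BooleanSubalgebra.mem_top)
  choose τ hτ using hs
  have hφ : ∀ t : BTerm ι, (τ (t.eval g)).eval f = t.eval f := fun t =>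
    le_antisymm (hle _ _ (hτ _).le) (hle _ _ (hτ _).ge)
  refine ⟨{ toFun := fun a => (τ a).eval f, map_sup' := ?_, map_inf' := ?_, map_top' := ?_,
            map_bot' := ?_ }, hφ⟩
  · intro a b
    have := hφ (.join (τ a) (τ b))
    simpa only [BTerm.eval, hτ] using this
  · intro a b
    have := hφ (.meet (τ a) (τ b))
    simpa only [BTerm.eval, hτ] using this
  · exact hφ .one
  · exact hφ .zero

theorem BoundedLatticeHom.ext_of_closure_eq_top {s : Set A}
    (hs : BooleanSubalgebra.closure s = ⊤) {f g : BoundedLatticeHom A B}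
    (h : ∀ a ∈ s, f a = g a) (a : A) : f a = g a := by
  have ha : a ∈ BooleanSubalgebra.closure s := by rw [hs]; exact BooleanSubalgebra.mem_top
  induction ha using BooleanSubalgebra.closure_bot_sup_induction with
  | mem x hx => exact h x hx
  | bot => simp
  | sup x _ y _ hx hy => simp [hx, hy]
  | compl x _ hx => simp [hx]

end Cells

/-- Hall's marriage theorem, applied to large enough finite subsets of the `A i`. -/
theorem exists_injective_of_forall_infinite {ι α : Type*} [Finite ι] (A : ι → Set α)
    (hA : ∀ i, (A i).Infinite) : ∃ f : ι → α, Function.Injective f ∧ ∀ i, f i ∈ A i := by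
  classical
  have := Fintype.ofFinite ι
  choose t ht htc using fun i => (hA i).exists_subset_card_eq (Fintype.card ι)
  obtain ⟨f, hf, hft⟩ := (Finset.all_card_le_biUnion_card_iff_exists_injective t).1 fun s => by
    obtain rfl | ⟨i, hi⟩ := s.eq_empty_or_nonempty
    · simp
    · exact (Finset.card_le_univ s).trans
        ((htc i).ge.trans (Finset.card_le_card (Finset.subset_biUnion_of_mem t hi)))
  exact ⟨f, hf, fun i => ht i (hft i)⟩

/-! ### Ultrafilters below the first measurable cardinal -/

/-- Without such a function D would be countably complete. The least size of a family of D-large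
sets with non-large intersection would then be uncountable and at most |X|, and a projection of D
would make it measurable. -/
theorem exists_nat_tendsto_of_not_measurable {X : Type u}
    (hX : ∀ κ : Cardinal.{u}, IsMeasurableCardinal κ → #X < κ) (D : Ultrafilter X)
    (hD : ∀ x, {x} ∉ D) : ∃ g : X → ℕ, ∀ n, {x | n ≤ g x} ∈ D := by
  classical
  by_contra! hg
  have hctbl : ∀ A : ℕ → Set X, (∀ n, A n ∈ D) → ⋂ n, A n ∈ D := by
    intro A hA
    by_contra hn
    rw [← Ultrafilter.compl_mem_iff_notMem] at hn
    -- The function takes x to the first k with x ∉ `A k`; off the intersection it is at least n on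
    -- every point of `A k` for all k < n.
    obtain ⟨n, hn'⟩ := hg fun x => if h : ∃ n, x ∉ A n then Nat.find h else 0
    refine hn' (Filter.mem_of_superset (Filter.inter_mem hn
      ((Filter.biInter_mem (Set.finite_lt_nat n)).2 fun k _ => hA k)) ?_)
    rintro x ⟨hx, hxn⟩
    have h : ∃ n, x ∉ A n := by simpa using hx
    simp only [Set.mem_ofPred_eq, dif_pos h, Nat.le_find_iff, not_not]
    intro m hm
    exact Set.mem_iInter₂.1 hxn m hm
  let P : Cardinal.{u} → Prop := fun c =>
    ∃ S : Set (Set X), #S = c ∧ (∀ s ∈ S, s ∈ D) ∧ ⋂₀ S ∉ D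
  have hPX : P #(Set.range fun x : X => ({x}ᶜ : Set X)) := by
    refine ⟨_, rfl, ?_, ?_⟩
    · rintro _ ⟨x, rfl⟩
      exact Ultrafilter.compl_mem_iff_notMem.2 (hD x)
    · have : ⋂₀ (Set.range fun x : X => ({x}ᶜ : Set X)) = ∅ := by
        ext x
        simp
      rw [this]
      exact D.empty_notMem
  obtain ⟨κ, ⟨S, hSκ, hSD, hS⟩, hmin⟩ := WellFounded.has_min Cardinal.lt_wf {c | P c} ⟨_, hPX⟩
  have hκX : κ ≤ #X := (not_lt.1 (hmin _ hPX)).trans mk_range_le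
  refine absurd hκX (not_le.2 (hX κ ⟨?_, ?_⟩))
  · by_contra hle
    rw [not_lt, ← hSκ, Cardinal.le_aleph0_iff_set_countable] at hle
    obtain rfl | hne := S.eq_empty_or_nonempty
    · exact hS (by rw [Set.sInter_empty]; exact Filter.univ_mem)
    · obtain ⟨A, rfl⟩ := hle.exists_eq_range hne
      refine hS ?_
      rw [Set.sInter_range]
      exact hctbl A fun n => hSD _ ⟨n, rfl⟩
  · have hDκ : CardinalInterFilter (D : Filter X) κ := by
      refine ⟨fun T hT hTD => ?_⟩
      by_contra hn
      exact hmin #T ⟨T, rfl, hTD, hn⟩ hT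
    have e : κ.out ≃ S := Cardinal.eq.1 (by rw [mk_out, hSκ]) |>.some
    have hne : Nonempty S := by
      by_contra h
      rw [not_nonempty_iff, Set.isEmpty_coe_sort] at h
      exact hS (by rw [h, Set.sInter_empty]; exact Filter.univ_mem)
    have : Nonempty κ.out := ⟨e.symm hne.some⟩
    -- A point goes to an index of a member of `S` that omits it. The fibre over i misses the
    -- D-large set `e i`, apart from points of the non-large set ⋂ S, so the image of D is
    -- nonprincipal; completeness passes to images.
    let f : X → κ.out := fun x =>
      if h : ∃ i, x ∉ (e i : Set X) then WellFounded.min (WellOrderingRel.isWellOrder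
        (α := κ.out)).toIsWellFounded.wf {i | x ∉ (e i : Set X)} h else Classical.arbitrary _
    refine ⟨D.map f, fun i hi => ?_, ?_⟩
    · rw [Ultrafilter.mem_map] at hi
      rw [← Ultrafilter.compl_mem_iff_notMem] at hS
      refine (Ultrafilter.compl_mem_iff_notMem.1 (Filter.mem_of_superset
        (Filter.inter_mem hi hS) ?_)) (hSD _ (e i).2)
      rintro x ⟨hx, hxS⟩
      have h : ∃ i, x ∉ (e i : Set X) := by
        simp only [Set.mem_compl_iff, Set.mem_sInter, not_forall] at hxS
        obtain ⟨s, hs, hxs⟩ := hxS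
        exact ⟨e.symm ⟨s, hs⟩, by simpa using hxs⟩
      have hfx : f x = i := hx
      simp only [f, dif_pos h] at hfx
      rw [← hfx]
      exact WellFounded.min_mem _ {i | x ∉ (e i : Set X)} h
    · rw [Ultrafilter.coe_map]
      infer_instance

/-! ### Independent patterns -/

/-- The Hausdorff construction of independent families. A point codes a finite set a, a finite
relation T and a number; its pattern at i is the set of t related by T to the trace of `e i` on a.
Once a separates finitely many sets `e i`, T can prescribe all their patterns, and the number gives
infinitely many such points. -/
theorem exists_independent_patterns {X I : Type u} [Infinite X] (hI : #I ≤ 2 ^ #X) :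
    ∃ pat : X → I → Finset ℕ, ∀ (s : Finset I) (W : I → Finset ℕ),
      {x | ∀ i ∈ s, pat x i = W i}.Infinite := by
  classical
  obtain ⟨e⟩ : Nonempty (I ↪ Set X) := by rwa [← Cardinal.le_def, mk_set]
  obtain ⟨code⟩ : Nonempty (X ≃ Finset X × Finset (Finset X × ℕ) × ℕ) := by
    rw [← Cardinal.eq]
    have h := aleph0_le_mk X
    simp [mk_finset_of_infinite, mul_eq_self h, mul_aleph0_eq h]
  refine ⟨fun x i => (((code x).2.1).filter fun z => z.1 = (code x).1.filter (· ∈ e i)).image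
    Prod.snd, fun s W => ?_⟩
  have hsep : ∀ z : I × I, ∃ a : X, z.1 ≠ z.2 → ¬ (a ∈ e z.1 ↔ a ∈ e z.2) := by
    rintro ⟨i, j⟩
    by_cases h : i = j
    · exact ⟨Classical.arbitrary X, fun h' => absurd h h'⟩
    · by_contra! hc
      exact h (e.injective (Set.ext fun a => (hc a).2))
  choose sep hsep using hsep
  let a : Finset X := (s ×ˢ s).image sep
  have ha : ∀ i ∈ s, ∀ j ∈ s, a.filter (· ∈ e i) = a.filter (· ∈ e j) → i = j := by
    intro i hi j hj hij
    by_contra hne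
    have hm : sep (i, j) ∈ a := Finset.mem_image_of_mem _ (Finset.mk_mem_product hi hj)
    have := congrArg (sep (i, j) ∈ ·) hij
    simp only [Finset.mem_filter, hm, true_and, eq_iff_iff] at this
    exact hsep (i, j) hne this
  let T : Finset (Finset X × ℕ) :=
    s.biUnion fun i => (W i).image fun t => (a.filter (· ∈ e i), t)
  refine (Set.infinite_range_of_injective (f := fun k : ℕ => code.symm (a, T, k)) ?_).mono ?_
  · intro k k' h
    simpa using h
  · rintro _ ⟨k, rfl⟩ i hi
    ext t
    simp only [Equiv.apply_symm_apply]
    constructor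
    · intro ht
      obtain ⟨z, hz, rfl⟩ := Finset.mem_image.1 ht
      obtain ⟨hzT, hz1⟩ := Finset.mem_filter.1 hz
      obtain ⟨j, hj, hzj⟩ := Finset.mem_biUnion.1 hzT
      obtain ⟨t, ht, rfl⟩ := Finset.mem_image.1 hzj
      rwa [← ha j hj i hi hz1]
    · intro ht
      exact Finset.mem_image.2 ⟨(a.filter (· ∈ e i), t), Finset.mem_filter.2
        ⟨Finset.mem_biUnion.2 ⟨i, hi, Finset.mem_image_of_mem _ ht⟩, rfl⟩, rfl⟩

/-! ### Tame functions on finite sequences -/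

/-- A function on finite sequences is tame if, except at finitely many sequences, it increases for
only finitely many one-step extensions. -/
def TameFun {X : Type u} (f : List X → ℕ) : Prop :=
  {p | {x | f p < f (x :: p)}.Infinite}.Finite

/-- The largest `k` for which `S k` is a suffix of `p`. -/
noncomputable def suffixLevel {X : Type u} (S : ℕ → List X) (p : List X) : ℕ :=
  open Classical in Nat.findGreatest (fun k => S k <:+ p) p.length

theorem suffixLevel_suffix {X : Type u} {S : ℕ → List X} {p : List X} (h : suffixLevel S p ≠ 0) :
    S (suffixLevel S p) <:+ p := by
  classical
  exact Nat.findGreatest_of_ne_zero (P := fun k => S k <:+ p) rfl h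

theorem le_suffixLevel {X : Type u} {S : ℕ → List X} {p : List X} {k : ℕ} (hk : k ≤ p.length)
    (h : S k <:+ p) : k ≤ suffixLevel S p := by
  classical
  exact Nat.le_findGreatest hk h

/-- Every nonprincipal ultrafilter on finite sequences makes some tame function tend to infinity,
if no cardinal up to the size of the alphabet is measurable. -/
theorem exists_tameFun_tendsto {X : Type u}
    (hX : ∀ κ : Cardinal.{u}, IsMeasurableCardinal κ → #X < κ) (D : Ultrafilter (List X))
    (hD : ∀ p, {p} ∉ D) : ∃ f : List X → ℕ, TameFun f ∧ ∀ n, {p | n ≤ f p} ∈ D := by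
  classical
  by_cases hne : Nonempty X
  swap
  · exfalso
    have hp : ∀ p : List X, p = [] := fun p => by
      cases p with
      | nil => rfl
      | cons x p => exact absurd ⟨x⟩ hne
    refine hD [] (Filter.mem_of_superset Filter.univ_mem fun p _ => hp p)
  by_cases h : ∀ s, {p | s <:+ p} ∈ D → ∃ x : X, {p | x :: s <:+ p} ∈ D
  -- The D-large cones follow an infinite branch `S`. The function measures how far a sequence
  -- agrees with the branch, so only the extension along the branch can raise it.
  · choose! nx hnx using h
    let S : ℕ → List X := fun k => Nat.rec [] (fun _ s => nx s :: s) k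
    have hS : ∀ k, {p | S k <:+ p} ∈ D := by
      intro k
      induction k with
      | zero => exact Filter.mem_of_superset Filter.univ_mem fun p _ => List.nil_suffix
      | succ k ih => exact hnx _ ih
    have hlen : ∀ k, (S k).length = k := by
      intro k
      induction k with
      | zero => rfl
      | succ k ih => simpa [S] using ih
    refine ⟨suffixLevel S, ?_, fun n => Filter.mem_of_superset (hS n) fun p hp => ?_⟩
    · refine Set.Finite.subset Set.finite_empty fun p hp => hp ?_
      refine Set.Subsingleton.finite ?_
      have key : ∀ x, suffixLevel S p < suffixLevel S (x :: p) → x :: p = S (p.length + 1) := by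
        intro x hx
        set k := suffixLevel S (x :: p) with hk
        have hk1 : S k <:+ x :: p := suffixLevel_suffix (by omega)
        rcases List.suffix_cons_iff.1 hk1 with h1 | h1
        · have : k = p.length + 1 := by rw [← hlen k, h1]; rfl
          rw [← this, h1]
        · exfalso
          have : k ≤ suffixLevel S p := le_suffixLevel (by
            have := h1.length_le
            rwa [hlen] at this) h1
          omega
      intro x hx y hy
      have := (key x hx).trans (key y hy).symm
      simpa using this
    · have h1 := List.IsSuffix.length_le hp
      rw [hlen] at h1
      exact le_suffixLevel h1 hp
  · push Not at h
    obtain ⟨s, hs, hsx⟩ := h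
    -- Here the cone of `s` is D-large but the cone of none of its children is. The entry following
    -- `s` therefore projects D to a nonprincipal ultrafilter on the alphabet.
    have hs' : {p | s <:+ p} ∩ {s}ᶜ ∈ D :=
      Filter.inter_mem hs (Ultrafilter.compl_mem_iff_notMem.2 (hD s))
    have hex : ∀ p, s <:+ p ∧ p ≠ s → ∃ x, x :: s <:+ p := by
      rintro p ⟨⟨t, rfl⟩, hps⟩
      obtain rfl | ⟨t', x, rfl⟩ := t.eq_nil_or_concat
      · simp at hps
      · exact ⟨x, t', by simp⟩
    choose! nx hnx using hex
    obtain ⟨g, hg⟩ := exists_nat_tendsto_of_not_measurable hX (D.map nx) fun x hx => by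
      rw [Ultrafilter.mem_map] at hx
      refine hsx x (Filter.mem_of_superset (Filter.inter_mem hx hs') ?_)
      rintro p ⟨hp1, hp2⟩
      have := hnx p hp2
      rwa [show nx p = x from hp1] at this
    -- Above `s` the entry following `s` does not change under extension, so `s` itself is the only
    -- possible exception to tameness.
    refine ⟨fun p => if s <:+ p ∧ p ≠ s then g (nx p) else 0, ?_, fun n => ?_⟩
    · refine (Set.finite_singleton s).subset fun p hp => ?_
      by_contra hps
      obtain ⟨x, hx⟩ := Set.Infinite.nonempty hp
      have hps : p ≠ s := hps
      simp only [Set.mem_ofPred_eq] at hx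
      by_cases hsp : s <:+ p
      · have h1 : s <:+ x :: p := hsp.trans (List.suffix_cons _ _)
        have h2 : x :: p ≠ s := by
          rintro rfl
          simpa using hsp.length_le
        have h3 : nx (x :: p) = nx p := by
          have a1 := hnx p ⟨hsp, hps⟩
          have a2 := hnx (x :: p) ⟨h1, h2⟩
          have := List.suffix_of_suffix_length_le (a1.trans (List.suffix_cons x p)) a2 (by simp)
          have := this.eq_of_length (by simp)
          simpa using this.symm
        rw [if_pos ⟨hsp, hps⟩, if_pos ⟨h1, h2⟩, h3] at hx
        exact lt_irrefl _ hx
      · have h1 : ¬ (s <:+ x :: p ∧ x :: p ≠ s) := by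
          rintro ⟨h1, h2⟩
          rcases List.suffix_cons_iff.1 h1 with h | h
          · exact h2 h.symm
          · exact hsp h
        rw [if_neg h1] at hx
        exact Nat.not_lt_zero _ hx
    · have := hg n
      rw [Ultrafilter.mem_map] at this
      refine Filter.mem_of_superset (Filter.inter_mem this hs') ?_
      rintro p ⟨hp1, hp2⟩
      change n ≤ ite _ _ _
      rw [if_pos (show s <:+ p ∧ p ≠ s from hp2)]
      exact hp1

/-! ### The generic sets -/

section GenericSets

variable {X L : Type u}

/-- The pattern attached to a finite sequence: that of its last entry. -/
def listPat {I : Type u} (pat : X → I → Finset ℕ) : List X → I → Finset ℕ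
  | [] => fun _ => ∅
  | x :: _ => pat x

/-- The code of a node of the binary tree together with a direction. -/
def nodeCode (m : ℕ) (s : Finset ℕ) (b : Bool) : ℕ := Encodable.encode (m, s, b)

/-- The node at level `m` of the branch `y`. -/
def branchNode (y : ℕ → Bool) (m : ℕ) : Finset ℕ := (Finset.range m).filter fun k => y k = true

/-- Indices of the killing sequences: a tame function and a branch of the binary tree. -/
abbrev KillIdx (X : Type u) : Type u := {f : List X → ℕ // TameFun f} × (ℕ → Bool)

/-- The sets from which the Boolean algebra is generated. For a killing index `(f, y)`, the two sets
attached to the two directions at a node of level `m` cover `{p | m < f p}`; otherwise all these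
sets are as independent as possible. -/
def genSet (pat : X → {f : List X → ℕ // TameFun f} ⊕ L → Finset ℕ) :
    KillIdx X ⊕ L → ℕ → Set (List X)
  | Sum.inl (f, y), m => {p |
      if y m = false then nodeCode m (branchNode y m) false ∈ listPat pat p (Sum.inl f)
      else if m < f.1 p then nodeCode m (branchNode y m) false ∉ listPat pat p (Sum.inl f)
      else nodeCode m (branchNode y m) true ∈ listPat pat p (Sum.inl f)}
  | Sum.inr l, m => {p | m ∈ listPat pat p (Sum.inr l)}

theorem nodeCode_inj {m m' : ℕ} {s s' : Finset ℕ} {b b' : Bool} :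
    nodeCode m s b = nodeCode m' s' b' ↔ m = m' ∧ s = s' ∧ b = b' := by
  simp [nodeCode]

variable (pat : X → {f : List X → ℕ // TameFun f} ⊕ L → Finset ℕ)

theorem mem_genSet_inl_of_le {f : {f : List X → ℕ // TameFun f}} {y : ℕ → Bool} {m : ℕ}
    {p : List X} (h : f.1 p ≤ m) : p ∈ genSet pat (Sum.inl (f, y)) m ↔
      nodeCode m (branchNode y m) (y m) ∈ listPat pat p (Sum.inl f) := by
  change ite _ _ _ ↔ _
  cases hy : y m <;> simp [not_lt.2 h]

theorem genSet_finite (i : KillIdx X ⊕ L) (p : List X) : {m | p ∈ genSet pat i m}.Finite := by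
  rcases i with ⟨f, y⟩ | l
  · have h2 : {m | nodeCode m (branchNode y m) (y m) ∈ listPat pat p (Sum.inl f)}.Finite :=
      Set.Finite.preimage (f := fun m => nodeCode m (branchNode y m) (y m))
        (fun m _ m' _ h => (nodeCode_inj.1 h).1) (Finset.finite_toSet _)
    refine ((Set.finite_lt_nat (f.1 p)).union h2).subset fun m hm => ?_
    by_cases h : m < f.1 p
    · exact Or.inl h
    · exact Or.inr ((mem_genSet_inl_of_le pat (not_lt.1 h)).1 hm)
  · exact Finset.finite_toSet (listPat pat p (Sum.inr l))

/-- At each node D contains the set of the first direction or its complement. In the second case the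
complement, cut down to the D-large set where f exceeds the level, lies in the set of the second
direction. -/
theorem exists_genSet_mem_ultrafilter
    (hX : ∀ κ : Cardinal.{u}, IsMeasurableCardinal κ → #X < κ) (D : Ultrafilter (List X))
    (hD : ∀ p, {p} ∉ D) : ∃ i : KillIdx X, ∀ m, genSet pat (Sum.inl i) m ∈ D := by
  classical
  obtain ⟨f, hf, hfD⟩ := exists_tameFun_tendsto hX D hD
  let A : ℕ → Finset ℕ → Set (List X) := fun m s =>
    {p | nodeCode m s false ∈ listPat pat p (Sum.inl ⟨f, hf⟩)}
  -- The nodes are computed by recursion from the decisions of D; `hnode` identifies them with the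
  -- nodes of the branch `y` that they define.
  let node : ℕ → Finset ℕ := fun k => Nat.rec ∅ (fun m s => if A m s ∈ D then s else insert m s) k
  let y : ℕ → Bool := fun m => if A m (node m) ∈ D then false else true
  have hnode : ∀ m, branchNode y m = node m := by
    intro m
    induction m with
    | zero => rfl
    | succ m ih =>
      have h1 : node (m + 1) = if A m (node m) ∈ D then node m else insert m (node m) := rfl
      rw [h1, branchNode, Finset.range_add_one, Finset.filter_insert]
      change (if y m = true then insert m (branchNode y m) else branchNode y m) = _
      rw [ih]
      by_cases h : A m (node m) ∈ D <;> simp [y, h]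
  refine ⟨(⟨f, hf⟩, y), fun m => ?_⟩
  by_cases h : A m (node m) ∈ D
  · refine Filter.mem_of_superset h fun p hp => ?_
    have hy : y m = false := if_pos h
    change ite _ _ _
    rw [if_pos hy, hnode]
    exact hp
  · have hy : y m = true := if_neg h
    refine Filter.mem_of_superset (Filter.inter_mem (Ultrafilter.compl_mem_iff_notMem.2 h)
      (hfD (m + 1))) ?_
    rintro p ⟨hp1, hp2⟩
    change ite _ _ _
    have hp2 : m < f p := hp2
    rw [if_neg (by simp [hy]), if_pos hp2, hnode]
    exact hp1

end GenericSets

/-! ### Genericity and independence of the generating sets -/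

section Generic

variable {X L : Type u}

/-- Dickson's lemma: the value vectors have only finitely many minimal elements. -/
theorem exists_bound_of_minimal {α ι : Type*} [Finite ι] (F : α → ι → ℕ) (S : Set α) :
    ∃ N, ∀ p ∈ S, ∃ p₀ ∈ S, F p₀ ≤ F p ∧ ∀ i, F p₀ i ≤ N := by
  have hfin : {a | Minimal (· ∈ F '' S) a}.Finite :=
    (setOfPred_minimal_antichain _).finite_of_wellQuasiOrdered wellQuasiOrdered_le
  obtain ⟨N, hN⟩ := (hfin.biUnion fun a _ => Set.finite_range a).bddAbove
  refine ⟨N, fun p hp => ?_⟩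
  obtain ⟨b, hb, hmin⟩ := exists_minimal_le_of_wellFoundedLT (· ∈ F '' S) (F p) ⟨p, hp, rfl⟩
  obtain ⟨p₀, hp₀, rfl⟩ := hmin.prop
  exact ⟨p₀, hp₀, hb, fun i => hN (Set.mem_biUnion (show F p₀ ∈ _ from hmin) ⟨i, rfl⟩)⟩

/-- Distinct branches part at a finite level. From there on their nodes have different codes, so
sequences with the same tame function can be prescribed separately. -/
theorem exists_branchNode_separation (u : Finset (KillIdx X)) :
    ∃ n, ∀ m ≥ n, ∀ ζ ∈ u, ∀ ζ' ∈ u, ζ.1 = ζ'.1 → branchNode ζ.2 m = branchNode ζ'.2 m →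
      ζ = ζ' := by
  classical
  have hsep : ∀ z : KillIdx X × KillIdx X, ∃ k, z.1.2 ≠ z.2.2 → z.1.2 k ≠ z.2.2 k := by
    rintro ⟨⟨f, y⟩, ⟨f', y'⟩⟩
    by_cases h : y = y'
    · exact ⟨0, fun h' => absurd h h'⟩
    · obtain ⟨k, hk⟩ := Function.ne_iff.1 h
      exact ⟨k, fun _ => hk⟩
  choose k hk using hsep
  refine ⟨(u ×ˢ u).sup k + 1, fun m hm ζ hζ ζ' hζ' h1 h2 => Prod.ext h1 ?_⟩
  by_contra hne
  have hkm : k (ζ, ζ') < m :=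
    lt_of_lt_of_le (Nat.lt_succ_of_le (Finset.le_sup (Finset.mk_mem_product hζ hζ'))) hm
  refine hk (ζ, ζ') hne ?_
  have := congrArg (k (ζ, ζ') ∈ ·) h2
  simp only [branchNode, Finset.mem_filter, Finset.mem_range, hkm, true_and, eq_iff_iff] at this
  exact Bool.eq_iff_iff.2 this

variable (pat : X → {f : List X → ℕ // TameFun f} ⊕ L → Finset ℕ)

/-- Beyond some level, any infinite cell of finitely many killing sequences contains infinitely many
points realizing any prescribed finite patterns. -/
theorem genSet_generic
    (hpat : ∀ (s : Finset ({f : List X → ℕ // TameFun f} ⊕ L)) (W : _ → Finset ℕ),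
      {x | ∀ i ∈ s, pat x i = W i}.Infinite) (u : Finset (KillIdx X)) :
    ∃ n₀, ∀ n ≥ n₀, ∀ q,
      {p | ∀ ζ ∈ u, ∀ m < n, (p ∈ genSet pat (.inl ζ) m ↔ q ∈ genSet pat (.inl ζ) m)}.Infinite →
      ∀ (v : Finset L) (w : KillIdx X ⊕ L → Finset ℕ),
      {p | (∀ ζ ∈ u, ∀ m < n, (p ∈ genSet pat (.inl ζ) m ↔ q ∈ genSet pat (.inl ζ) m)) ∧
        (∀ ζ ∈ u, ∀ m ≥ n, (p ∈ genSet pat (.inl ζ) m ↔ m ∈ w (.inl ζ))) ∧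
        ∀ l ∈ v, ∀ m, (p ∈ genSet pat (.inr l) m ↔ m ∈ w (.inr l))}.Infinite := by
  classical
  let u₁ : Finset {f : List X → ℕ // TameFun f} := u.image Prod.fst
  have hu₁ : ∀ ζ ∈ u, ζ.1 ∈ u₁ := fun ζ hζ => Finset.mem_image_of_mem _ hζ
  -- The exceptional points of the tame functions involved; finitely many, so an infinite cell has a
  -- point outside.
  let E : Set (List X) := ⋃ ξ ∈ u₁, {p | {x | ξ.1 p < ξ.1 (x :: p)}.Infinite}
  have hE : E.Finite := u₁.finite_toSet.biUnion fun ξ _ => ξ.2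
  obtain ⟨N, hN⟩ := exists_bound_of_minimal (fun (p : List X) (ξ : u₁) => ξ.1.1 p) Eᶜ
  obtain ⟨n₁, hn₁⟩ := exists_branchNode_separation u
  -- `N` bounds the tame functions at the point `p₀` that will be extended, uniformly in the cell;
  -- `n₁` separates the branches.
  refine ⟨max N n₁, fun n hn q hinf v w => ?_⟩
  obtain ⟨p, hpq, hpE⟩ := (hinf.sdiff hE).nonempty
  obtain ⟨p₀, hp₀E, hle, hp₀N⟩ := hN p hpE
  have hle : ∀ ξ ∈ u₁, ξ.1 p₀ ≤ ξ.1 p := fun ξ hξ => hle ⟨ξ, hξ⟩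
  have hp₀N : ∀ ξ ∈ u₁, ξ.1 p₀ ≤ n := fun ξ hξ =>
    (hp₀N ⟨ξ, hξ⟩).trans ((le_max_left _ _).trans hn)
  let Bad : Set X := ⋃ ξ ∈ u₁, {x | ξ.1 p₀ < ξ.1 (x :: p₀)}
  have hBad : Bad.Finite := u₁.finite_toSet.biUnion fun ξ hξ => by
    by_contra h
    exact hp₀E (Set.mem_biUnion hξ h)
  -- The codes that the new entry x must carry at ξ. Below level n they reproduce the cell of `p`.
  -- As ξ may be smaller at `x :: p₀` than at `p`, the second direction may now be read from its own
  -- code where at `p` it was read as the negation of the first; its code is therefore set to that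
  -- negation. From level n on the codes realize `w`.
  let S : {f : List X → ℕ // TameFun f} → Set ℕ := fun ξ => {k | ∃ m s b, k = nodeCode m s b ∧
    ((m < n ∧ s ⊆ Finset.range m ∧ (if b = true ∧ m < ξ.1 p
        then nodeCode m s false ∉ listPat pat p (.inl ξ)
        else nodeCode m s b ∈ listPat pat p (.inl ξ))) ∨
      (n ≤ m ∧ ∃ y, (ξ, y) ∈ u ∧ s = branchNode y m ∧ b = y m ∧ m ∈ w (.inl (ξ, y))))}
  have hS : ∀ ξ, (S ξ).Finite := by
    intro ξ
    refine (((Finset.range n ×ˢ (Finset.range n).powerset ×ˢ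
      (Finset.univ : Finset Bool)).finite_toSet.image fun z => nodeCode z.1 z.2.1 z.2.2).union
      (u.finite_toSet.biUnion fun ζ _ => (w (.inl ζ)).finite_toSet.image fun m =>
        nodeCode m (branchNode ζ.2 m) (ζ.2 m))).subset ?_
    rintro _ ⟨m, s, b, rfl, ⟨hm, hs, -⟩ | ⟨-, y, hy, rfl, rfl, hmw⟩⟩
    · refine Or.inl ⟨(m, s, b), ?_, rfl⟩
      simp only [Finset.coe_product, Set.mem_prod, Finset.mem_coe, Finset.mem_range, hm,
        Finset.mem_powerset, Finset.mem_univ, and_true, true_and]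
      exact hs.trans (Finset.range_mono hm.le)
    · exact Or.inr (Set.mem_biUnion (Finset.mem_coe.2 hy) ⟨m, hmw, rfl⟩)
  have hSlt : ∀ ξ y m b, m < n → (nodeCode m (branchNode y m) b ∈ S ξ ↔
      (if b = true ∧ m < ξ.1 p then nodeCode m (branchNode y m) false ∉ listPat pat p (.inl ξ)
        else nodeCode m (branchNode y m) b ∈ listPat pat p (.inl ξ))) := by
    intro ξ y m b hm
    constructor
    · rintro ⟨m', s, b', he, h⟩
      obtain ⟨rfl, rfl, rfl⟩ := nodeCode_inj.1 he
      rcases h with h | h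
      · exact h.2.2
      · exact absurd h.1 (not_le.2 hm)
    · intro h
      exact ⟨m, _, b, rfl, Or.inl ⟨hm, Finset.filter_subset _ _, h⟩⟩
  have hSge : ∀ ξ y m, (ξ, y) ∈ u → n ≤ m →
      (nodeCode m (branchNode y m) (y m) ∈ S ξ ↔ m ∈ w (.inl (ξ, y))) := by
    intro ξ y m hy hm
    constructor
    · rintro ⟨m', s, b', he, h⟩
      obtain ⟨rfl, rfl, rfl⟩ := nodeCode_inj.1 he
      rcases h with h | ⟨-, y', hy', h1, -, h3⟩
      · exact absurd h.1 (not_lt.2 hm)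
      · have := hn₁ m (((le_max_right _ _).trans hn).trans hm) _ hy _ hy' rfl h1
        rwa [this]
    · intro h
      exact ⟨m, _, _, rfl, Or.inr ⟨hm, y, hy, rfl, rfl, h⟩⟩
  let W : {f : List X → ℕ // TameFun f} ⊕ L → Finset ℕ :=
    Sum.elim (fun ξ => (hS ξ).toFinset) fun l => w (.inr l)
  have hx := (hpat (u₁.disjSum v) W).sdiff hBad
  refine (hx.image (f := fun x => x :: p₀) ?_).mono ?_
  · intro x _ x' _ h
    simpa using h
  · rintro _ ⟨x, ⟨hxW, hxB⟩, rfl⟩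
    have hxξ : ∀ ξ ∈ u₁, ∀ k, (k ∈ listPat pat (x :: p₀) (.inl ξ) ↔ k ∈ S ξ) := by
      intro ξ hξ k
      have h : pat x (.inl ξ) = (hS ξ).toFinset :=
        hxW (.inl ξ) (Finset.inl_mem_disjSum.2 hξ)
      change k ∈ pat x (.inl ξ) ↔ _
      rw [h, Set.Finite.mem_toFinset]
    have hxle : ∀ ξ ∈ u₁, ξ.1 (x :: p₀) ≤ ξ.1 p₀ := by
      intro ξ hξ
      by_contra h
      exact hxB (Set.mem_biUnion hξ (not_le.1 h))
    refine ⟨?_, ?_, ?_⟩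
    · rintro ⟨ξ, y⟩ hζ m hm
      rw [← hpq _ hζ m hm]
      have hξ := hu₁ _ hζ
      have hξle : ξ.1 (x :: p₀) ≤ ξ.1 p := (hxle ξ hξ).trans (hle ξ hξ)
      change ite _ _ _ ↔ ite _ _ _
      rw [hxξ ξ hξ, hxξ ξ hξ, hSlt ξ y m _ hm, hSlt ξ y m _ hm]
      by_cases hy : y m = false
      · simp [hy]
      · by_cases h1 : m < ξ.1 (x :: p₀)
        · simp [hy, h1, h1.trans_le hξle]
        · by_cases h2 : m < ξ.1 p <;> simp [hy, h1, h2]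
    · rintro ⟨ξ, y⟩ hζ m hm
      have hξ := hu₁ _ hζ
      rw [mem_genSet_inl_of_le pat (((hxle ξ hξ).trans (hp₀N ξ hξ)).trans hm), hxξ ξ hξ,
        hSge ξ y m hζ hm]
    · intro l hl m
      have h : pat x (.inr l) = w (.inr l) := hxW (.inr l) (Finset.inr_mem_disjSum.2 hl)
      change m ∈ pat x (.inr l) ↔ _
      rw [h]

/-- A sequence of sets is independent modulo the ideal of finite sets. -/
def SeqIndep {P : Type u} (f : ℕ → Set P) : Prop :=
  ∀ (n : ℕ) (η : ℕ → Prop), {p | ∀ m < n, (p ∈ f m ↔ η m)}.Infinite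

/-- One-entry sequences suffice. The value of the tame function there is unknown, so the codes of
both directions are set such that either reading gives η. -/
theorem genSet_seqIndep
    (hpat : ∀ (s : Finset ({f : List X → ℕ // TameFun f} ⊕ L)) (W : _ → Finset ℕ),
      {x | ∀ i ∈ s, pat x i = W i}.Infinite) (i : KillIdx X ⊕ L) : SeqIndep (genSet pat i) := by
  classical
  intro n η
  rcases i with ⟨ξ, y⟩ | l
  · let S : Finset ℕ := (((Finset.range n).filter fun m => y m = false ↔ η m).image fun m =>
        nodeCode m (branchNode y m) false) ∪ (((Finset.range n).filter fun m => η m).image fun m =>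
        nodeCode m (branchNode y m) true)
    have hf : ∀ m < n, (nodeCode m (branchNode y m) false ∈ S ↔ (y m = false ↔ η m)) := by
      intro m hm
      simp only [S, Finset.mem_union, Finset.mem_image, Finset.mem_filter, Finset.mem_range,
        nodeCode_inj]
      constructor
      · rintro (⟨m', ⟨-, h⟩, rfl, -⟩ | ⟨m', -, -, -, h⟩)
        · exact h
        · cases h
      · exact fun h => Or.inl ⟨m, ⟨hm, h⟩, rfl, rfl, trivial⟩
    have ht : ∀ m < n, (nodeCode m (branchNode y m) true ∈ S ↔ η m) := by
      intro m hm
      simp only [S, Finset.mem_union, Finset.mem_image, Finset.mem_filter, Finset.mem_range,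
        nodeCode_inj]
      constructor
      · rintro (⟨m', -, -, -, h⟩ | ⟨m', ⟨-, h⟩, rfl, -⟩)
        · cases h
        · exact h
      · exact fun h => Or.inr ⟨m, ⟨hm, h⟩, rfl, rfl, trivial⟩
    refine ((hpat {.inl ξ} fun _ => S).image (f := fun x => [x]) ?_).mono ?_
    · intro x _ x' _ h
      simpa using h
    · rintro _ ⟨x, hx, rfl⟩ m hm
      have hx : listPat pat [x] (.inl ξ) = S := hx _ (Finset.mem_singleton_self _)
      change ite _ _ _ ↔ _
      rw [hx, hf m hm, ht m hm]
      by_cases hy : y m = false <;> simp [hy]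
  · refine ((hpat {.inr l} fun _ => (Finset.range n).filter fun m => η m).image
      (f := fun x => [x]) ?_).mono ?_
    · intro x _ x' _ h
      simpa using h
    · rintro _ ⟨x, hx, rfl⟩ m hm
      have hx : pat x (.inr l) = _ := hx _ (Finset.mem_singleton_self _)
      change m ∈ pat x (.inr l) ↔ _
      simp [hx, hm]

end Generic

/-! ### Finitely determined sets -/

theorem exists_infinite_fiber {α β : Type*} [Finite β] (f : α → β) {s : Set α} (hs : s.Infinite) :
    ∃ p ∈ s, {p' ∈ s | f p' = f p}.Infinite := by
  by_contra! h
  refine hs ((Set.finite_iUnion (f := fun b : β => {p ∈ s | f p = b}) fun b => ?_).subset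
    fun p hp => Set.mem_iUnion.2 ⟨f p, hp, rfl⟩)
  by_cases hb : ∃ p ∈ s, f p = b
  · obtain ⟨p, hp, rfl⟩ := hb
    exact h p hp
  · refine Set.finite_empty.subset fun p hp => hb ⟨p, hp.1, hp.2⟩

/-- Such a set is the union of the cells of `Y` that it contains. -/
theorem BooleanSubalgebra.mem_of_finite_determined {P : Type u} (A : BooleanSubalgebra (Set P))
    {Y : Set (Set P)} (hY : Y.Finite) (hYA : Y ⊆ A) {b : Set P}
    (h : ∀ p p', (∀ y ∈ Y, (p ∈ y ↔ p' ∈ y)) → p ∈ b → p' ∈ b) : b ∈ A := by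
  classical
  let cell : (Y → Bool) → Set P := fun v => ⋂ y : Y, if v y then (y : Set P) else (y : Set P)ᶜ
  have : Finite Y := hY
  have hcell : ∀ v, cell v ∈ A := by
    intro v
    refine BooleanSubalgebra.iInf_mem fun y => ?_
    split
    · exact hYA y.2
    · exact BooleanSubalgebra.compl_mem (hYA y.2)
  have hself : ∀ p, p ∈ cell fun y => decide (p ∈ (y : Set P)) := by
    intro p
    simp only [cell, Set.mem_iInter]
    intro y
    by_cases hp : p ∈ (y : Set P) <;> simp [hp]
  have hb : b = ⋃ v : {v : Y → Bool // cell v ⊆ b}, cell v := by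
    refine Set.Subset.antisymm (fun p hp => Set.mem_iUnion.2 ⟨⟨_, fun p' hp' => ?_⟩, hself p⟩)
      (Set.iUnion_subset fun v => v.2)
    refine h p p' (fun y hy => ?_) hp
    have hy' : p' ∈ if decide (p ∈ y) = true then y else yᶜ := Set.mem_iInter.1 hp' ⟨y, hy⟩
    by_cases hpy : p ∈ y
    · rw [if_pos (decide_eq_true hpy)] at hy'
      exact iff_of_true hpy hy'
    · rw [if_neg (by simpa using hpy)] at hy'
      exact iff_of_false hpy hy'
  rw [hb]
  exact BooleanSubalgebra.iSup_mem fun v => hcell v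

/-! ### The Boolean algebra and the sequences of the model -/

section Model

variable {P Z L : Type u}

/-- The algebra generated by the singletons and the sets `H i m`. -/
def genAlg (H : Z ⊕ L → ℕ → Set P) : BooleanSubalgebra (Set P) :=
  BooleanSubalgebra.closure (Set.range (fun p : P => ({p} : Set P)) ∪
    Set.range fun i : (Z ⊕ L) × ℕ => H i.1 i.2)

variable (H : Z ⊕ L → ℕ → Set P)

theorem singleton_mem_genAlg (p : P) : {p} ∈ genAlg H :=
  BooleanSubalgebra.subset_closure (Or.inl ⟨p, rfl⟩)

theorem gen_mem_genAlg (i : Z ⊕ L) (m : ℕ) : H i m ∈ genAlg H :=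
  BooleanSubalgebra.subset_closure (Or.inr ⟨(i, m), rfl⟩)

theorem finite_mem_genAlg {s : Set P} (hs : s.Finite) : s ∈ genAlg H := by
  have := BooleanSubalgebra.biSup_mem (L := genAlg H) (f := fun p => ({p} : Set P)) hs
    fun p _ => singleton_mem_genAlg H p
  simpa using this

/-- Every member of the algebra is determined, up to finitely many points, by finitely many of the
generating sets. -/
theorem genAlg_determined {b : Set P} (hb : b ∈ genAlg H) :
    ∃ (W : Finset ((Z ⊕ L) × ℕ)) (E : Set P), E.Finite ∧ ∀ p ∉ E, ∀ p' ∉ E,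
      (∀ i ∈ W, (p ∈ H i.1 i.2 ↔ p' ∈ H i.1 i.2)) → (p ∈ b ↔ p' ∈ b) := by
  classical
  induction hb using BooleanSubalgebra.closure_bot_sup_induction with
  | mem x hx =>
    rcases hx with ⟨q, rfl⟩ | ⟨i, rfl⟩
    · refine ⟨∅, {q}, Set.finite_singleton q, fun p hp p' hp' _ => ?_⟩
      exact iff_of_false hp hp'
    · exact ⟨{i}, ∅, Set.finite_empty, fun p _ p' _ h => h i (Finset.mem_singleton_self i)⟩
  | bot => exact ⟨∅, ∅, Set.finite_empty, fun p _ p' _ _ => Iff.rfl⟩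
  | sup x _ y _ hx hy =>
    obtain ⟨W, E, hE, h⟩ := hx
    obtain ⟨W', E', hE', h'⟩ := hy
    refine ⟨W ∪ W', E ∪ E', hE.union hE', fun p hp p' hp' hpp => ?_⟩
    exact or_congr
      (h p (fun hh => hp (Or.inl hh)) p' (fun hh => hp' (Or.inl hh))
        fun i hi => hpp i (Finset.mem_union_left _ hi))
      (h' p (fun hh => hp (Or.inr hh)) p' (fun hh => hp' (Or.inr hh))
        fun i hi => hpp i (Finset.mem_union_right _ hi))
  | compl x _ hx =>
    obtain ⟨W, E, hE, h⟩ := hx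
    exact ⟨W, E, hE, fun p hp p' hp' hpp => not_congr (h p hp p' hp' hpp)⟩

/-- The sequence with initial segment `r.1`, continued by the sets `H (inr l)` without the
points of `r.2`. -/
def shiftedSeq (r : List (genAlg H) × Finset P) (l : L) (m : ℕ) : Set P :=
  if h : m < r.1.length then (r.1[m] : Set P) else H (.inr l) (m - r.1.length) \ r.2

/-- The request at `l`, if it leads to an independent sequence, and the trivial request
otherwise. -/
noncomputable def effReq (req : L → List (genAlg H) × Finset P) (l : L) :
    List (genAlg H) × Finset P :=
  open Classical in if SeqIndep (shiftedSeq H (req l) l) then req l else ([], ∅)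

variable (req : L → List (genAlg H) × Finset P)

/-- The sequences `(F_m(c))_m` of the model. -/
noncomputable def modelF : Z ⊕ L → ℕ → Set P
  | .inl z => H (.inl z)
  | .inr l => shiftedSeq H (effReq H req l) l

/-- The properties of the generating sets on which the construction rests. -/
structure GenericFamily : Prop where
  finite : ∀ i p, {m | p ∈ H i m}.Finite
  seqIndep : ∀ i, SeqIndep (H i)
  generic : ∀ u : Finset Z, ∃ n₀, ∀ n ≥ n₀, ∀ q,
    {p | ∀ ζ ∈ u, ∀ m < n, (p ∈ H (.inl ζ) m ↔ q ∈ H (.inl ζ) m)}.Infinite →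
    ∀ (v : Finset L) (w : Z ⊕ L → Finset ℕ),
    {p | (∀ ζ ∈ u, ∀ m < n, (p ∈ H (.inl ζ) m ↔ q ∈ H (.inl ζ) m)) ∧
      (∀ ζ ∈ u, ∀ m ≥ n, (p ∈ H (.inl ζ) m ↔ m ∈ w (.inl ζ))) ∧
      ∀ l ∈ v, ∀ m, (p ∈ H (.inr l) m ↔ m ∈ w (.inr l))}.Infinite

theorem shiftedSeq_nil (l : L) : shiftedSeq H ([], ∅) l = H (.inr l) := by
  funext m
  simp [shiftedSeq]

theorem shiftedSeq_of_ge {r : List (genAlg H) × Finset P} {l : L} {m : ℕ} (h : r.1.length ≤ m) :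
    shiftedSeq H r l m = H (.inr l) (m - r.1.length) \ r.2 :=
  dif_neg (not_lt.2 h)

/-- A request is honoured only if it leads to an independent sequence; otherwise the generating
sequence itself is used. -/
theorem modelF_seqIndep (hH : GenericFamily H) (c : Z ⊕ L) : SeqIndep (modelF H req c) := by
  rcases c with z | l
  · exact hH.seqIndep _
  · change SeqIndep (shiftedSeq H (effReq H req l) l)
    rw [effReq]
    split
    · assumption
    · rw [shiftedSeq_nil]
      exact hH.seqIndep _

theorem modelF_mem_genAlg (c : Z ⊕ L) (m : ℕ) : modelF H req c m ∈ genAlg H := by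
  rcases c with z | l
  · exact gen_mem_genAlg H _ _
  · change shiftedSeq H (effReq H req l) l m ∈ _
    unfold shiftedSeq
    split
    · exact Subtype.prop _
    · exact BooleanSubalgebra.sdiff_mem (gen_mem_genAlg H _ _)
        (finite_mem_genAlg H (Finset.finite_toSet _))

theorem modelF_finite (hH : GenericFamily H) (c : Z ⊕ L) (p : P) :
    {m | p ∈ modelF H req c m}.Finite := by
  rcases c with z | l
  · exact hH.finite _ p
  · refine ((Set.finite_lt_nat (effReq H req l).1.length).union
      ((hH.finite (.inr l) p).image fun m => m + (effReq H req l).1.length)).subset fun m hm => ?_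
    by_cases h : m < (effReq H req l).1.length
    · exact Or.inl h
    · have hm : p ∈ shiftedSeq H (effReq H req l) l m := hm
      rw [shiftedSeq_of_ge H (not_lt.1 h)] at hm
      exact Or.inr ⟨_, hm.1, by dsimp only; omega⟩

/-- The points agreeing with `q` about the first `n` sets of the sequences in `T`. -/
def cellOf {C : Type u} (F : C → ℕ → Set P) (T : Finset C) (n : ℕ) (q : P) : Set P :=
  {p | ∀ c ∈ T, ∀ m < n, (p ∈ F c m ↔ q ∈ F c m)}

/-- Every infinite cell contains infinitely many points with prescribed finite patterns, both
for the tails of the sequences in `T` and for new generating sets. -/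
def CellGeneric (T : Finset (Z ⊕ L)) (V : Finset L) (n : ℕ) : Prop :=
  ∀ q, (cellOf (modelF H req) T n q).Infinite → ∀ v : Finset L, Disjoint v V →
    ∀ (w : Z ⊕ L → Finset ℕ) (w' : L → Finset ℕ),
    {p ∈ cellOf (modelF H req) T n q |
      (∀ c ∈ T, ∀ m ≥ n, (p ∈ modelF H req c m ↔ m ∈ w c)) ∧
      ∀ l ∈ v, ∀ m, (p ∈ H (.inr l) m ↔ m ∈ w' l)}.Infinite

/-- Up to finitely many points, the initial segments of the sequences in `T` depend on finitely many
generating sets. Keeping these fixed, one transfers the genericity of `H`; the remaining terms are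
shifted generating sets up to finitely many points. `V` collects the indices whose generating sets
are no longer free. -/
theorem exists_cellGeneric (hH : GenericFamily H) (T : Finset (Z ⊕ L)) :
    ∃ (V : Finset L) (n₀ : ℕ), (∀ l, .inr l ∈ T → l ∈ V) ∧
      ∀ n ≥ n₀, CellGeneric H req T V n := by
  classical
  have hdet : ∀ b : genAlg H, ∃ (W : Finset ((Z ⊕ L) × ℕ)) (E : Set P), E.Finite ∧
      ∀ p ∉ E, ∀ p' ∉ E, (∀ i ∈ W, (p ∈ H i.1 i.2 ↔ p' ∈ H i.1 i.2)) →
        (p ∈ (b : Set P) ↔ p' ∈ (b : Set P)) := fun b => genAlg_determined H b.2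
  choose W E hE hdet using hdet
  let len : L → ℕ := fun l => (effReq H req l).1.length
  let TL : Finset L := T.toRight
  let W₀ : Finset ((Z ⊕ L) × ℕ) := TL.biUnion fun l => (effReq H req l).1.toFinset.biUnion W
  let I : Finset (Z ⊕ L) := T ∪ W₀.image Prod.fst
  obtain ⟨n₁, hn₁⟩ := hH.generic I.toLeft
  have hTL : ∀ l, .inr l ∈ T → l ∈ TL := fun l hl => Finset.mem_toRight.2 hl
  let EE : Set P := ⋃ l ∈ TL, ((⋃ b ∈ (effReq H req l).1.toFinset, E b) ∪ (effReq H req l).2)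
  have hEE : EE.Finite := TL.finite_toSet.biUnion fun l _ =>
    ((Finset.finite_toSet _).biUnion fun b _ => hE b).union (Finset.finite_toSet _)
  -- The generating sets in `W₀` may belong to sequences of `T` themselves. The level is so high
  -- that they then lie below n - len l, where the generating sets are copied from `p₀`.
  refine ⟨I.toRight, max n₁ (W₀.sup Prod.snd + TL.sup len + 1), fun l hl =>
    Finset.mem_toRight.2 (Finset.mem_union_left _ hl), fun n hn q hq v hv w w' => ?_⟩
  have hWn : ∀ i ∈ W₀, ∀ l ∈ TL, i.2 + len l < n := by
    intro i hi l hl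
    have h1 : i.2 ≤ W₀.sup Prod.snd := Finset.le_sup (f := Prod.snd) hi
    have h2 : len l ≤ TL.sup len := Finset.le_sup hl
    have h3 := (le_max_right _ _).trans hn
    omega
  have hWn' : ∀ i ∈ W₀, i.2 < n := by
    intro i hi
    have h1 : i.2 ≤ W₀.sup Prod.snd := Finset.le_sup (f := Prod.snd) hi
    have h3 := (le_max_right _ _).trans hn
    omega
  have hlen : ∀ l ∈ TL, len l < n := by
    intro l hl
    have h2 : len l ≤ TL.sup len := Finset.le_sup hl
    have h3 := (le_max_right _ _).trans hn
    omega
  -- Genericity of `H` needs an infinite cell for the larger index set `I.toLeft`; the pigeonhole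
  -- principle finds one inside the cell of `q`.
  obtain ⟨p₀, ⟨hp₀, hp₀E⟩, hinf⟩ := exists_infinite_fiber
    (fun p => fun i : I.toLeft × Fin n => p ∈ H (.inl i.1) i.2) (hq.sdiff hEE)
  let w'' : Z ⊕ L → Finset ℕ := Sum.elim (fun z => w (.inl z)) fun l =>
    if l ∈ v then w' l else if l ∈ TL then
      ((Finset.range (n - len l)).filter fun m => p₀ ∈ H (.inr l) m) ∪
        ((w (.inr l)).filter fun m => n ≤ m).image fun m => m - len l
    else (hH.finite (.inr l) p₀).toFinset
  have hgen := hn₁ n ((le_max_left _ _).trans hn) p₀ (hinf.mono (by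
    rintro p ⟨-, hp⟩ z hz m hm
    exact iff_of_eq (congrFun hp (⟨z, hz⟩, ⟨m, hm⟩)))) (I.toRight ∪ v) w''
  refine (hgen.sdiff hEE).mono ?_
  rintro p ⟨⟨hp1, hp2, hp3⟩, hpE⟩
  have hout : ∀ p ∉ EE, ∀ l ∈ TL, p ∉ (effReq H req l).2 ∧ ∀ b ∈ (effReq H req l).1, p ∉ E b := by
    intro p hp l hl
    refine ⟨fun h => hp (Set.mem_biUnion hl (Or.inr h)), fun b hb h => hp (Set.mem_biUnion hl
      (Or.inl (Set.mem_biUnion (List.mem_toFinset.2 hb) h)))⟩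
  have hvI : ∀ l, .inr l ∈ I → l ∉ v := fun l hl hlv =>
    Finset.disjoint_left.1 hv hlv (Finset.mem_toRight.2 hl)
  have hTLI : ∀ l ∈ TL, Sum.inr l ∈ I := fun l hl =>
    Finset.mem_union_left _ (Finset.mem_toRight.1 hl)
  have hlow : ∀ l ∈ TL, ∀ m < n - len l, (p ∈ H (.inr l) m ↔ p₀ ∈ H (.inr l) m) := by
    intro l hl m hm
    rw [hp3 l (Finset.mem_union_left _ (Finset.mem_toRight.2 (hTLI l hl)))]
    simp only [w'', Sum.elim_inr, if_neg (hvI l (hTLI l hl)), if_pos hl, Finset.mem_union,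
      Finset.mem_filter, Finset.mem_range, hm, true_and, Finset.mem_image, or_iff_left_iff_imp]
    rintro ⟨m', ⟨-, hm'⟩, rfl⟩
    omega
  have hW₀ : ∀ i ∈ W₀, (p ∈ H i.1 i.2 ↔ p₀ ∈ H i.1 i.2) := by
    rintro ⟨z | l, m⟩ hi
    · exact hp1 z (Finset.mem_toLeft.2 (Finset.mem_union_right _ (Finset.mem_image_of_mem _ hi))) m
        (hWn' _ hi)
    · have hlI : Sum.inr l ∈ I := Finset.mem_union_right _ (Finset.mem_image_of_mem Prod.fst hi)
      by_cases hl : l ∈ TL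
      · exact hlow l hl m (by have := hWn _ hi l hl; dsimp only at this; omega)
      · dsimp only
        rw [hp3 l (Finset.mem_union_left _ (Finset.mem_toRight.2 hlI))]
        simp [w'', hvI l hlI, hl]
  refine ⟨?_, ?_, fun l hl m => ?_⟩
  · rintro c hc m hm
    rw [← hp₀ c hc m hm]
    rcases c with z | l
    · exact hp1 z (Finset.mem_toLeft.2 (Finset.mem_union_left _ hc)) m hm
    · have hl := hTL l hc
      change p ∈ shiftedSeq H (effReq H req l) l m ↔ p₀ ∈ shiftedSeq H (effReq H req l) l m
      by_cases h : m < len l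
      · have e : shiftedSeq H (effReq H req l) l m = ((effReq H req l).1[m] : Set P) := dif_pos h
        have hb : (effReq H req l).1[m] ∈ (effReq H req l).1 := List.getElem_mem h
        rw [e]
        refine hdet _ p ((hout p hpE l hl).2 _ hb) p₀ ((hout p₀ hp₀E l hl).2 _ hb) fun i hi => ?_
        exact hW₀ i (Finset.mem_biUnion.2 ⟨l, hl, Finset.mem_biUnion.2
          ⟨_, List.mem_toFinset.2 hb, hi⟩⟩)
      · rw [shiftedSeq_of_ge H (not_lt.1 h)]
        refine and_congr (hlow l hl _ ?_) (iff_of_true (hout p hpE l hl).1 (hout p₀ hp₀E l hl).1)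
        change m - len l < n - len l
        omega
  · rintro (z | l) hc m hm
    · exact hp2 z (Finset.mem_toLeft.2 (Finset.mem_union_left _ hc)) m hm
    · have hl := hTL l hc
      have hln := hlen l hl
      change p ∈ shiftedSeq H (effReq H req l) l m ↔ _
      rw [shiftedSeq_of_ge H (hln.le.trans hm)]
      refine (and_iff_left (hout p hpE l hl).1).trans ?_
      rw [hp3 l (Finset.mem_union_left _ (Finset.mem_toRight.2 (hTLI l hl)))]
      simp only [w'', Sum.elim_inr, if_neg (hvI l (hTLI l hl)), if_pos hl, Finset.mem_union,
        Finset.mem_filter, Finset.mem_range, Finset.mem_image]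
      constructor
      · rintro (⟨h, -⟩ | ⟨m', ⟨h1, h2⟩, h3⟩)
        · exfalso
          change m - len l < n - len l at h
          omega
        · change m' - len l = m - len l at h3
          have : m' = m := by omega
          rwa [← this]
      · intro h
        exact Or.inr ⟨m, ⟨h, hm⟩, rfl⟩
  · rw [hp3 l (Finset.mem_union_right _ hl)]
    simp [w'', hl]

end Model

/-! ### New sequences with prescribed initial behaviour -/

section Extension

variable {P Z L : Type u} (H : Z ⊕ L → ℕ → Set P) (req : L → List (genAlg H) × Finset P)

/-- New sequences with prescribed initial segments: given, for each point `p` outside `Q`, the set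
`Good p` of admissible patterns, there are indices `h d` such that the patterns of the points of
the model are exactly the admissible ones, and their tails are generic. -/
theorem exists_extension (hreq : ∀ r, {l | req l = r}.Infinite) {T : Finset (Z ⊕ L)}
    {V : Finset L} {n : ℕ} (hV : ∀ l, .inr l ∈ T → l ∈ V) (hg : CellGeneric H req T V n)
    {D : Type u} [Finite D] (Q : Finset P)
    (hQ : ∀ p ∉ Q, (cellOf (modelF H req) T n p).Infinite)
    (Good : P → Set (D → Fin n → Prop)) (hne : ∀ p ∉ Q, (Good p).Nonempty)
    (hinv : ∀ p p', p' ∈ cellOf (modelF H req) T n p → Good p' = Good p)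
    (hind : ∀ d (η : Fin n → Prop), ∃ p ∉ Q, ∃ e ∈ Good p, e d = η)
    (ρ : P → D → Fin n → Prop) :
    ∃ h : D → L, Function.Injective h ∧ (∀ d, .inr (h d) ∉ T) ∧
      (∀ p ∈ Q, ∀ d, (∀ m : Fin n, p ∈ modelF H req (.inr (h d)) m ↔ ρ p d m) ∧
        ∀ m ≥ n, p ∉ modelF H req (.inr (h d)) m) ∧
      (∀ p ∉ Q, (fun d (m : Fin n) => p ∈ modelF H req (.inr (h d)) m) ∈ Good p) ∧
      ∀ p ∉ Q, ∀ e ∈ Good p, ∀ w : Z ⊕ L → Finset ℕ,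
        {p' ∈ cellOf (modelF H req) T n p |
          (∀ d (m : Fin n), p' ∈ modelF H req (.inr (h d)) m ↔ e d m) ∧
          (∀ c ∈ T, ∀ m ≥ n, (p' ∈ modelF H req c m ↔ m ∈ w c)) ∧
          ∀ d, ∀ m ≥ n, (p' ∈ modelF H req (.inr (h d)) m ↔ m ∈ w (.inr (h d)))}.Infinite := by
  classical
  have := Fintype.ofFinite D
  have hLinf : Infinite L := Set.infinite_univ_iff.1 ((hreq ([], ∅)).mono (Set.subset_univ _))
  -- The generating sets at the indices `l d` only provide a generic pattern `δ`; the new sequences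
  -- will sit at other indices.
  obtain ⟨l, hl, hlV⟩ := exists_injective_of_forall_infinite
    (fun _ : D => (Set.univ \ (V : Set L))) fun _ => Set.infinite_univ.sdiff V.finite_toSet
  let δ : P → D → Fin n → Prop := fun p d m => p ∈ H (.inr (l d)) m
  have hdflt : ∀ S : Set (D → Fin n → Prop), ∃ e, S.Nonempty → e ∈ S := by
    intro S
    by_cases h : S.Nonempty
    · exact ⟨h.some, fun _ => h.some_mem⟩
    · exact ⟨fun _ _ => False, fun h' => absurd h' h⟩
  choose dflt hdflt using hdflt
  -- The generic pattern is corrected to a default when it is inadmissible. All values off `Q` are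
  -- then admissible, and every admissible one is still attained infinitely often in its cell.
  let θ : P → D → Fin n → Prop := fun p => if δ p ∈ Good p then δ p else dflt (Good p)
  have hθ : ∀ p ∉ Q, θ p ∈ Good p := by
    intro p hp
    by_cases h : δ p ∈ Good p
    · simp only [θ, if_pos h, h]
    · simp only [θ, if_neg h]
      exact hdflt _ (hne p hp)
  let b : D → Fin n → Set P := fun d m => {p | if p ∈ Q then ρ p d m else θ p d m}
  have hb : ∀ d m, b d m ∈ genAlg H := by
    intro d m
    refine BooleanSubalgebra.mem_of_finite_determined (genAlg H)
      (Y := ((fun q : P => ({q} : Set P)) '' Q) ∪ ((fun z : (Z ⊕ L) × ℕ => modelF H req z.1 z.2) ''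
        (T ×ˢ Finset.range n : Finset _)) ∪ Set.range fun z : D × Fin n => H (.inr (l z.1)) z.2)
      (((Q.finite_toSet.image _).union ((Finset.finite_toSet _).image _)).union
        (Set.finite_range _)) ?_ ?_
    · rintro _ ((⟨q, -, rfl⟩ | ⟨z, -, rfl⟩) | ⟨z, rfl⟩)
      · exact singleton_mem_genAlg H q
      · exact modelF_mem_genAlg H req _ _
      · exact gen_mem_genAlg H _ _
    · intro p p' hpp hp
      by_cases hpQ : p ∈ Q
      · have : p' ∈ ({p} : Set P) := (hpp {p} (Or.inl (Or.inl ⟨p, hpQ, rfl⟩))).1 rfl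
        rwa [Set.mem_singleton_iff.1 this]
      · have hpQ' : p' ∉ Q := fun h => hpQ (by
          have : p ∈ ({p'} : Set P) := (hpp {p'} (Or.inl (Or.inl ⟨p', h, rfl⟩))).2 rfl
          rwa [Set.mem_singleton_iff.1 this])
        have hcell : p' ∈ cellOf (modelF H req) T n p := fun c hc m hm =>
          (hpp _ (Or.inl (Or.inr ⟨(c, m), by simp [hc, hm], rfl⟩))).symm
        have hδ : δ p' = δ p := by
          funext d m
          exact propext (hpp _ (Or.inr ⟨(d, m), rfl⟩)).symm
        have hp : ite _ _ _ := hp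
        change ite _ _ _
        rw [if_neg hpQ] at hp
        rw [if_neg hpQ']
        simpa only [θ, hδ, hinv p p' hcell] using hp
  let r : D → List (genAlg H) × Finset P := fun d =>
    (List.ofFn fun m : Fin n => (⟨b d m, hb d m⟩ : genAlg H), Q)
  -- The indices answering the requests avoid `V` and the `l d`, so that their tails are independent
  -- of the cells and of `δ`.
  obtain ⟨h, hh, hhA⟩ := exists_injective_of_forall_infinite
    (fun d : D => {x | req x = r d} \ ((V : Set L) ∪ Set.range l)) fun d =>
      (hreq (r d)).sdiff (V.finite_toSet.union (Set.finite_range l))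
  have hlen : ∀ d, (r d).1.length = n := fun d => List.length_ofFn
  have hlow : ∀ d (m : Fin n), shiftedSeq H (r d) (h d) m = b d m := by
    intro d m
    have : (m : ℕ) < (r d).1.length := by rw [hlen]; exact m.2
    unfold shiftedSeq
    rw [dif_pos this]
    simp [r]
  have hhigh : ∀ d m, n ≤ m → shiftedSeq H (r d) (h d) m = H (.inr (h d)) (m - n) \ Q := by
    intro d m hm
    rw [shiftedSeq_of_ge H ((hlen d).le.trans hm), hlen]
  have key : ∀ p ∉ Q, ∀ e ∈ Good p, ∀ (w : Z ⊕ L → Finset ℕ) (w' : L → Finset ℕ),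
      {p' ∈ cellOf (modelF H req) T n p |
        (∀ d (m : Fin n), p' ∈ b d m ↔ e d m) ∧
        (∀ c ∈ T, ∀ m ≥ n, (p' ∈ modelF H req c m ↔ m ∈ w c)) ∧
        ∀ d, ∀ m ≥ n, (p' ∈ H (.inr (h d)) (m - n) \ Q ↔ m - n ∈ w' (h d))}.Infinite := by
    intro p hp e he w w'
    let wl : L → Finset ℕ := fun x => if hx : ∃ d, l d = x then
      (Finset.univ.filter fun m : Fin n => e hx.choose m).image Fin.val else w' x
    have hwl : ∀ d (m : Fin n), ((m : ℕ) ∈ wl (l d) ↔ e d m) := by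
      intro d m
      have hx : ∃ d', l d' = l d := ⟨d, rfl⟩
      have hd : hx.choose = d := hl hx.choose_spec
      simp only [wl, dif_pos hx, hd, Finset.mem_image, Finset.mem_filter, Finset.mem_univ,
        true_and]
      constructor
      · rintro ⟨m', h1, h2⟩
        rwa [← Fin.ext h2]
      · exact fun h1 => ⟨m, h1, rfl⟩
    have hwh : ∀ d, wl (h d) = w' (h d) := fun d => dif_neg fun ⟨d', hd'⟩ =>
      (hhA d).2 (Or.inr ⟨d', hd'⟩)
    have := hg p (hQ p hp) (Finset.univ.image l ∪ Finset.univ.image h) (by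
      rw [Finset.disjoint_union_left, Finset.disjoint_left, Finset.disjoint_left]
      constructor
      · intro x hx
        obtain ⟨d, -, rfl⟩ := Finset.mem_image.1 hx
        exact (hlV d).2
      · intro x hx hxV
        obtain ⟨d, -, rfl⟩ := Finset.mem_image.1 hx
        exact (hhA d).2 (Or.inl hxV)) w wl
    refine (this.sdiff Q.finite_toSet).mono ?_
    rintro p' ⟨⟨h1, h2, h3⟩, hp'Q⟩
    have hp'Q : p' ∉ Q := hp'Q
    refine ⟨h1, fun d m => ?_, h2, fun d m hm => ?_⟩
    · have hδ : δ p' = e := by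
        funext d m
        exact propext ((h3 (l d) (Finset.mem_union_left _
          (Finset.mem_image_of_mem _ (Finset.mem_univ d))) m).trans (hwl d m))
      change ite _ _ _ ↔ _
      rw [if_neg hp'Q]
      simp only [hδ, hinv p p' h1, if_pos he]
    · rw [← hwh]
      exact (and_iff_left hp'Q).trans (h3 (h d) (Finset.mem_union_right _
        (Finset.mem_image_of_mem _ (Finset.mem_univ d))) (m - n))
  have hF : ∀ d, modelF H req (.inr (h d)) = shiftedSeq H (r d) (h d) := by
    intro d
    have hreqd : req (h d) = r d := (hhA d).1
    -- Without this, `effReq` would replace the request by the trivial one. Initial patterns come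
    -- from `hind`, tails from `key`.
    have hs : SeqIndep (shiftedSeq H (r d) (h d)) := by
      intro N η
      obtain ⟨p, hp, e, he, hed⟩ := hind d fun m => η m
      refine (key p hp e he (fun _ => ∅)
        fun _ => (Finset.range N).filter fun m => η (m + n)).mono ?_
      rintro p' ⟨-, h1, -, h2⟩ m hm
      by_cases hmn : m < n
      · have := hlow d ⟨m, hmn⟩
        dsimp only at this
        rw [this, h1, hed]
      · rw [hhigh d m (not_lt.1 hmn), h2 d m (not_lt.1 hmn)]
        simp only [Finset.mem_filter, Finset.mem_range]
        rw [Nat.sub_add_cancel (not_lt.1 hmn)]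
        exact and_iff_right (by omega)
    have : effReq H req (h d) = r d := by
      rw [effReq, hreqd, if_pos hs]
    change shiftedSeq H (effReq H req (h d)) (h d) = _
    rw [this]
  refine ⟨h, hh, fun d hd => (hhA d).2 (Or.inl (hV _ hd)), fun p hp d => ⟨fun m => ?_,
    fun m hm => ?_⟩, fun p hp => ?_, fun p hp e he w => ?_⟩
  · rw [hF, hlow]
    change ite _ _ _ ↔ _
    rw [if_pos hp]
  · rw [hF, hhigh d m hm]
    exact fun h => h.2 hp
  · convert hθ p hp using 3 with d m
    rw [hF, hlow]
    change ite _ _ _ ↔ _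
    rw [if_neg hp]
  · refine (key p hp e he w fun x => ((w (.inr x)).filter fun m => n ≤ m).image
      fun m => m - n).mono ?_
    rintro p' ⟨h1, h2, h3, h4⟩
    refine ⟨h1, fun d m => by rw [hF, hlow, h2], h3, fun d m hm => ?_⟩
    rw [hF, hhigh d m hm, h4 d m hm]
    simp only [Finset.mem_image, Finset.mem_filter]
    constructor
    · rintro ⟨m', ⟨h5, h6⟩, h7⟩
      rwa [show m = m' by omega]
    · exact fun h5 => ⟨m, ⟨h5, hm⟩, rfl⟩

end Extension

/-! ### Structures in the finite classes -/

section Atoms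

variable {B : Type*} [BooleanAlgebra B]

theorem IsAtom.le_compl_iff {a x : B} (ha : IsAtom a) : a ≤ xᶜ ↔ ¬ a ≤ x := by
  rw [ha.not_le_iff_disjoint, le_compl_iff_disjoint_right]

theorem IsAtom.le_sup_iff {a x y : B} (ha : IsAtom a) : a ≤ x ⊔ y ↔ a ≤ x ∨ a ≤ y := by
  refine ⟨fun h => ?_, fun h => h.elim le_sup_of_le_left le_sup_of_le_right⟩
  by_contra! hc
  rw [ha.not_le_iff_disjoint, ha.not_le_iff_disjoint, ← disjoint_sup_right] at hc
  exact ha.ne_bot (disjoint_self.1 (hc.mono_right h))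

theorem IsAtom.le_finset_sup_iff {ι : Type*} {a : B} (ha : IsAtom a) (s : Finset ι) (f : ι → B) :
    a ≤ s.sup f ↔ ∃ i ∈ s, a ≤ f i := by
  classical
  induction s using Finset.induction_on with
  | empty => simpa using ha.ne_bot
  | insert i s _ ih => simp [ha.le_sup_iff, ih]

theorem IsAtom.le_boolCell_iff {ι : Type*} {a : B} (ha : IsAtom a) (y : ι → B) (s : Finset ι)
    (v : ι → Bool) : a ≤ boolCell y s v ↔ ∀ i ∈ s, (a ≤ y i ↔ v i = true) := by
  rw [boolCell, Finset.le_inf_iff]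
  refine forall₂_congr fun i _ => ?_
  cases v i <;> simp [ha.le_compl_iff]

/-- A cell with a positive atom is below it, so it is that atom or zero. -/
theorem IsAtom.boolCell_eq_bot_iff {ι : Type*} {y : ι → B} {s : Finset ι} {v : ι → Bool} {i : ι}
    (ha : IsAtom (y i)) (hi : i ∈ s) (hv : v i = true) :
    boolCell y s v = ⊥ ↔ ¬ ∀ j ∈ s, (y i ≤ y j ↔ v j = true) := by
  rw [← ha.le_boolCell_iff]
  have hle : boolCell y s v ≤ y i := by simpa [hv] using boolCell_le y (v := v) hi
  rcases ha.le_iff.1 hle with h | h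
  · rw [h]
    simpa using ha.ne_bot
  · rw [h]
    simpa using ha.ne_bot

end Atoms

namespace TauStr

variable {M : TauStr.{u}}

theorem mem_P4n_one {b : M.P1} : b ∈ M.P4n 1 ↔ IsAtom b := by
  constructor
  · rintro ⟨s, hs, hat, rfl⟩
    obtain ⟨a, rfl⟩ := Finset.card_eq_one.1 hs
    simpa using hat
  · intro h
    exact ⟨{b}, by simp, by simpa using h, by simp⟩

/-- The generators `G a` and `F_m(c)` of the Boolean algebra. -/
def gen (M : TauStr.{u}) : M.P0 ⊕ (ℕ × M.P2) → M.P1 := Sum.elim M.G fun z => M.F z.1 z.2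

/-- The generators of level less than `n`. -/
def genFinset (M : TauStr.{u}) [Fintype M.P0] [Fintype M.P2] (n : ℕ) :
    Finset (M.P0 ⊕ (ℕ × M.P2)) :=
  Finset.univ.disjSum (Finset.range n ×ˢ Finset.univ)

theorem inl_mem_genFinset [Fintype M.P0] [Fintype M.P2] (n : ℕ) (a : M.P0) :
    .inl a ∈ M.genFinset n := by
  simp [genFinset]

theorem inr_mem_genFinset [Fintype M.P0] [Fintype M.P2] {n m : ℕ} {c : M.P2} :
    .inr (m, c) ∈ M.genFinset n ↔ m < n := by
  simp [genFinset]

namespace KNegOneFin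

variable (h : M.KNegOneFin)
include h

theorem isAtom_G (a : M.P0) : IsAtom (M.G a) :=
  mem_P4n_one.1 (h.G_bij.mapsTo (Set.mem_univ a))

theorem exists_G_eq {b : M.P1} (hb : IsAtom b) : ∃ a, M.G a = b := by
  obtain ⟨a, -, ha⟩ := h.G_bij.surjOn (mem_P4n_one.2 hb)
  exact ⟨a, ha⟩

theorem G_injective : Function.Injective M.G := fun _ _ hab =>
  h.G_bij.injOn (Set.mem_univ _) (Set.mem_univ _) hab

theorem isLowerSet_P4 : IsLowerSet M.P4 := by
  obtain ⟨b, hb⟩ := h.P4_principal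
  rw [hb]
  exact isLowerSet_Iic b

theorem supClosed_P4 : SupClosed M.P4 := by
  obtain ⟨b, hb⟩ := h.P4_principal
  rw [hb]
  exact fun x hx y hy => sup_le hx hy

theorem G_mem_P4 (a : M.P0) : M.G a ∈ M.P4 := by
  rw [h.P4_eq]
  exact Set.mem_iUnion.2 ⟨1, mem_P4n_one.2 (h.isAtom_G a)⟩

theorem bot_mem_P4 : ⊥ ∈ M.P4 := by
  obtain ⟨b, hb⟩ := h.P4_principal
  rw [hb]
  exact bot_le

theorem mem_P4_iff {x : M.P1} : x ∈ M.P4 ↔ ∃ s : Finset M.P0, s.sup M.G = x := by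
  classical
  constructor
  · intro hx
    rw [h.P4_eq] at hx
    obtain ⟨n, s, -, hat, rfl⟩ := Set.mem_iUnion.1 hx
    clear hx
    induction s using Finset.induction_on with
    | empty => exact ⟨∅, rfl⟩
    | insert b s _ ih =>
      rw [Finset.forall_mem_insert] at hat
      obtain ⟨t, ht⟩ := ih hat.2
      obtain ⟨a, ha⟩ := h.exists_G_eq hat.1
      exact ⟨insert a t, by rw [Finset.sup_insert, Finset.sup_insert, ht, ha, id]⟩
  · rintro ⟨s, rfl⟩
    exact Finset.sup_induction h.bot_mem_P4 (fun x hx y hy => h.supClosed_P4 hx hy)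
      fun a _ => h.G_mem_P4 a

theorem G_le_G_iff {a a' : M.P0} : M.G a ≤ M.G a' ↔ a = a' := by
  rw [(h.isAtom_G a').le_iff_eq (h.isAtom_G a).ne_bot, h.G_injective.eq_iff]

theorem G_le_sup_iff {a : M.P0} {s : Finset M.P0} : M.G a ≤ s.sup M.G ↔ a ∈ s := by
  rw [(h.isAtom_G a).le_finset_sup_iff]
  simp [h.G_le_G_iff]

/-- A cell avoiding all the elements of `P₀` is in `P₄` only if it vanishes. -/
theorem boolCell_mem_P4_iff {s : Finset (M.P0 ⊕ (ℕ × M.P2))} {v : M.P0 ⊕ (ℕ × M.P2) → Bool}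
    (hs : ∀ a, .inl a ∈ s) (hv : ∀ a, v (.inl a) = false) :
    boolCell M.gen s v ∈ M.P4 ↔ boolCell M.gen s v = ⊥ := by
  refine ⟨fun hx => ?_, fun hx => by rw [hx]; exact h.bot_mem_P4⟩
  obtain ⟨t, ht⟩ := h.mem_P4_iff.1 hx
  obtain rfl | ⟨a, ha⟩ := t.eq_empty_or_nonempty
  · simpa using ht.symm
  · exfalso
    have h1 : M.G a ≤ boolCell M.gen s v := by
      rw [← ht, h.G_le_sup_iff]
      exact ha
    have h2 := ((h.isAtom_G a).le_boolCell_iff _ _ _).1 h1 (.inl a) (hs a)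
    rw [hv] at h2
    exact Bool.false_ne_true (h2.1 le_rfl)

theorem boolCell_mem_P4_of_true {s : Finset (M.P0 ⊕ (ℕ × M.P2))}
    {v : M.P0 ⊕ (ℕ × M.P2) → Bool} {a : M.P0} (ha : .inl a ∈ s) (hv : v (.inl a) = true) :
    boolCell M.gen s v ∈ M.P4 := by
  have := boolCell_le M.gen (v := v) ha
  rw [hv] at this
  exact h.isLowerSet_P4 this (h.G_mem_P4 a)

end KNegOneFin

namespace IsWitness

variable {n : ℕ} {B : ℕ → BooleanSubalgebra M.P1} {b : M.P1} (hw : M.IsWitness n B b)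
include hw

theorem top_notMem_P4 : ⊤ ∉ M.P4 := by
  intro h
  refine hw.P4_ssubset.2 fun x _ => ?_
  rw [hw.P4_eq] at h ⊢
  exact le_top.trans h

theorem finite_P0 (h : M.KNegOneFin) : Finite M.P0 := by
  have hf : M.P4.Finite := (hw.B_finite n le_rfl).subset hw.P4_ssubset.1
  have : Finite M.P4 := hf
  exact Finite.of_injective (fun a => (⟨M.G a, h.G_mem_P4 a⟩ : M.P4)) fun a a' haa =>
    h.G_injective (congrArg Subtype.val haa)

theorem not_G_le_F (h : M.KNegOneFin) {m : ℕ} (hm : n ≤ m) (a : M.P0) (c : M.P2) :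
    ¬ M.G a ≤ M.F m c := by
  intro hle
  have hb : M.G a ≤ b := hw.isLUB.1 (h.G_mem_P4 a)
  exact (h.isAtom_G a).ne_bot (le_bot_iff.1 ((le_inf hle hb).trans (hw.F_inf m hm c).le))

/-- The increasing algebras in the witness are generated by `P₄` and the `F_m(c)`, and `P₄` consists
of finite joins of the `G a`. -/
theorem closure_gen (h : M.KNegOneFin) : BooleanSubalgebra.closure (Set.range M.gen) = ⊤ := by
  set A := BooleanSubalgebra.closure (Set.range M.gen) with hA
  have hF : ∀ m c, M.F m c ∈ A := fun m c =>
    BooleanSubalgebra.subset_closure ⟨.inr (m, c), rfl⟩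
  have hP4 : M.P4 ⊆ A := by
    intro x hx
    obtain ⟨s, rfl⟩ := h.mem_P4_iff.1 hx
    exact Finset.sup_induction (p := fun x => x ∈ A) BooleanSubalgebra.bot_mem
      (fun x hx y hy => BooleanSubalgebra.sup_mem hx hy)
      fun a _ => BooleanSubalgebra.subset_closure ⟨.inl a, rfl⟩
  have hBn : B n ≤ A := by
    rw [← hw.B_gen, BooleanSubalgebra.closure_le]
    rintro x (hx | ⟨m, -, c, rfl⟩)
    · exact hP4 hx
    · exact hF m c
  rw [eq_top_iff]
  intro x _
  obtain ⟨m, hm, hx⟩ := hw.union x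
  rw [hw.B_eq m hm] at hx
  refine (BooleanSubalgebra.closure_le.2 ?_ :
    _ ≤ A) hx
  rintro x (hx | ⟨k, -, -, c, rfl⟩)
  · exact hBn hx
  · exact hF k c

theorem boolCell_F_notMem_P4 (c : M.P2) (s : Finset ℕ) (η : ℕ → Bool) :
    boolCell (fun m => M.F m c) s η ∉ M.P4 := by
  simpa using (hw.F_indep c).boolCell_inf_notMem (a := ⊤) BooleanSubalgebra.top_mem
    hw.top_notMem_P4 s η

/-- The sequences `F_m(c)`, `m ≥ n`, split every nonvanishing cell that avoids `P₀`. -/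
theorem boolCell_ne_bot [Fintype M.P0] [Fintype M.P2] (h : M.KNegOneFin) {k k' : ℕ} (hk : n ≤ k)
    {v : M.P0 ⊕ (ℕ × M.P2) → Bool} (hv : ∀ a, v (.inl a) = false)
    (hne : boolCell M.gen (M.genFinset k) v ≠ ⊥) : boolCell M.gen (M.genFinset k') v ≠ ⊥ := by
  classical
  rw [Ne, ← h.boolCell_mem_P4_iff (inl_mem_genFinset k) hv] at hne
  have hsub : M.genFinset n ⊆ M.genFinset k := by
    rintro (a | ⟨m, c⟩) hi
    · exact inl_mem_genFinset k a
    · exact inr_mem_genFinset.2 ((inr_mem_genFinset.1 hi).trans_le hk)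
  have hx : boolCell M.gen (M.genFinset n) v ∉ M.P4 := fun hx =>
    hne (h.isLowerSet_P4 (boolCell_anti _ hsub v) hx)
  have hxB : boolCell M.gen (M.genFinset n) v ∈ B n := by
    refine boolCell_mem _ _ ?_
    rintro (a | ⟨m, c⟩) hi
    · exact hw.P4_ssubset.1 (h.G_mem_P4 a)
    · rw [← hw.B_gen]
      exact BooleanSubalgebra.subset_closure (Or.inr ⟨m, inr_mem_genFinset.1 hi, c, rfl⟩)
  have hxB' : boolCell M.gen (M.genFinset n) v ∈ BooleanSubalgebra.closure (B n : Set M.P1) :=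
    BooleanSubalgebra.subset_closure hxB
  let s : Finset ({m : ℕ // n ≤ m} × M.P2) :=
    ((Finset.range k').subtype (fun m => n ≤ m)) ×ˢ Finset.univ
  have := hw.F_free.boolCell_inf_notMem hxB' hx s fun i => v (.inr (i.1, i.2))
  intro hbot
  refine this (h.isLowerSet_P4 ?_ h.bot_mem_P4)
  rw [← hbot]
  refine Finset.le_inf ?_
  rintro (a | ⟨m, c⟩) hi
  · exact inf_le_right.trans (boolCell_le _ (inl_mem_genFinset n a))
  · by_cases hm : m < n
    · exact inf_le_right.trans (boolCell_le _ (inr_mem_genFinset.2 hm))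
    · have hmem : ((⟨m, not_lt.1 hm⟩ : {m : ℕ // n ≤ m}), c) ∈ s := by
        simpa [s] using inr_mem_genFinset.1 hi
      exact inf_le_left.trans (boolCell_le (fun i : {m : ℕ // n ≤ m} × M.P2 => M.F i.1 i.2) hmem)

end IsWitness

end TauStr

/-! ### Finitely generated substructures of the model -/

section ClosureLemmas

variable {A : Type u} [BooleanAlgebra A]

/-- An element is determined by the truth table of a polynomial representing it. -/
theorem BooleanSubalgebra.closure_finite {s : Set A} (hs : s.Finite) :
    (BooleanSubalgebra.closure s : Set A).Finite := by
  classical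
  have : Finite s := hs
  let y : s → A := Subtype.val
  have hex : ∀ x : BooleanSubalgebra.closure s, ∃ t : BTerm s, t.eval y = x := fun x =>
    exists_eval_eq (by rw [Subtype.range_coe]; exact x.2)
  choose τ hτ using hex
  refine Set.Finite.of_injOn (f := fun x => if hx : x ∈ BooleanSubalgebra.closure s then
    {v : s → Bool | (τ ⟨x, hx⟩).eval v = true} else ∅) (t := Set.univ)
    (fun _ _ => Set.mem_univ _) ?_ Set.finite_univ
  have key : ∀ x x' : BooleanSubalgebra.closure s,
      {v : s → Bool | (τ x).eval v = true} = {v : s → Bool | (τ x').eval v = true} →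
      (x : A) ≤ x' := by
    intro x x' hxx
    have : (BTerm.meet (τ x) (.neg (τ x'))).eval y ∈ ({⊥} : Set A) := by
      refine (eval_mem_ideal_iff (I := {⊥}) ?_ ?_ rfl y _ subset_rfl).2 fun v hv => ?_
      · rintro a b hab rfl
        exact le_bot_iff.1 hab
      · rintro _ rfl _ rfl
        exact sup_idem _
      · exfalso
        have h := Set.ext_iff.1 hxx v
        simp only [Set.mem_ofPred_eq] at h
        simp only [BTerm.eval] at hv
        cases h1 : (τ x).eval v <;> cases h2 : (τ x').eval v <;> simp_all
    simp only [BTerm.eval, hτ, Set.mem_singleton_iff] at this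
    rwa [← sdiff_eq, sdiff_eq_bot_iff] at this
  intro x hx x' hx' hxx
  have hx : x ∈ BooleanSubalgebra.closure s := hx
  have hx' : x' ∈ BooleanSubalgebra.closure s := hx'
  simp only [dif_pos hx, dif_pos hx'] at hxx
  exact le_antisymm (key ⟨x, hx⟩ ⟨x', hx'⟩ hxx) (key ⟨x', hx'⟩ ⟨x, hx⟩ hxx.symm)

theorem BooleanSubalgebra.closure_preimage_coe (s : Set A) :
    BooleanSubalgebra.closure
      ((↑) ⁻¹' s : Set (BooleanSubalgebra.closure s)) = ⊤ := by
  rw [eq_top_iff]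
  rintro ⟨x, hx⟩ -
  induction hx using BooleanSubalgebra.closure_bot_sup_induction with
  | mem x hx => exact BooleanSubalgebra.subset_closure hx
  | bot => exact BooleanSubalgebra.bot_mem
  | sup x hx y hy ihx ihy => exact BooleanSubalgebra.sup_mem ihx ihy
  | compl x hx ih => exact BooleanSubalgebra.compl_mem ih

end ClosureLemmas

namespace TauStr

theorem P4n_eq {M : TauStr.{u}} (hG : Function.Injective M.G)
    (hat : ∀ b : M.P1, IsAtom b ↔ ∃ a, M.G a = b) (k : ℕ) :
    M.P4n k = {x | ∃ t : Finset M.P0, t.card = k ∧ t.sup M.G = x} := by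
  classical
  ext x
  constructor
  · rintro ⟨s, rfl, hs, rfl⟩
    have hsub : s ⊆ (s.preimage M.G hG.injOn).image M.G := by
      intro b hb
      obtain ⟨a, rfl⟩ := (hat b).1 (hs b hb)
      exact Finset.mem_image_of_mem _ (Finset.mem_preimage.2 hb)
    have heq : (s.preimage M.G hG.injOn).image M.G = s :=
      Finset.Subset.antisymm (Finset.image_subset_iff.2 fun a ha => Finset.mem_preimage.1 ha) hsub
    refine ⟨s.preimage M.G hG.injOn, ?_, ?_⟩
    · rw [← Finset.card_image_of_injective _ hG, heq]
    · conv_rhs => rw [← heq, Finset.sup_image]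
      rfl
  · rintro ⟨t, rfl, rfl⟩
    refine ⟨t.image M.G, Finset.card_image_of_injective _ hG, ?_, ?_⟩
    · intro b hb
      obtain ⟨a, -, rfl⟩ := Finset.mem_image.1 hb
      exact (hat _).2 ⟨a, rfl⟩
    · rw [Finset.sup_image]
      rfl

end TauStr

/-! ### The model and the substructures generated by finitely many points and sequences -/

section Model

variable {P Z L : Type u} (H : Z ⊕ L → ℕ → Set P) (req : L → List (genAlg H) × Finset P)

/-- The model: `P₀` is the set of points, `P₁` the algebra of sets, `P₂` the set of indices. -/
noncomputable def genModel : TauStr.{u} where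
  P0 := P
  P1 := genAlg H
  P2 := Z ⊕ L
  P4 := {b | (b : Set P).Finite}
  R p b := p ∈ (b : Set P)
  G p := ⟨{p}, singleton_mem_genAlg H p⟩
  F m c := ⟨modelF H req c m, modelF_mem_genAlg H req c m⟩

/-- The generators of the substructure generated by `Q` and `T`. -/
def finGens (Q : Finset P) (T : Finset (Z ⊕ L)) : Set (genModel H req).P1 :=
  (genModel H req).G '' (Q : Set P) ∪ {x | ∃ m, ∃ c ∈ T, x = (genModel H req).F m c}

/-- The substructure generated by `Q` and `T`. -/
noncomputable def finSub (Q : Finset P) (T : Finset (Z ⊕ L)) : (genModel H req).Sub where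
  S0 := (Q : Set P)
  S1 := BooleanSubalgebra.closure (finGens H req Q T)
  S2 := (T : Set (Z ⊕ L))
  G_mem a ha := BooleanSubalgebra.subset_closure (Or.inl ⟨a, ha, rfl⟩)
  F_mem n c hc := BooleanSubalgebra.subset_closure (Or.inr ⟨n, c, hc, rfl⟩)

/-- The elements of `P₁` of a substructure as sets of points. -/
def subSet (S : (genModel H req).Sub) : BoundedLatticeHom S.toStr.P1 (Set P) where
  toFun x := (x.1 : genAlg H).1
  map_sup' _ _ := rfl
  map_inf' _ _ := rfl
  map_top' := rfl
  map_bot' := rfl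

theorem subSet_injective (S : (genModel H req).Sub) : Function.Injective (subSet H req S) :=
  fun _ _ h => Subtype.ext (Subtype.ext h)

theorem subSet_subset {S : (genModel H req).Sub} {x y : S.toStr.P1} :
    subSet H req S x ⊆ subSet H req S y ↔ x ≤ y := Iff.rfl

variable {H req} {Q : Finset P} {T : Finset (Z ⊕ L)}

theorem closure_gen_finSub :
    BooleanSubalgebra.closure (Set.range (finSub H req Q T).toStr.gen) = ⊤ := by
  refine top_le_iff.1 ((BooleanSubalgebra.closure_preimage_coe (finGens H req Q T)).ge.trans
    (BooleanSubalgebra.closure_mono ?_))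
  rintro x (⟨a, ha, hx⟩ | ⟨m, c, hc, hx⟩)
  · exact ⟨.inl ⟨a, ha⟩, Subtype.ext hx⟩
  · exact ⟨.inr (m, ⟨c, hc⟩), Subtype.ext hx.symm⟩

/-- The point of the model given by an element of `P₀` of a finitely generated substructure. -/
def subPt (a : (finSub H req Q T).toStr.P0) : P := a.1

/-- An element of `Q` as an element of `P₀` of the substructure. -/
def ptSub {p : P} (hp : p ∈ Q) : (finSub H req Q T).toStr.P0 := ⟨p, hp⟩

theorem subPt_mem (a : (finSub H req Q T).toStr.P0) : subPt a ∈ Q := a.2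

theorem subPt_injective : Function.Injective (subPt (H := H) (req := req) (Q := Q) (T := T)) :=
  Subtype.val_injective

noncomputable instance : Fintype (finSub H req Q T).toStr.P0 := inferInstanceAs (Fintype Q)

noncomputable instance : Fintype (finSub H req Q T).toStr.P2 := inferInstanceAs (Fintype T)

theorem subSet_G (a : (finSub H req Q T).toStr.P0) :
    subSet H req _ ((finSub H req Q T).toStr.G a) = {subPt a} := rfl

theorem subSet_F (m : ℕ) (c : (finSub H req Q T).toStr.P2) :
    subSet H req _ ((finSub H req Q T).toStr.F m c) = modelF H req c.1 m := rfl

theorem subSet_sup_G (t : Finset (finSub H req Q T).toStr.P0) :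
    subSet H req _ (t.sup (finSub H req Q T).toStr.G) = {p | ∃ a ∈ t, subPt a = p} := by
  classical
  induction t using Finset.induction_on with
  | empty =>
    rw [Finset.sup_empty, map_bot]
    ext p
    exact iff_of_false id fun ⟨a, ha, _⟩ => Finset.notMem_empty a ha
  | insert a t _ ih =>
    rw [Finset.sup_insert, map_sup, ih, subSet_G]
    ext p
    refine Iff.trans ?_ (Finset.exists_mem_insert (p := fun a => subPt a = p) a t).symm
    exact or_congr_left eq_comm

theorem finSub_G_injective : Function.Injective (finSub H req Q T).toStr.G := by
  intro a a' h
  have := congrArg (subSet H req _) h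
  rw [subSet_G, subSet_G] at this
  exact subPt_injective (Set.singleton_injective this)

/-- The level-`m` subalgebra of a finitely generated substructure. -/
noncomputable def finLevel (H : Z ⊕ L → ℕ → Set P) (req : L → List (genAlg H) × Finset P)
    (Q : Finset P) (T : Finset (Z ⊕ L)) (m : ℕ) : BooleanSubalgebra (finSub H req Q T).toStr.P1 :=
  BooleanSubalgebra.closure ((finSub H req Q T).toStr.P4 ∪
    {x | ∃ k < m, ∃ c, x = (finSub H req Q T).toStr.F k c})

theorem finLevel_mono {m m' : ℕ} (h : m ≤ m') : finLevel H req Q T m ≤ finLevel H req Q T m' :=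
  BooleanSubalgebra.closure_mono (Set.union_subset_union_right _ fun _ ⟨k, hk, c, hx⟩ =>
    ⟨k, hk.trans_le h, c, hx⟩)

theorem exists_mem_finLevel (n : ℕ) (x : (finSub H req Q T).toStr.P1) :
    ∃ m, n ≤ m ∧ x ∈ finLevel H req Q T m := by
  have hx : x ∈ BooleanSubalgebra.closure (Set.range (finSub H req Q T).toStr.gen) := by
    rw [closure_gen_finSub]
    exact BooleanSubalgebra.mem_top
  induction hx using BooleanSubalgebra.closure_bot_sup_induction with
  | mem x hx =>
    obtain ⟨a | ⟨m, c⟩, rfl⟩ := hx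
    · refine ⟨n, le_rfl, BooleanSubalgebra.subset_closure (Or.inl ?_)⟩
      exact Set.finite_singleton a.1
    · exact ⟨max n (m + 1), le_max_left _ _, BooleanSubalgebra.subset_closure (Or.inr
        ⟨m, by omega, c, rfl⟩)⟩
  | bot => exact ⟨n, le_rfl, BooleanSubalgebra.bot_mem⟩
  | sup x _ y _ hx hy =>
    obtain ⟨m, hm, hx⟩ := hx
    obtain ⟨m', hm', hy⟩ := hy
    exact ⟨max m m', hm.trans (le_max_left _ _), BooleanSubalgebra.sup_mem
      (finLevel_mono (le_max_left _ _) hx) (finLevel_mono (le_max_right _ _) hy)⟩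
  | compl x _ hx =>
    obtain ⟨m, hm, hx⟩ := hx
    exact ⟨m, hm, BooleanSubalgebra.compl_mem hx⟩

/-- Conditions on `Q`, `T`, `D` and `n` which make the substructure generated by `Q` and `T` a
member of the class `K¹_{<ℵ₀}`, freely generated at level `n` by the sequences in `D`. -/
structure FreeAbove (H : Z ⊕ L → ℕ → Set P) (req : L → List (genAlg H) × Finset P)
    (Q : Finset P) (T D : Finset (Z ⊕ L)) (n : ℕ) : Prop where
  nonempty : T.Nonempty
  subset : D ⊆ T
  tail_notMem : ∀ p ∈ Q, ∀ c ∈ T, ∀ m ≥ n, p ∉ modelF H req c m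
  tail_generic : ∀ p ∉ Q, ∀ w : Z ⊕ L → Finset ℕ,
    {p' ∈ cellOf (modelF H req) T n p |
      ∀ c ∈ T, ∀ m ≥ n, (p' ∈ modelF H req c m ↔ m ∈ w c)}.Infinite
  free : ∀ e : Z ⊕ L → ℕ → Prop, ∃ p ∉ Q, ∀ c ∈ D, ∀ m < n, (p ∈ modelF H req c m ↔ e c m)
  determined : ∀ p ∉ Q, ∀ p' ∉ Q, p' ∈ cellOf (modelF H req) D n p →
    p' ∈ cellOf (modelF H req) T n p

namespace FreeAbove

variable {D : Finset (Z ⊕ L)} {n : ℕ} (h : FreeAbove H req Q T D n)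
include h

/-- The level may be raised: on the levels from n to n' one prescribes the pattern of `p` itself. -/
theorem exists_tail (p : P) (hp : p ∉ Q) (n' : ℕ) (hn' : n ≤ n') (w : Z ⊕ L → Finset ℕ) :
    {p' ∈ cellOf (modelF H req) T n' p | p' ∉ Q ∧
      ∀ c ∈ T, ∀ m ≥ n', (p' ∈ modelF H req c m ↔ m ∈ w c)}.Infinite := by
  classical
  refine ((h.tail_generic p hp fun c => ((Finset.range n').filter fun m => p ∈ modelF H req c m) ∪
    (w c).filter fun m => n' ≤ m).sdiff Q.finite_toSet).mono ?_
  rintro p' ⟨⟨h1, h2⟩, hp'⟩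
  refine ⟨fun c hc m hm => ?_, hp', fun c hc m hm => ?_⟩
  · by_cases hmn : m < n
    · exact h1 c hc m hmn
    · rw [h2 c hc m (not_lt.1 hmn)]
      simp [hm, not_le.2 hm]
  · rw [h2 c hc m (hn'.trans hm)]
    have hm : n' ≤ m := hm
    simp [hm, not_lt.2 hm]

theorem infinite_compl : ((Q : Set P)ᶜ).Infinite := by
  obtain ⟨p, hp, -⟩ := h.free fun _ _ => True
  exact (h.exists_tail p hp n le_rfl fun _ => ∅).mono fun p' hp' => hp'.2.1

omit h in
theorem exists_level_determined (x : (finSub H req Q T).toStr.P1) :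
    ∃ m, n ≤ m ∧ ∀ p ∉ Q, ∀ p' ∉ Q, p' ∈ cellOf (modelF H req) T m p →
      (p ∈ subSet H req _ x ↔ p' ∈ subSet H req _ x) := by
  have hx : x ∈ BooleanSubalgebra.closure (Set.range (finSub H req Q T).toStr.gen) := by
    rw [closure_gen_finSub]
    exact BooleanSubalgebra.mem_top
  induction hx using BooleanSubalgebra.closure_bot_sup_induction with
  | mem x hx =>
    obtain ⟨a | ⟨m, c⟩, rfl⟩ := hx
    · refine ⟨n, le_rfl, fun p hp p' hp' _ => iff_of_false ?_ ?_⟩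
      · rintro rfl
        exact hp a.2
      · rintro rfl
        exact hp' a.2
    · exact ⟨max n (m + 1), le_max_left _ _, fun p _ p' _ hpp =>
        (hpp c.1 c.2 m (by omega)).symm⟩
  | bot => exact ⟨n, le_rfl, fun _ _ _ _ _ => Iff.rfl⟩
  | sup x _ y _ hx hy =>
    obtain ⟨m, hm, hx⟩ := hx
    obtain ⟨m', hm', hy⟩ := hy
    exact ⟨max m m', hm.trans (le_max_left _ _), fun p hp p' hp' hpp => or_congr
      (hx p hp p' hp' fun c hc k hk => hpp c hc k (hk.trans_le (le_max_left _ _)))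
      (hy p hp p' hp' fun c hc k hk => hpp c hc k (hk.trans_le (le_max_right _ _)))⟩
  | compl x _ hx =>
    obtain ⟨m, hm, hx⟩ := hx
    exact ⟨m, hm, fun p hp p' hp' hpp => not_congr (hx p hp p' hp' hpp)⟩

/-- An element containing a point outside `Q` contains infinitely many points of the cell of that
point, at a level deciding the element. -/
theorem mem_P4_iff {x : (finSub H req Q T).toStr.P1} :
    x ∈ (finSub H req Q T).toStr.P4 ↔ subSet H req _ x ⊆ Q := by
  refine ⟨fun hx p hp => ?_, fun hx => Q.finite_toSet.subset hx⟩
  by_contra hpQ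
  obtain ⟨m, hm, hdet⟩ := exists_level_determined (n := n) x
  refine (h.exists_tail p hpQ m hm fun _ => ∅).mono (fun p' hp' => ?_) hx
  exact (hdet p hpQ p' hp'.2.1 hp'.1).1 hp

/-- Membership of a point outside `Q` in an element of level `m` depends only on its cell. -/
theorem mem_subSet_iff_of_mem_finLevel {m : ℕ} {x : (finSub H req Q T).toStr.P1}
    (hx : x ∈ finLevel H req Q T m) {p p' : P} (hp : p ∉ Q)
    (hp' : p' ∉ Q) (hpp : p' ∈ cellOf (modelF H req) T m p) :
    p ∈ subSet H req _ x ↔ p' ∈ subSet H req _ x := by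
  induction hx using BooleanSubalgebra.closure_bot_sup_induction with
  | mem x hx =>
    rcases hx with hx | ⟨k, hk, c, rfl⟩
    · exact iff_of_false (fun h' => hp (h.mem_P4_iff.1 hx h'))
        (fun h' => hp' (h.mem_P4_iff.1 hx h'))
    · exact (hpp c.1 c.2 k hk).symm
  | bot => exact Iff.rfl
  | sup x _ y _ hx hy => exact or_congr hx hy
  | compl x _ hx => exact not_congr hx

omit h in
theorem isAtom_G (a : (finSub H req Q T).toStr.P0) : IsAtom ((finSub H req Q T).toStr.G a) := by
  rw [isAtom_iff_le_of_ge]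
  have hinj := subSet_injective H req (finSub H req Q T)
  refine ⟨fun hb => ?_, fun b hb hle => ?_⟩
  · have := congrArg (subSet H req _) hb
    rw [subSet_G, map_bot] at this
    exact Set.singleton_ne_empty _ this
  · have h1 : subSet H req _ b ⊆ {subPt a} := hle
    rcases Set.subset_singleton_iff_eq.1 h1 with h2 | h2
    · exact absurd (hinj (h2.trans (map_bot _).symm)) hb
    · exact (hinj (h2.trans (subSet_G a).symm)).ge

/-- An element with a point outside `Q` is not an atom: a term `F m c` past the level that decides
the element splits it. -/
theorem isAtom_iff (b : (finSub H req Q T).toStr.P1) :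
    IsAtom b ↔ ∃ a, (finSub H req Q T).toStr.G a = b := by
  classical
  have hinj := subSet_injective H req (finSub H req Q T)
  refine ⟨fun hb => ?_, fun ⟨a, ha⟩ => ha ▸ isAtom_G a⟩
  have hne : (subSet H req _ b).Nonempty := by
    by_contra hcon
    rw [Set.not_nonempty_iff_eq_empty] at hcon
    exact hb.ne_bot (hinj (hcon.trans (map_bot _).symm))
  obtain ⟨p, hp⟩ := hne
  by_cases hpQ : p ∈ Q
  · refine ⟨ptSub hpQ, ?_⟩
    rw [← hb.le_iff_eq (isAtom_G _).ne_bot, ← subSet_subset, subSet_G]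
    exact Set.singleton_subset_iff.2 hp
  · exfalso
    obtain ⟨c, hc⟩ := h.nonempty
    obtain ⟨m, hm, hdet⟩ := exists_level_determined (n := n) b
    obtain ⟨p₁, h1, h1Q, h1t⟩ := (h.exists_tail p hpQ m hm fun _ => {m}).nonempty
    obtain ⟨p₂, h2, h2Q, h2t⟩ := (h.exists_tail p hpQ m hm fun _ => ∅).nonempty
    have e1 := (hdet p hpQ p₁ h1Q h1).1 hp
    have e2 := (hdet p hpQ p₂ h2Q h2).1 hp
    have f1 : p₁ ∈ subSet H req _ ((finSub H req Q T).toStr.F m ⟨c, hc⟩) :=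
      (h1t c hc m le_rfl).2 (Finset.mem_singleton_self m)
    have f2 : p₂ ∉ subSet H req _ ((finSub H req Q T).toStr.F m ⟨c, hc⟩) :=
      fun hf => Finset.notMem_empty _ ((h2t c hc m le_rfl).1 hf)
    by_cases hle : b ≤ (finSub H req Q T).toStr.F m ⟨c, hc⟩
    · exact f2 (hle e2)
    · rw [← hb.le_compl_iff] at hle
      exact hle e1 f1

theorem P4n_eq (k : ℕ) : (finSub H req Q T).toStr.P4n k =
    {x | ∃ t : Finset (finSub H req Q T).toStr.P0, t.card = k ∧
      t.sup (finSub H req Q T).toStr.G = x} :=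
  TauStr.P4n_eq finSub_G_injective h.isAtom_iff k

theorem mem_P4_iff_exists {x : (finSub H req Q T).toStr.P1} : x ∈ (finSub H req Q T).toStr.P4 ↔
    ∃ t : Finset (finSub H req Q T).toStr.P0, t.sup (finSub H req Q T).toStr.G = x := by
  classical
  rw [h.mem_P4_iff]
  constructor
  · intro hx
    refine ⟨Finset.univ.filter fun a => subPt a ∈ subSet H req _ x,
      subSet_injective H req _ ?_⟩
    rw [subSet_sup_G]
    ext p
    constructor
    · rintro ⟨a, ha, rfl⟩
      exact (Finset.mem_filter.1 ha).2
    · intro hp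
      exact ⟨ptSub (hx hp), Finset.mem_filter.2 ⟨Finset.mem_univ _, hp⟩, rfl⟩
  · rintro ⟨t, rfl⟩
    rw [subSet_sup_G]
    rintro p ⟨a, -, rfl⟩
    exact subPt_mem a

omit h in
/-- The largest element of `P₄`. -/
theorem exists_subSet_eq : ∃ b, subSet H req (finSub H req Q T) b = Q := by
  classical
  refine ⟨Finset.univ.sup (finSub H req Q T).toStr.G, ?_⟩
  have := subSet_sup_G (H := H) (req := req) (Q := Q) (T := T) Finset.univ
  rw [this]
  ext p
  exact ⟨fun ⟨a, _, ha⟩ => ha ▸ subPt_mem a, fun hp => ⟨ptSub hp, Finset.mem_univ _, rfl⟩⟩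

theorem kNegOneFin (hH : GenericFamily H) : (finSub H req Q T).toStr.KNegOneFin where
  finGen := by
    refine ⟨Set.univ, ∅, Set.univ, Set.toFinite _, Set.finite_empty, Set.toFinite _,
      fun S h0 _ h2 => ⟨Set.univ_subset_iff.1 h0, ?_, Set.univ_subset_iff.1 h2⟩⟩
    rw [← top_le_iff, ← closure_gen_finSub, BooleanSubalgebra.closure_le]
    rintro _ ⟨a | ⟨m, c⟩, rfl⟩
    · exact S.G_mem a (h0 (Set.mem_univ a))
    · exact S.F_mem m c (h2 (Set.mem_univ c))
  R_hom := ⟨{ toFun := fun x => {a | subPt a ∈ subSet H req _ x}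
              map_sup' := fun _ _ => rfl
              map_inf' := fun _ _ => rfl
              map_top' := rfl
              map_bot' := rfl }, fun _ => rfl⟩
  P4_eq := by
    ext x
    rw [h.mem_P4_iff_exists, Set.mem_iUnion]
    simp only [h.P4n_eq]
    exact ⟨fun ⟨t, ht⟩ => ⟨_, t, rfl, ht⟩, fun ⟨_, t, _, ht⟩ => ⟨t, ht⟩⟩
  P4_principal := by
    obtain ⟨b, hb⟩ := exists_subSet_eq (H := H) (req := req) (Q := Q) (T := T)
    refine ⟨b, Set.ext fun x => ?_⟩
    rw [h.mem_P4_iff, ← hb]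
    rfl
  G_bij := by
    refine ⟨fun a _ => TauStr.mem_P4n_one.2 (isAtom_G a), finSub_G_injective.injOn, ?_⟩
    intro b hb
    obtain ⟨a, ha⟩ := (h.isAtom_iff b).1 (TauStr.mem_P4n_one.1 hb)
    exact ⟨a, Set.mem_univ _, ha⟩
  R_G a := by
    ext x
    exact Subtype.ext_iff.symm
  P2_finite := T.finite_toSet
  incomplete a ha c := by
    obtain ⟨p, rfl⟩ := (h.isAtom_iff a).1 (TauStr.mem_P4n_one.1 ha)
    refine (modelF_finite H req hH c.1 p.1).subset fun m hm => ?_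
    exact hm (Set.mem_singleton p.1)
  generated := by
    refine ⟨∅, Set.finite_empty, top_le_iff.1 (closure_gen_finSub.ge.trans
      (BooleanSubalgebra.closure_mono ?_))⟩
    rintro _ ⟨a | ⟨m, c⟩, rfl⟩
    · exact Or.inl (Or.inl (Set.finite_singleton a.1))
    · exact Or.inl (Or.inr ⟨m, c, rfl⟩)

end FreeAbove

end Model

/-! ### Generated substructures in K¹_{<ℵ₀} -/

section Model

variable {P Z L : Type u} {H : Z ⊕ L → ℕ → Set P} {req : L → List (genAlg H) × Finset P}
  {Q : Finset P} {T D : Finset (Z ⊕ L)} {n : ℕ}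

namespace FreeAbove

variable (h : FreeAbove H req Q T D n)
include h

theorem finite_P4 : (finSub H req Q T).toStr.P4.Finite := by
  refine Set.Finite.of_finite_image (f := subSet H req _) (Q.finite_toSet.finite_subsets.subset ?_)
    (subSet_injective H req _).injOn
  rintro _ ⟨x, hx, rfl⟩
  exact h.mem_P4_iff.1 hx

theorem exists_of_notMem_P4 {x : (finSub H req Q T).toStr.P1}
    (hx : x ∉ (finSub H req Q T).toStr.P4) : ∃ p ∉ Q, p ∈ subSet H req _ x := by
  rw [h.mem_P4_iff, Set.not_subset] at hx
  obtain ⟨p, hp, hpQ⟩ := hx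
  exact ⟨p, hpQ, hp⟩

theorem notMem_P4 {x : (finSub H req Q T).toStr.P1} {p : P} (hp : p ∉ Q)
    (hpx : p ∈ subSet H req _ x) : x ∉ (finSub H req Q T).toStr.P4 := fun hx =>
  hp (h.mem_P4_iff.1 hx hpx)

theorem isLowerSet_P4 : IsLowerSet (finSub H req Q T).toStr.P4 := by
  intro x y hxy hx
  rw [h.mem_P4_iff] at hx ⊢
  exact subset_trans hxy hx

theorem top_notMem_P4 : ⊤ ∉ (finSub H req Q T).toStr.P4 := by
  obtain ⟨p, hp⟩ := h.infinite_compl.nonempty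
  exact h.notMem_P4 (p := p) hp (by rw [map_top]; exact Set.mem_univ p)

/-- Off `Q` the initial terms of all sequences are functions of the pattern of those in `D`; the
finitely many points of `Q` are adjusted by singletons. -/
theorem closure_P4_union_eq : BooleanSubalgebra.closure ((finSub H req Q T).toStr.P4 ∪
    {x | ∃ m < n, ∃ c : (finSub H req Q T).toStr.P2, c.1 ∈ D ∧
      x = (finSub H req Q T).toStr.F m c}) = finLevel H req Q T n := by
  refine le_antisymm (BooleanSubalgebra.closure_mono ?_) ?_
  · rintro x (hx | ⟨m, hm, c, -, rfl⟩)
    · exact Or.inl hx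
    · exact Or.inr ⟨m, hm, c, rfl⟩
  · set A := BooleanSubalgebra.closure ((finSub H req Q T).toStr.P4 ∪
      {x | ∃ m < n, ∃ c : (finSub H req Q T).toStr.P2, c.1 ∈ D ∧
        x = (finSub H req Q T).toStr.F m c}) with hA
    rw [finLevel, BooleanSubalgebra.closure_le]
    rintro x (hx | ⟨k, hk, c, rfl⟩)
    · exact BooleanSubalgebra.subset_closure (Or.inl hx)
    · suffices hs : modelF H req c.1 k ∈ A.map (subSet H req (finSub H req Q T)) by
        obtain ⟨x, hx, hxe⟩ := BooleanSubalgebra.mem_map.1 hs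
        rwa [subSet_injective H req _ (hxe.trans (subSet_F k c).symm)] at hx
      refine BooleanSubalgebra.mem_of_finite_determined _
        (Y := ((fun q : P => ({q} : Set P)) '' Q) ∪
          ((fun z : (Z ⊕ L) × ℕ => modelF H req z.1 z.2) '' (D ×ˢ Finset.range n : Finset _)))
        ((Q.finite_toSet.image _).union ((Finset.finite_toSet _).image _)) ?_ ?_
      · rintro _ (⟨q, hq, rfl⟩ | ⟨⟨d, m⟩, hz, rfl⟩)
        · exact ⟨_, BooleanSubalgebra.subset_closure
            (Or.inl (Set.finite_singleton q : ({q} : Set P).Finite)), subSet_G (ptSub hq)⟩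
        · obtain ⟨hd, hm⟩ := Finset.mem_product.1 (Finset.mem_coe.1 hz)
          exact ⟨_, BooleanSubalgebra.subset_closure (Or.inr ⟨m, Finset.mem_range.1 hm,
            ⟨d, h.subset hd⟩, hd, rfl⟩), subSet_F m ⟨d, h.subset hd⟩⟩
      · intro p p' hpp hp
        by_cases hpQ : p ∈ Q
        · have : p' ∈ ({p} : Set P) := (hpp {p} (Or.inl ⟨p, hpQ, rfl⟩)).1 rfl
          rwa [Set.mem_singleton_iff.1 this]
        · have hpQ' : p' ∉ Q := fun h => hpQ (by
            have : p ∈ ({p'} : Set P) := (hpp {p'} (Or.inl ⟨p', h, rfl⟩)).2 rfl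
            rwa [Set.mem_singleton_iff.1 this])
          refine (h.determined p hpQ p' hpQ' (fun d hd m hm => ?_) c.1 c.2 k hk).2 hp
          exact (hpp _ (Or.inr ⟨(d, m), Finset.mem_coe.2 (Finset.mem_product.2
            ⟨hd, Finset.mem_range.2 hm⟩), rfl⟩)).symm

theorem exists_free : ∃ Y : Set (finSub H req Q T).toStr.P1,
    IndepMod (fun y : Y => (y : (finSub H req Q T).toStr.P1)) ∅ (finSub H req Q T).toStr.P4 ∧
    BooleanSubalgebra.closure ((finSub H req Q T).toStr.P4 ∪ Y) = finLevel H req Q T n := by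
  classical
  refine ⟨_, ?_, h.closure_P4_union_eq⟩
  refine indepMod_of_boolCell h.isLowerSet_P4 fun a ha haP s v => ?_
  have hatop : a = ⊤ := by
    have : a ∈ (⊥ : BooleanSubalgebra (finSub H req Q T).toStr.P1) :=
      BooleanSubalgebra.closure_le.2 (Set.empty_subset _) ha
    rcases BooleanSubalgebra.mem_bot.1 this with rfl | rfl
    · exact absurd (h.mem_P4_iff.2 (by rw [map_bot]; exact Set.empty_subset _)) haP
    · rfl
  rw [hatop, inf_top_eq]
  -- The sign is attached to the set, not to the pair (c, m), so no injectivity of F on these pairs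
  -- is needed.
  obtain ⟨p, hpQ, hp⟩ := h.free fun c m =>
    ∃ y ∈ s, modelF H req c m = subSet H req _ y.1 ∧ v y = true
  refine h.notMem_P4 hpQ ?_
  rw [map_boolCell, mem_boolCell]
  rintro ⟨y, m, hm, c, hc, rfl⟩ hy
  refine (hp c.1 hc m hm).trans ⟨?_, fun hv => ⟨_, hy, rfl, hv⟩⟩
  rintro ⟨y', hy', hye, hv⟩
  have : y'.1 = (finSub H req Q T).toStr.F m c := subSet_injective H req _ hye.symm
  rwa [show y' = ⟨_, m, hm, c, hc, rfl⟩ from Subtype.ext this] at hv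

/-- `P₄` generates only finite and cofinite sets, and these do not affect independence modulo finite
sets. -/
theorem F_indep (hH : GenericFamily H) (c : (finSub H req Q T).toStr.P2) :
    IndepMod (fun m => (finSub H req Q T).toStr.F m c) (finSub H req Q T).toStr.P4
      (finSub H req Q T).toStr.P4 := by
  refine indepMod_of_boolCell h.isLowerSet_P4 fun a ha haP s v => ?_
  have hcof : (subSet H req _ a)ᶜ.Finite := by
    have : (subSet H req _ a).Finite ∨ (subSet H req _ a)ᶜ.Finite := by
      clear haP
      induction ha using BooleanSubalgebra.closure_bot_sup_induction with
      | mem x hx => exact Or.inl hx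
      | bot => exact Or.inl (by rw [map_bot]; exact Set.finite_empty)
      | sup x _ y _ hx hy =>
        rw [map_sup]
        rcases hx with hx | hx
        · rcases hy with hy | hy
          · exact Or.inl (hx.union hy)
          · exact Or.inr (hy.subset (Set.compl_subset_compl.2 Set.subset_union_right))
        · exact Or.inr (hx.subset (Set.compl_subset_compl.2 Set.subset_union_left))
      | compl x _ hx =>
        rw [map_compl', compl_compl]
        exact hx.symm
    exact this.resolve_left haP
  have hinf := (modelF_seqIndep H req hH c.1 (s.sup id + 1) fun m => v m = true).sdiff hcof
  intro hfin
  have hfin : (subSet H req (finSub H req Q T)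
    (boolCell (fun m => (finSub H req Q T).toStr.F m c) s v ⊓ a)).Finite := hfin
  refine hinf (hfin.subset ?_)
  rintro p ⟨hp, hpa⟩
  rw [map_inf, map_boolCell]
  refine ⟨mem_boolCell.2 fun m hm => hp m ?_, not_not.1 hpa⟩
  exact Nat.lt_succ_of_le (Finset.le_sup (f := id) hm)

/-- An element of level n outside `P₄` contains, up to `Q`, a whole cell, in which all finite tails
occur. -/
theorem F_free : IndepMod (fun i : {m : ℕ // n ≤ m} × (finSub H req Q T).toStr.P2 =>
    (finSub H req Q T).toStr.F i.1 i.2) (finLevel H req Q T n) (finSub H req Q T).toStr.P4 := by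
  classical
  refine indepMod_of_boolCell h.isLowerSet_P4 fun a ha haP s v => ?_
  have ha : a ∈ finLevel H req Q T n := BooleanSubalgebra.closure_le.2 subset_rfl ha
  obtain ⟨p, hpQ, hpa⟩ := h.exists_of_notMem_P4 haP
  have hw : ∀ c : Z ⊕ L, {m | ∃ i ∈ s, i.2.1 = c ∧ v i = true ∧ i.1.1 = m}.Finite := fun c =>
    (s.finite_toSet.image fun i => i.1.1).subset fun m ⟨i, hi, _, _, hm⟩ => ⟨i, hi, hm⟩
  obtain ⟨p', hp', hp'Q, hpt⟩ :=
    (h.exists_tail p hpQ n le_rfl fun c => (hw c).toFinset).nonempty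
  refine h.notMem_P4 hp'Q ?_
  rw [map_inf, map_boolCell]
  refine ⟨mem_boolCell.2 ?_, (h.mem_subSet_iff_of_mem_finLevel ha hpQ hp'Q hp').1 hpa⟩
  rintro ⟨⟨m, hm⟩, c⟩ hi
  refine (hpt c.1 c.2 m hm).trans ?_
  rw [Set.Finite.mem_toFinset]
  constructor
  · rintro ⟨⟨⟨m', hm'⟩, c'⟩, -, hc, hv, rfl⟩
    rwa [show c' = c from Subtype.ext hc] at hv
  · intro hv
    exact ⟨_, hi, rfl, hv, rfl⟩

theorem isWitness (hH : GenericFamily H) {b : (finSub H req Q T).toStr.P1}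
    (hb : subSet H req _ b = Q) :
    (finSub H req Q T).toStr.IsWitness n (finLevel H req Q T) b := by
  classical
  have hP4 : (finSub H req Q T).toStr.P4 = {c | c ≤ b} := by
    ext x
    rw [h.mem_P4_iff, ← hb]
    rfl
  refine
    { isLUB := by rw [hP4]; exact isLUB_Iic
      P4_bounded := ?_
      B_finite := fun m _ => BooleanSubalgebra.closure_finite (h.finite_P4.union ?_)
      B_mono := fun m m' _ hm => finLevel_mono hm
      P4_eq := hP4
      P4_ssubset := ?_
      B_gen := rfl
      B_free := h.exists_free
      union := exists_mem_finLevel n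
      P2_finite := T.finite_toSet
      P2_nonempty := h.nonempty.to_subtype
      F_indep := h.F_indep hH
      F_free := h.F_free
      F_inf := ?_
      B_eq := ?_ }
  · refine ⟨Fintype.card (finSub H req Q T).toStr.P0, ?_, fun j hj => ?_⟩
    · rw [← hP4]
      ext x
      rw [h.mem_P4_iff_exists]
      simp only [Set.mem_iUnion, h.P4n_eq]
      exact ⟨fun ⟨_, _, t, _, ht⟩ => ⟨t, ht⟩, fun ⟨t, ht⟩ => ⟨_, Finset.card_le_univ t, t, rfl, ht⟩⟩
    · rw [h.P4n_eq, Set.eq_empty_iff_forall_notMem]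
      rintro x ⟨t, rfl, -⟩
      exact absurd (Finset.card_le_univ t) (not_le.2 hj)
  · refine (((Set.finite_lt_nat m).prod (Set.finite_univ
      (α := (finSub H req Q T).toStr.P2))).image
      fun z => (finSub H req Q T).toStr.F z.1 z.2).subset ?_
    rintro _ ⟨k, hk, c, rfl⟩
    exact ⟨(k, c), ⟨hk, Set.mem_univ c⟩, rfl⟩
  · refine ⟨fun x hx => BooleanSubalgebra.subset_closure (Or.inl hx), fun hsub => ?_⟩
    exact h.top_notMem_P4 (hsub BooleanSubalgebra.top_mem)
  · intro m hm c
    apply subSet_injective H req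
    rw [map_inf, hb, map_bot, subSet_F]
    ext p
    exact iff_of_false (fun hp => h.tail_notMem p hp.2 c.1 c.2 m hm hp.1) id
  · intro m hm
    refine le_antisymm (BooleanSubalgebra.closure_le.2 ?_) (BooleanSubalgebra.closure_le.2 ?_)
    · rintro x (hx | ⟨k, hk, c, rfl⟩)
      · exact BooleanSubalgebra.subset_closure
          (Or.inl (BooleanSubalgebra.subset_closure (Or.inl hx)))
      · by_cases hkn : k < n
        · exact BooleanSubalgebra.subset_closure
            (Or.inl (BooleanSubalgebra.subset_closure (Or.inr ⟨k, hkn, c, rfl⟩)))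
        · exact BooleanSubalgebra.subset_closure (Or.inr ⟨k, not_lt.1 hkn, hk, c, rfl⟩)
    · rintro x (hx | ⟨k, -, hk, c, rfl⟩)
      · exact finLevel_mono hm hx
      · exact BooleanSubalgebra.subset_closure (Or.inr ⟨k, hk, c, rfl⟩)

theorem kOneFin (hH : GenericFamily H) : (finSub H req Q T).toStr.KOneFin := by
  obtain ⟨b, hb⟩ := exists_subSet_eq (H := H) (req := req) (Q := Q) (T := T)
  exact ⟨h.kNegOneFin hH, n, _, b, h.isWitness hH hb⟩

end FreeAbove

end Model

/-! ### The model is in K₁ -/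

section Model

variable {P Z L : Type u} {H : Z ⊕ L → ℕ → Set P} {req : L → List (genAlg H) × Finset P}

/-- Only finitely many points lie in finite cells. -/
theorem finite_setOf_cellOf_finite {C : Type u} (F : C → ℕ → Set P) (T : Finset C) (n : ℕ) :
    {p | (cellOf F T n p).Finite}.Finite := by
  by_contra h
  obtain ⟨p, hp, hinf⟩ := exists_infinite_fiber
    (fun p (c : T) (m : Fin n) => (p ∈ F c m : Prop)) h
  refine (hinf.mono ?_) hp
  rintro p' ⟨-, hpp⟩ c hc m hm
  exact iff_of_eq (congrFun (congrFun hpp ⟨c, hc⟩) ⟨m, hm⟩)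

theorem exists_level_notMem (hH : GenericFamily H) (Q : Finset P) (T : Finset (Z ⊕ L)) :
    ∃ k, ∀ p ∈ Q, ∀ c ∈ T, ∀ m ≥ k, p ∉ modelF H req c m := by
  have hfin : (⋃ p ∈ Q, ⋃ c ∈ T, {m | p ∈ modelF H req c m}).Finite :=
    Q.finite_toSet.biUnion fun p _ => T.finite_toSet.biUnion fun c _ => modelF_finite H req hH c p
  obtain ⟨k, hk⟩ := hfin.bddAbove
  refine ⟨k + 1, fun p hp c hc m hm hmem => ?_⟩
  have := hk (Set.mem_biUnion hp (Set.mem_biUnion hc hmem))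
  omega

/-- Beyond the level of genericity infinite cells remain infinite. -/
theorem CellGeneric.infinite_cellOf (hH : GenericFamily H) {T : Finset (Z ⊕ L)} {V : Finset L}
    {n₀ n : ℕ} (hg : CellGeneric H req T V n₀) {p : P}
    (hp : (cellOf (modelF H req) T n₀ p).Infinite) : (cellOf (modelF H req) T n p).Infinite := by
  refine (hg p hp ∅ (Finset.disjoint_empty_left _)
    (fun c => (modelF_finite H req hH c p).toFinset) fun _ => ∅).mono ?_
  rintro p' ⟨h1, h2, -⟩ c hc m -
  by_cases hm : m < n₀
  · exact h1 c hc m hm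
  · exact (h2 c hc m (not_lt.1 hm)).trans (Set.Finite.mem_toFinset _)

/-- The quotient by `P₄` need not be free for `T` alone, since only some patterns are realized. One
adjoins a sequence for each element of `T` and lets a pattern e of these be admissible at p when a
retraction θ onto the realized patterns takes e to the pattern of p. All new patterns then occur,
and the old pattern is θ of the new one. -/
theorem exists_freeAbove (hH : GenericFamily H) (hreq : ∀ r, {l | req l = r}.Infinite)
    [Infinite P] (Q₀ : Finset P) {T : Finset (Z ⊕ L)} (hT : T.Nonempty) :
    ∃ Q T' D n, Q₀ ⊆ Q ∧ T ⊆ T' ∧ FreeAbove H req Q T' D n := by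
  classical
  obtain ⟨V, n₀, hV, hg⟩ := exists_cellGeneric H req hH T
  -- Points in finite cells are put into `Q`, so that all cells of other points are infinite.
  set Q : Finset P := Q₀ ∪ (finite_setOf_cellOf_finite (modelF H req) T n₀).toFinset with hQdef
  obtain ⟨k, hk⟩ := exists_level_notMem (req := req) hH Q T
  set n := max n₀ k with hn
  have hQ : ∀ p ∉ Q, (cellOf (modelF H req) T n p).Infinite := by
    intro p hp
    refine (hg n₀ le_rfl).infinite_cellOf hH fun hfin => hp ?_
    exact Finset.mem_union_right _ ((Set.Finite.mem_toFinset _).2 hfin)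
  let pat : P → T → Fin n → Prop := fun p c m => p ∈ modelF H req c m
  have hpat : ∀ {p p'}, p' ∈ cellOf (modelF H req) T n p ↔ pat p' = pat p := by
    intro p p'
    constructor
    · intro h
      funext c m
      exact propext (h c.1 c.2 m.1 m.2)
    · intro h c hc m hm
      exact iff_of_eq (congrFun (congrFun h ⟨c, hc⟩) ⟨m, hm⟩)
  obtain ⟨q₀, hq₀⟩ := Infinite.exists_notMem_finset Q
  let θ : (T → Fin n → Prop) → (T → Fin n → Prop) := fun e =>
    if ∃ p ∉ Q, pat p = e then e else pat q₀
  have hθ : ∀ e, ∃ p ∉ Q, θ e = pat p := by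
    intro e
    by_cases h : ∃ p ∉ Q, pat p = e
    · obtain ⟨p, hp, hpe⟩ := id h
      exact ⟨p, hp, by simp only [θ, if_pos h, hpe]⟩
    · exact ⟨q₀, hq₀, by simp only [θ, if_neg h]⟩
  have hθpat : ∀ p ∉ Q, θ (pat p) = pat p := fun p hp => if_pos ⟨p, hp, rfl⟩
  obtain ⟨h, hinj, hnotin, honQ, hgood, hgen⟩ := exists_extension H req hreq hV
    (hg n (le_max_left _ _)) (D := T) Q hQ (fun p => {e | θ e = pat p})
    (fun p hp => ⟨pat p, hθpat p hp⟩)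
    (fun p p' hpp => by rw [hpat.1 hpp])
    (fun d η => by
      obtain ⟨p, hp, hpe⟩ := hθ fun _ => η
      exact ⟨p, hp, _, hpe, rfl⟩)
    fun _ _ _ => False
  let D : Finset (Z ⊕ L) := Finset.univ.image fun d => .inr (h d)
  have hD : ∀ d, .inr (h d) ∈ D := fun d => Finset.mem_image_of_mem _ (Finset.mem_univ d)
  have hdet : ∀ p ∉ Q, ∀ p' ∉ Q, p' ∈ cellOf (modelF H req) D n p → pat p' = pat p := by
    intro p hp p' hp' hpp
    rw [← hgood p' hp', ← hgood p hp]
    congr 1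
    funext d m
    exact propext (hpp _ (hD d) m.1 m.2)
  refine ⟨Q, T ∪ D, D, n, Finset.subset_union_left, Finset.subset_union_left,
    { nonempty := hT.mono Finset.subset_union_left
      subset := Finset.subset_union_right
      tail_notMem := ?_
      tail_generic := ?_
      free := ?_
      determined := ?_ }⟩
  · intro p hp c hc m hm
    rcases Finset.mem_union.1 hc with hc | hc
    · exact hk p hp c hc m ((le_max_right _ _).trans hm)
    · obtain ⟨d, -, rfl⟩ := Finset.mem_image.1 hc
      exact (honQ p hp d).2 m hm
  · intro p hp w
    refine (hgen p hp _ (hgood p hp) w).mono ?_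
    rintro p' ⟨h1, h2, h3, h4⟩
    constructor
    · intro c hc m hm
      rcases Finset.mem_union.1 hc with hc | hc
      · exact h1 c hc m hm
      · obtain ⟨d, -, rfl⟩ := Finset.mem_image.1 hc
        exact h2 d ⟨m, hm⟩
    · intro c hc m hm
      rcases Finset.mem_union.1 hc with hc | hc
      · exact h3 c hc m hm
      · obtain ⟨d, -, rfl⟩ := Finset.mem_image.1 hc
        exact h4 d m hm
  · intro e
    obtain ⟨p, hp, hpe⟩ := hθ fun d m => e (.inr (h d)) m
    obtain ⟨p', ⟨-, h2, -⟩, hp'⟩ :=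
      ((hgen p hp _ hpe fun _ => ∅).sdiff Q.finite_toSet).nonempty
    refine ⟨p', hp', fun c hc m hm => ?_⟩
    obtain ⟨d, -, rfl⟩ := Finset.mem_image.1 hc
    exact h2 d ⟨m, hm⟩
  · intro p hp p' hp' hpp c hc m hm
    rcases Finset.mem_union.1 hc with hc | hc
    · exact hpat.2 (hdet p hp p' hp' hpp) c hc m hm
    · exact hpp c hc m hm

/-- The elements of a substructure, as a subalgebra of `genAlg H`. -/
def subAlg (S : (genModel H req).Sub) : BooleanSubalgebra (genAlg H) := S.S1

theorem finset_mem_finSub {Q : Finset P} {T : Finset (Z ⊕ L)} {s : Finset P} (hs : s ⊆ Q) :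
    (⟨(s : Set P), finite_mem_genAlg H s.finite_toSet⟩ : genAlg H) ∈
      subAlg (finSub H req Q T) := by
  classical
  induction s using Finset.induction_on with
  | empty =>
    have : (⊥ : genAlg H) ∈ subAlg (finSub H req Q T) := BooleanSubalgebra.bot_mem
    convert this using 1
    exact Subtype.ext Finset.coe_empty
  | insert p s _ ih =>
    rw [Finset.insert_subset_iff] at hs
    have h1 : (⟨{p}, singleton_mem_genAlg H p⟩ : genAlg H) ∈ subAlg (finSub H req Q T) :=
      BooleanSubalgebra.subset_closure (Or.inl ⟨p, hs.1, rfl⟩)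
    have := BooleanSubalgebra.sup_mem h1 (ih hs.2)
    convert this using 1
    exact Subtype.ext (Finset.coe_insert p s)

/-- Past its initial segment, the sequence at `l` is the generating sequence without finitely many
points; adding these back recovers the generating sets. -/
theorem gen_inr_mem_finSub (l : L) (m : ℕ) :
    (⟨H (.inr l) m, gen_mem_genAlg H _ _⟩ : genAlg H) ∈
      subAlg (finSub H req (effReq H req l).2 {.inr l}) := by
  set r := effReq H req l with hr
  have hfin : (H (.inr l) m ∩ r.2).Finite := r.2.finite_toSet.inter_of_right _
  have h1 := finset_mem_finSub (H := H) (req := req) (Q := r.2) (T := {.inr l})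
    (s := hfin.toFinset) fun p hp => ((Set.Finite.mem_toFinset hfin).1 hp).2
  have h2 : (⟨modelF H req (.inr l) (m + r.1.length), modelF_mem_genAlg H req _ _⟩ : genAlg H) ∈
      subAlg (finSub H req r.2 {.inr l}) :=
    BooleanSubalgebra.subset_closure (Or.inr ⟨_, _, Finset.mem_singleton_self _, rfl⟩)
  have key := BooleanSubalgebra.sup_mem h2 h1
  convert key using 1
  refine Subtype.ext ?_
  have hF : modelF H req (.inr l) (m + r.1.length) = H (.inr l) m \ r.2 := by
    change shiftedSeq H (effReq H req l) l (m + r.1.length) = _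
    rw [shiftedSeq_of_ge H (Nat.le_add_left _ _), ← hr, Nat.add_sub_cancel]
  change H (.inr l) m = modelF H req (.inr l) (m + r.1.length) ∪ (hfin.toFinset : Set P)
  rw [hF, Set.Finite.coe_toFinset, Set.sdiff_union_inter]

/-- Every element of `P₁` lies in some finitely generated substructure. -/
theorem exists_mem_finSub (b : (genModel H req).P1) :
    ∃ (Q : Finset P) (T : Finset (Z ⊕ L)), b ∈ (finSub H req Q T).S1 := by
  classical
  suffices hs : ∀ x (hx : x ∈ genAlg H), ∃ (Q : Finset P) (T : Finset (Z ⊕ L)),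
      (⟨x, hx⟩ : (genModel H req).P1) ∈ (finSub H req Q T).S1 from hs b.1 b.2
  have hmono : ∀ {Q Q' : Finset P} {T T' : Finset (Z ⊕ L)}, Q ⊆ Q' → T ⊆ T' →
      (finSub H req Q T).S1 ≤ (finSub H req Q' T').S1 := by
    intro Q Q' T T' hQ hT
    refine BooleanSubalgebra.closure_mono ?_
    rintro x (⟨a, ha, rfl⟩ | ⟨m, c, hc, rfl⟩)
    · exact Or.inl ⟨a, hQ ha, rfl⟩
    · exact Or.inr ⟨m, c, hT hc, rfl⟩
  intro x hx
  induction hx using BooleanSubalgebra.closure_bot_sup_induction with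
  | mem x hx =>
    rcases hx with ⟨p, rfl⟩ | ⟨⟨z | l, m⟩, rfl⟩
    · exact ⟨{p}, ∅, BooleanSubalgebra.subset_closure
        (Or.inl ⟨p, Finset.mem_singleton_self p, rfl⟩)⟩
    · exact ⟨∅, {.inl z}, BooleanSubalgebra.subset_closure
        (Or.inr ⟨m, .inl z, by simp, rfl⟩)⟩
    · exact ⟨_, _, gen_inr_mem_finSub l m⟩
  | bot => exact ⟨∅, ∅, BooleanSubalgebra.bot_mem⟩
  | sup x _ y _ hx hy =>
    obtain ⟨Q, T, hx⟩ := hx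
    obtain ⟨Q', T', hy⟩ := hy
    exact ⟨Q ∪ Q', T ∪ T', BooleanSubalgebra.sup_mem
      (hmono Finset.subset_union_left Finset.subset_union_left hx)
      (hmono Finset.subset_union_right Finset.subset_union_right hy)⟩
  | compl x _ hx =>
    obtain ⟨Q, T, hx⟩ := hx
    exact ⟨Q, T, BooleanSubalgebra.compl_mem hx⟩

/-- Members of K¹_{<ℵ₀} are generated by their elements of `P₀` and `P₂`. -/
theorem KOneFin_sub_le {M : TauStr.{u}} {S U : M.Sub} (hS : S.toStr.KOneFin) (h0 : S.S0 ⊆ U.S0)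
    (h2 : S.S2 ⊆ U.S2) : S.IsSub U := by
  refine ⟨h0, fun x hx => ?_, h2⟩
  obtain ⟨h, n, B, b, hw⟩ := hS
  have hx' : (⟨x, hx⟩ : S.toStr.P1) ∈ BooleanSubalgebra.closure (Set.range S.toStr.gen) := by
    rw [hw.closure_gen h]
    exact BooleanSubalgebra.mem_top
  suffices hs : ∀ y ∈ BooleanSubalgebra.closure (Set.range S.toStr.gen), y.1 ∈ U.S1 from hs _ hx'
  intro y hy
  induction hy using BooleanSubalgebra.closure_bot_sup_induction with
  | mem y hy =>
    obtain ⟨a | ⟨m, c⟩, rfl⟩ := hy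
    · exact U.G_mem a.1 (h0 a.2)
    · exact U.F_mem m c.1 (h2 c.2)
  | bot => exact BooleanSubalgebra.bot_mem
  | sup y _ z _ hy hz => exact BooleanSubalgebra.sup_mem hy hz
  | compl y _ hy => exact BooleanSubalgebra.compl_mem hy

/-- The family of all substructures in K¹_{<ℵ₀} is directed, since finite sets of points and indices
can be enlarged by `exists_freeAbove`. -/
theorem genModel_kOne (hH : GenericFamily H) (hreq : ∀ r, {l | req l = r}.Infinite)
    [Infinite P] : (genModel H req).KOne := by
  classical
  obtain ⟨l₀, -⟩ := (hreq ([], ∅)).nonempty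
  have hex : ∀ (Q : Finset P) (T : Finset (Z ⊕ L)), ∃ Q' T', Q ⊆ Q' ∧ T ⊆ T' ∧
      (finSub H req Q' T').toStr.KOneFin := by
    intro Q T
    obtain ⟨Q', T', D, n, hQ, hT, hF⟩ := exists_freeAbove hH hreq Q
      (Finset.insert_nonempty (.inr l₀) T)
    exact ⟨Q', T', hQ, (Finset.subset_insert _ _).trans hT, hF.kOneFin hH⟩
  refine ⟨{S | S.toStr.KOneFin}, ?_, fun S hS => hS, ?_, fun p => ?_, fun b => ?_, fun c => ?_⟩
  · obtain ⟨Q, T, -, -, h⟩ := hex ∅ ∅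
    exact ⟨_, h⟩
  · intro S hS S' hS'
    have hfin : ∀ S : (genModel H req).Sub, S.toStr.KOneFin → S.S0.Finite ∧ S.S2.Finite := by
      rintro S ⟨h, n, B, b, hw⟩
      exact ⟨hw.finite_P0 h, h.P2_finite⟩
    obtain ⟨f0, f2⟩ := hfin S hS
    obtain ⟨f0', f2'⟩ := hfin S' hS'
    obtain ⟨Q, T, hQ, hT, h⟩ := hex (f0.union f0').toFinset (f2.union f2').toFinset
    have hQ' : S.S0 ∪ S'.S0 ⊆ (Q : Set P) := fun x hx => hQ ((Set.Finite.mem_toFinset _).2 hx)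
    have hT' : S.S2 ∪ S'.S2 ⊆ (T : Set (Z ⊕ L)) := fun x hx =>
      hT ((Set.Finite.mem_toFinset _).2 hx)
    exact ⟨_, h, KOneFin_sub_le hS (Set.subset_union_left.trans hQ')
      (Set.subset_union_left.trans hT'), KOneFin_sub_le hS'
      (Set.subset_union_right.trans hQ') (Set.subset_union_right.trans hT')⟩
  · obtain ⟨Q, T, hQ, -, h⟩ := hex {p} ∅
    exact ⟨_, h, hQ (Finset.mem_singleton_self p)⟩
  · obtain ⟨Q, T, hb⟩ := exists_mem_finSub b
    obtain ⟨Q', T', hQ, hT, h⟩ := hex Q T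
    refine ⟨_, h, (BooleanSubalgebra.closure_mono ?_ : (finSub H req Q T).S1 ≤ _) hb⟩
    rintro x (⟨a, ha, rfl⟩ | ⟨m, c, hc, rfl⟩)
    · exact Or.inl ⟨a, hQ ha, rfl⟩
    · exact Or.inr ⟨m, c, hT hc, rfl⟩
  · obtain ⟨Q, T, -, hT, h⟩ := hex ∅ {c}
    exact ⟨_, h, hT (Finset.mem_singleton_self c)⟩

end Model

/-! ### Cells of finite structures -/

section Patterns

namespace TauStr

variable {M : TauStr.{u}} [Fintype M.P0] [Fintype M.P2]

open Classical in
/-- The cell of level `n` that avoids `P₀` and has the pattern `U`. -/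
noncomputable def patCell (M : TauStr.{u}) [Fintype M.P0] [Fintype M.P2] (n : ℕ)
    (U : M.P2 → ℕ → Prop) : M.P1 :=
  boolCell M.gen (M.genFinset n) (Sum.elim (fun _ => false) fun z => decide (U z.2 z.1))

theorem boolCell_eq_patCell {n : ℕ} {v : M.P0 ⊕ (ℕ × M.P2) → Bool} {U : M.P2 → ℕ → Prop}
    (h0 : ∀ a, v (.inl a) = false) (hU : ∀ m < n, ∀ c, (v (.inr (m, c)) = true ↔ U c m)) :
    boolCell M.gen (M.genFinset n) v = M.patCell n U := by
  refine boolCell_congr _ ?_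
  rintro (a | ⟨m, c⟩) hi
  · exact h0 a
  · rw [Bool.eq_iff_iff, hU m (inr_mem_genFinset.1 hi)]
    simp

theorem patCell_congr {n : ℕ} {U U' : M.P2 → ℕ → Prop}
    (h : ∀ m < n, ∀ c, (U c m ↔ U' c m)) : M.patCell n U = M.patCell n U' :=
  boolCell_eq_patCell (fun _ => rfl) fun m hm c => by simp [h m hm]

theorem patCell_anti {n n' : ℕ} (h : n ≤ n') (U : M.P2 → ℕ → Prop) :
    M.patCell n' U ≤ M.patCell n U := by
  refine boolCell_anti _ ?_ _
  rintro (a | ⟨m, c⟩) hi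
  · exact inl_mem_genFinset _ a
  · exact inr_mem_genFinset.2 ((inr_mem_genFinset.1 hi).trans_le h)

theorem patCell_le_compl_G {n : ℕ} {U : M.P2 → ℕ → Prop} (a : M.P0) :
    M.patCell n U ≤ (M.G a)ᶜ :=
  boolCell_le M.gen (inl_mem_genFinset n a)

open Classical in
theorem patCell_le_F {n m : ℕ} (hm : m < n) {U : M.P2 → ℕ → Prop} (c : M.P2) :
    M.patCell n U ≤ if U c m then M.F m c else (M.F m c)ᶜ := by
  have := boolCell_le M.gen (v := Sum.elim (fun _ => false) fun z => decide (U z.2 z.1))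
    (inr_mem_genFinset.2 hm : .inr (m, c) ∈ M.genFinset n)
  simp only [Sum.elim_inr, decide_eq_true_eq] at this
  exact this

theorem KNegOneFin.patCell_mem_P4_iff (h : M.KNegOneFin) {n : ℕ} {U : M.P2 → ℕ → Prop} :
    M.patCell n U ∈ M.P4 ↔ M.patCell n U = ⊥ :=
  h.boolCell_mem_P4_iff (inl_mem_genFinset n) fun _ => rfl

/-- Every element outside of `P₄` meets a cell that avoids `P₀`. -/
theorem KNegOneFin.exists_patCell (h : M.KNegOneFin) {x : M.P1} (hx : x ∉ M.P4) (n : ℕ) :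
    ∃ U, x ⊓ M.patCell n U ≠ ⊥ := by
  by_contra! hcon
  refine hx (mem_of_inf_boolCell_mem h.supClosed_P4 M.gen (M.genFinset n) x fun v => ?_)
  by_cases hv : ∀ a, v (.inl a) = false
  · rw [boolCell_eq_patCell (U := fun c m => v (.inr (m, c)) = true) hv fun _ _ _ => Iff.rfl, hcon]
    exact h.bot_mem_P4
  · push Not at hv
    obtain ⟨a, ha⟩ := hv
    exact h.isLowerSet_P4 inf_le_right
      (h.boolCell_mem_P4_of_true (inl_mem_genFinset n a) (by simpa using ha))

theorem IsWitness.patCell_ne_bot {k : ℕ} {B : ℕ → BooleanSubalgebra M.P1} {b : M.P1}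
    (hw : M.IsWitness k B b) (h : M.KNegOneFin) {n n' : ℕ} (hk : k ≤ n) {U : M.P2 → ℕ → Prop}
    (hne : M.patCell n U ≠ ⊥) : M.patCell n' U ≠ ⊥ :=
  hw.boolCell_ne_bot h hk (fun _ => rfl) hne

-- The homomorphism given by R sends `G a` to {a}, and an atom lies below an element or below its
-- complement.
omit [Fintype M.P0] [Fintype M.P2] in
theorem KNegOneFin.R_iff (h : M.KNegOneFin) {a : M.P0} {b : M.P1} : M.R a b ↔ M.G a ≤ b := by
  obtain ⟨f, hf⟩ := h.R_hom
  have hG : f (M.G a) = {a} := (hf _).trans (h.R_G a)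
  have hmem : ∀ b, M.R a b ↔ a ∈ f b := fun b => by rw [hf]; rfl
  have hle : ∀ b, M.G a ≤ b → a ∈ f b := fun b hb =>
    (hG ▸ OrderHomClass.mono f hb : ({a} : Set M.P0) ≤ f b) rfl
  refine ⟨fun hR => ?_, fun hb => (hmem b).2 (hle b hb)⟩
  by_contra hb
  rw [← (h.isAtom_G a).le_compl_iff] at hb
  have := hle _ hb
  rw [map_compl'] at this
  exact this ((hmem b).1 hR)

end TauStr

end Patterns

/-! ### Embeddings into the model from a comparison of cells -/

section Embedding

variable {P Z L : Type u} {H : Z ⊕ L → ℕ → Set P} {req : L → List (genAlg H) × Finset P}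

/-- The elements of `genAlg H` as sets. -/
def genAlgSet (H : Z ⊕ L → ℕ → Set P) : BoundedLatticeHom (genAlg H) (Set P) where
  toFun x := x.1
  map_sup' _ _ := rfl
  map_inf' _ _ := rfl
  map_top' := rfl
  map_bot' := rfl

/-- The images of the generators of `N` under an embedding into `genModel H req` that is given by
`h0` and `h2`. -/
noncomputable def genImage (H : Z ⊕ L → ℕ → Set P) (req : L → List (genAlg H) × Finset P)
    {N : TauStr.{u}} (h0 : N.P0 → P) (h2 : N.P2 → Z ⊕ L) :
    N.P0 ⊕ (ℕ × N.P2) → genAlg H :=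
  Sum.elim (fun a => ⟨{h0 a}, singleton_mem_genAlg H _⟩)
    fun z => ⟨modelF H req (h2 z.2) z.1, modelF_mem_genAlg H req _ _⟩

theorem exists_genFinset_supset {N : TauStr.{u}} [Fintype N.P0] [Fintype N.P2] (n : ℕ)
    (s : Finset (N.P0 ⊕ (ℕ × N.P2))) : ∃ n' ≥ n, s ⊆ N.genFinset n' := by
  classical
  have hfin : {m | ∃ c, Sum.inr (m, c) ∈ s}.Finite :=
    (s.finite_toSet.image (Sum.elim (fun _ => 0) Prod.fst)).subset
      fun m ⟨c, hc⟩ => ⟨_, hc, rfl⟩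
  obtain ⟨k, hk⟩ := hfin.bddAbove
  refine ⟨max n (k + 1), le_max_left _ _, ?_⟩
  rintro (a | ⟨m, c⟩) hi
  · exact TauStr.inl_mem_genFinset _ a
  · have : m ≤ k := hk ⟨c, hi⟩
    exact TauStr.inr_mem_genFinset.2 (by omega)

theorem isLowerSet_singleton_bot {A : Type*} [BooleanAlgebra A] : IsLowerSet ({⊥} : Set A) := by
  rintro a b hab rfl
  exact le_bot_iff.1 hab

/-- Cells below an atom `G a` match by `hA`. For the others, `hB` makes a vanishing cell empty in
the model and `hC` makes a nonvanishing one infinite. So vanishing and membership in `P₄` agree for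
cells, hence for all polynomials, and Sikorski's criterion applies. -/
theorem exists_emb_of_cells {N : TauStr.{u}} (hN : N.KNegOneFin) [Fintype N.P0] [Fintype N.P2]
    (hcl : BooleanSubalgebra.closure (Set.range N.gen) = ⊤) {h0 : N.P0 → P} {h2 : N.P2 → Z ⊕ L}
    (h0i : Function.Injective h0) (h2i : Function.Injective h2) (n : ℕ)
    (hA : ∀ a m c, N.G a ≤ N.F m c ↔ h0 a ∈ modelF H req (h2 c) m)
    (hB : ∀ n' ≥ n, ∀ p ∉ Set.range h0, N.patCell n' (fun c m => p ∈ modelF H req (h2 c) m) ≠ ⊥)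
    (hC : ∀ n' ≥ n, ∀ U, N.patCell n' U ≠ ⊥ →
      {p | p ∉ Set.range h0 ∧ ∀ m < n', ∀ c, (p ∈ modelF H req (h2 c) m ↔ U c m)}.Infinite) :
    ∃ h : N.Emb (genModel H req), h.f0 = h0 ∧ h.f2 = h2 := by
  classical
  let y : N.P0 ⊕ (ℕ × N.P2) → Set P := fun i => genAlgSet H (genImage H req h0 h2 i)
  have hyl : ∀ a, y (.inl a) = {h0 a} := fun _ => rfl
  have hyr : ∀ m c, y (.inr (m, c)) = modelF H req (h2 c) m := fun _ _ => rfl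
  have hle : ∀ a j, N.G a ≤ N.gen j ↔ h0 a ∈ y j := by
    rintro a (a' | ⟨m, c⟩)
    · exact hN.G_le_G_iff.trans h0i.eq_iff.symm
    · exact hA a m c
  have hcell : ∀ n' ≥ n, ∀ v, (boolCell N.gen (N.genFinset n') v = ⊥ ↔
      boolCell y (N.genFinset n') v = ⊥) ∧ (boolCell N.gen (N.genFinset n') v ∈ N.P4 ↔
      (boolCell y (N.genFinset n') v).Finite) := by
    intro n' hn' v
    by_cases hv : ∀ a, v (.inl a) = false
    · let U : N.P2 → ℕ → Prop := fun c m => v (.inr (m, c)) = true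
      have hmem : ∀ p, p ∈ boolCell y (N.genFinset n') v ↔
          p ∉ Set.range h0 ∧ ∀ m < n', ∀ c, (p ∈ modelF H req (h2 c) m ↔ U c m) := by
        intro p
        rw [mem_boolCell]
        constructor
        · refine fun hp => ⟨?_, fun m hm c => hp (.inr (m, c)) (TauStr.inr_mem_genFinset.2 hm)⟩
          rintro ⟨a, rfl⟩
          have := (hp (.inl a) (TauStr.inl_mem_genFinset _ a)).1 rfl
          rw [hv] at this
          exact Bool.false_ne_true this
        · rintro ⟨hp0, hp⟩ (a | ⟨m, c⟩) hi
          · rw [hv]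
            exact iff_of_false (fun hpa => hp0 ⟨a, hpa.symm⟩) Bool.false_ne_true
          · exact hp m (TauStr.inr_mem_genFinset.1 hi) c
      rw [TauStr.boolCell_eq_patCell (U := U) hv fun _ _ _ => Iff.rfl, hN.patCell_mem_P4_iff]
      by_cases hbot : N.patCell n' U = ⊥
      · have hem : boolCell y (N.genFinset n') v = ⊥ := by
          refine Set.eq_empty_iff_forall_notMem.2 fun p hp => ?_
          obtain ⟨hp0, hp⟩ := (hmem p).1 hp
          refine hB n' hn' p hp0 ?_
          rw [TauStr.patCell_congr hp, hbot]
        rw [hem]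
        exact ⟨iff_of_true hbot rfl, iff_of_true hbot Set.finite_empty⟩
      · have hinf : (boolCell y (N.genFinset n') v).Infinite :=
          (hC n' hn' U hbot).mono fun p hp => (hmem p).2 hp
        refine ⟨iff_of_false hbot fun he => ?_, iff_of_false hbot hinf⟩
        rw [he] at hinf
        exact hinf Set.finite_empty
    · push Not at hv
      obtain ⟨a, ha⟩ := hv
      have ha : v (.inl a) = true := by simpa using ha
      have hmem := TauStr.inl_mem_genFinset (M := N) n' a
      constructor
      · refine (IsAtom.boolCell_eq_bot_iff (y := N.gen) (i := .inl a)
          (hN.isAtom_G a) hmem ha).trans ?_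
        refine Iff.trans ?_ (IsAtom.boolCell_eq_bot_iff (y := y) (i := .inl a)
          (Set.isAtom_singleton (h0 a)) hmem ha).symm
        refine not_congr (forall₂_congr fun j _ => iff_congr ?_ Iff.rfl)
        exact (hle a j).trans Set.singleton_subset_iff.symm
      · refine iff_of_true (hN.boolCell_mem_P4_of_true hmem ha) ?_
        have := boolCell_le y (v := v) hmem
        rw [ha] at this
        exact (Set.finite_singleton (h0 a)).subset this
  have hval : ∀ t : BTerm (N.P0 ⊕ (ℕ × N.P2)),
      genAlgSet H (t.eval (genImage H req h0 h2)) = t.eval y := fun t => BTerm.map_eval _ _ _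
  have hinj : Function.Injective (genAlgSet H) := Subtype.val_injective
  have hbot : ∀ t : BTerm (N.P0 ⊕ (ℕ × N.P2)),
      t.eval N.gen = ⊥ ↔ t.eval (genImage H req h0 h2) = ⊥ := by
    intro t
    obtain ⟨n', hn', hs⟩ := exists_genFinset_supset n t.supp
    rw [← hinj.eq_iff, hval, map_bot, ← Set.mem_singleton_iff,
      ← Set.mem_singleton_iff (a := t.eval y),
      eval_mem_ideal_iff isLowerSet_singleton_bot supClosed_singleton rfl _ t hs,
      eval_mem_ideal_iff isLowerSet_singleton_bot supClosed_singleton rfl _ t hs]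
    exact forall₂_congr fun v _ => (hcell n' hn' v).1
  have hP4 : ∀ t : BTerm (N.P0 ⊕ (ℕ × N.P2)), t.eval N.gen ∈ N.P4 ↔
      (genAlgSet H (t.eval (genImage H req h0 h2))).Finite := by
    intro t
    obtain ⟨n', hn', hs⟩ := exists_genFinset_supset n t.supp
    rw [hval, eval_mem_ideal_iff hN.isLowerSet_P4 hN.supClosed_P4 hN.bot_mem_P4 _ t hs]
    refine Iff.trans ?_ (eval_mem_ideal_iff (I := {s : Set P | s.Finite})
      (fun _ _ hab ha => Set.Finite.subset ha hab) (fun _ ha _ hb => Set.Finite.union ha hb)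
      Set.finite_empty y t hs).symm
    exact forall₂_congr fun v _ => (hcell n' hn' v).2
  obtain ⟨φ, hφ⟩ := exists_boundedLatticeHom_eval N.gen (genImage H req h0 h2) hcl
    fun t => (hbot t).1
  have hex : ∀ b : N.P1, ∃ t : BTerm (N.P0 ⊕ (ℕ × N.P2)), t.eval N.gen = b := fun b =>
    exists_eval_eq (by rw [hcl]; exact BooleanSubalgebra.mem_top)
  have hφbot : ∀ b, φ b = ⊥ → b = ⊥ := by
    intro b hb
    obtain ⟨t, rfl⟩ := hex b
    rw [hφ] at hb
    exact (hbot t).2 hb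
  have hφle : ∀ b b', φ b ≤ φ b' ↔ b ≤ b' := by
    intro b b'
    refine ⟨fun hb => ?_, fun hb => OrderHomClass.mono φ hb⟩
    rw [← sdiff_eq_bot_iff] at hb ⊢
    refine hφbot _ ?_
    rw [sdiff_eq, map_inf, map_compl', ← sdiff_eq, hb]
  have hφG : ∀ a, φ (N.G a) = genImage H req h0 h2 (.inl a) := fun a => hφ (.var (.inl a))
  have hφF : ∀ m c, φ (N.F m c) = genImage H req h0 h2 (.inr (m, c)) := fun m c =>
    hφ (.var (.inr (m, c)))
  exact ⟨{ f0 := h0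
           f1 := φ
           f2 := h2
           inj0 := h0i
           inj1 := fun b b' hb => le_antisymm ((hφle _ _).1 hb.le) ((hφle _ _).1 hb.ge)
           inj2 := h2i
           map_P4 := fun b => by
             obtain ⟨t, rfl⟩ := hex b
             refine Iff.trans ?_ (hP4 t).symm
             rw [← hφ]
             exact Iff.rfl
           map_R := fun a b => by
             rw [hN.R_iff, ← hφle, hφG]
             exact Set.singleton_subset_iff.symm
           map_G := hφG
           map_F := hφF }, rfl, rfl⟩

end Embedding

/-- Extending an injective function along an injection, with new values outside of the range. -/
theorem exists_injective_extension {α β γ : Type*} {i : α → β} (hi : Function.Injective i)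
    {f : α → γ} (hf : Function.Injective f) {g : {b // b ∉ Set.range i} → γ}
    (hg : Function.Injective g) (hfg : ∀ b, g b ∉ Set.range f) :
    ∃ h : β → γ, Function.Injective h ∧ (∀ a, h (i a) = f a) ∧ ∀ b, h b.1 = g b := by
  classical
  let h : β → γ := fun b => if hb : b ∈ Set.range i then f hb.choose else g ⟨b, hb⟩
  have h1 : ∀ a, h (i a) = f a := by
    intro a
    have hex : i a ∈ Set.range i := ⟨a, rfl⟩
    exact (dif_pos hex).trans (congrArg f (hi hex.choose_spec))
  have h2 : ∀ b, h b.1 = g b := fun b => dif_neg b.2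
  refine ⟨h, fun b b' hbb => ?_, h1, h2⟩
  by_cases hb : b ∈ Set.range i <;> by_cases hb' : b' ∈ Set.range i
  · obtain ⟨a, rfl⟩ := hb
    obtain ⟨a', rfl⟩ := hb'
    rw [h1, h1] at hbb
    rw [hf hbb]
  · obtain ⟨a, rfl⟩ := hb
    rw [h1, h2 ⟨b', hb'⟩] at hbb
    exact absurd ⟨a, hbb⟩ (hfg _)
  · obtain ⟨a', rfl⟩ := hb'
    rw [h1, h2 ⟨b, hb⟩] at hbb
    exact absurd ⟨a', hbb.symm⟩ (hfg _)
  · rw [h2 ⟨b, hb⟩, h2 ⟨b', hb'⟩] at hbb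
    exact congrArg Subtype.val (hg hbb)

/-! ### Richness -/

section Rich

variable {P Z L : Type u} {H : Z ⊕ L → ℕ → Set P} {req : L → List (genAlg H) × Finset P}
  {N₁ N₂ : TauStr.{u}}

namespace TauStr.Emb

/-- The points of the images of elements of `P₀`. -/
def pt (j : N₁.Emb (genModel H req)) (a : N₁.P0) : P := j.f0 a

/-- The indices of the images of elements of `P₂`. -/
def idx (j : N₁.Emb (genModel H req)) (c : N₁.P2) : Z ⊕ L := j.f2 c

/-- The images of elements of `P₁`, as sets of points. -/
def set (j : N₁.Emb (genModel H req)) : BoundedLatticeHom N₁.P1 (Set P) :=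
  (genAlgSet H).comp j.f1

variable (j : N₁.Emb (genModel H req))

theorem pt_injective : Function.Injective j.pt := j.inj0

theorem idx_injective : Function.Injective j.idx := j.inj2

theorem set_injective : Function.Injective j.set := fun _ _ h => j.inj1 (Subtype.ext h)

theorem set_G (a : N₁.P0) : j.set (N₁.G a) = {j.pt a} := congrArg Subtype.val (j.map_G a)

theorem set_F (m : ℕ) (c : N₁.P2) : j.set (N₁.F m c) = modelF H req (j.idx c) m :=
  congrArg Subtype.val (j.map_F m c)

theorem set_finite_iff (b : N₁.P1) : (j.set b).Finite ↔ b ∈ N₁.P4 := j.map_P4 b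

theorem G_le_iff {b : N₁.P1} {a : N₁.P0} : N₁.G a ≤ b ↔ j.pt a ∈ j.set b := by
  rw [← Set.singleton_subset_iff, ← set_G]
  refine ⟨fun h => OrderHomClass.mono j.set h, fun h => ?_⟩
  have : j.set (N₁.G a ⊓ b) = j.set (N₁.G a) := by
    rw [map_inf]
    exact Set.inter_eq_left.2 h
  exact inf_eq_left.1 (j.set_injective this)

theorem mem_set_patCell [Fintype N₁.P0] [Fintype N₁.P2] {n : ℕ} {U : N₁.P2 → ℕ → Prop} {p : P} :
    p ∈ j.set (N₁.patCell n U) ↔ p ∉ Set.range j.pt ∧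
      ∀ m < n, ∀ c, (p ∈ modelF H req (j.idx c) m ↔ U c m) := by
  rw [TauStr.patCell, map_boolCell, mem_boolCell]
  constructor
  · refine fun hp => ⟨?_, fun m hm c => ?_⟩
    · rintro ⟨a, rfl⟩
      refine Bool.false_ne_true ((hp (.inl a) (inl_mem_genFinset _ a)).1 ?_)
      exact (j.set_G a).ge rfl
    · have := hp (.inr (m, c)) (inr_mem_genFinset.2 hm)
      simp only [Sum.elim_inr, decide_eq_true_eq] at this
      rw [← this, ← set_F]
      rfl
  · rintro ⟨h0, h1⟩ (a | ⟨m, c⟩) hi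
    · refine iff_of_false (fun hp => h0 ⟨a, ?_⟩) Bool.false_ne_true
      exact ((j.set_G a).le hp).symm
    · simp only [Sum.elim_inr, decide_eq_true_eq]
      rw [← h1 m (inr_mem_genFinset.1 hi) c, ← set_F]
      rfl

theorem infinite_of_patCell_ne_bot (hN : N₁.KNegOneFin) [Fintype N₁.P0] [Fintype N₁.P2] {n : ℕ}
    {U : N₁.P2 → ℕ → Prop} (h : N₁.patCell n U ≠ ⊥) :
    {p | p ∉ Set.range j.pt ∧ ∀ m < n, ∀ c, (p ∈ modelF H req (j.idx c) m ↔ U c m)}.Infinite := by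
  rw [Ne, ← hN.patCell_mem_P4_iff, ← j.set_finite_iff] at h
  exact Set.Infinite.mono (fun p hp => j.mem_set_patCell.1 hp) h

theorem patCell_ne_bot_of_notMem_range [Fintype N₁.P0] [Fintype N₁.P2] {n : ℕ} {p : P}
    (hp : p ∉ Set.range j.pt) : N₁.patCell n (fun c m => p ∈ modelF H req (j.idx c) m) ≠ ⊥ := by
  intro h
  have : p ∈ j.set (N₁.patCell n fun c m => p ∈ modelF H req (j.idx c) m) :=
    j.mem_set_patCell.2 ⟨hp, fun _ _ _ => Iff.rfl⟩
  rw [h, map_bot] at this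
  exact this

-- The image of the cell in `N₂` lies above `x`.
open Classical in
theorem patCell_ne_bot_of_le [Fintype N₁.P0] [Fintype N₁.P2] (i : N₁.Emb N₂) {n : ℕ}
    {U : N₁.P2 → ℕ → Prop} {x : N₂.P1} (hx : x ≠ ⊥) (h0 : ∀ a, x ≤ (N₂.G (i.f0 a))ᶜ)
    (h1 : ∀ m < n, ∀ c, x ≤ if U c m then N₂.F m (i.f2 c) else (N₂.F m (i.f2 c))ᶜ) :
    N₁.patCell n U ≠ ⊥ := by
  intro hbot
  refine hx (le_bot_iff.1 ?_)
  rw [← map_bot i.f1, ← hbot, TauStr.patCell, map_boolCell]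
  refine Finset.le_inf ?_
  rintro (a | ⟨m, c⟩) hi
  · exact (h0 a).trans (by rw [← i.map_G]; exact le_rfl)
  · simp only [Sum.elim_inr, decide_eq_true_eq]
    have := h1 m (inr_mem_genFinset.1 hi) c
    rwa [← i.map_F] at this

end TauStr.Emb

end Rich

section Rich

variable {P Z L : Type u} {H : Z ⊕ L → ℕ → Set P} {req : L → List (genAlg H) × Finset P}
  {N₁ N₂ : TauStr.{u}}

namespace TauStr.Emb

variable (i : N₁.Emb N₂) (j : N₁.Emb (genModel H req)) [Fintype N₁.P0] [Fintype N₁.P2]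

/-- Infinitely many points realize the type over `N₁` of a new element of `P₀`. -/
theorem infinite_points (hN₁ : N₁.KNegOneFin) (hN₂ : N₂.KNegOneFin) {k : ℕ}
    {B : ℕ → BooleanSubalgebra N₂.P1} {b : N₂.P1} (hw : N₂.IsWitness k B b) {T : Finset (Z ⊕ L)}
    (hT : ∀ c, c ∈ T ↔ c ∈ Set.range j.idx) {V : Finset L} {n : ℕ}
    (hg : CellGeneric H req T V n) (hk : k ≤ n) {a : N₂.P0} (ha : a ∉ Set.range i.f0) :
    {p | p ∉ Set.range j.pt ∧
      ∀ c m, (p ∈ modelF H req (j.idx c) m ↔ N₂.G a ≤ N₂.F m (i.f2 c))}.Infinite := by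
  classical
  have hne : N₁.patCell n (fun c m => N₂.G a ≤ N₂.F m (i.f2 c)) ≠ ⊥ := by
    refine patCell_ne_bot_of_le i (hN₂.isAtom_G a).ne_bot (fun a' => ?_) fun m _ c => ?_
    · rw [(hN₂.isAtom_G a).le_compl_iff, hN₂.G_le_G_iff]
      exact fun h => ha ⟨a', h.symm⟩
    · split
      · assumption
      · rwa [(hN₂.isAtom_G a).le_compl_iff]
  have hinf := j.infinite_of_patCell_ne_bot hN₁ hne
  obtain ⟨p, hp0, hp⟩ := hinf.nonempty
  have hcell : (cellOf (modelF H req) T n p).Infinite := by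
    refine hinf.mono ?_
    rintro p' ⟨-, hp'⟩ c hc m hm
    obtain ⟨c, rfl⟩ := (hT c).1 hc
    exact (hp' m hm c).trans (hp m hm c).symm
  refine ((hg p hcell ∅ (Finset.disjoint_empty_left _) (fun _ => ∅) fun _ => ∅).sdiff
    (Set.finite_range j.pt)).mono ?_
  rintro p' ⟨⟨h1, h2, -⟩, h3⟩
  refine ⟨h3, fun c m => ?_⟩
  have hc := (hT _).2 ⟨c, rfl⟩
  by_cases hm : m < n
  · exact (h1 _ hc m hm).trans (hp m hm c)
  · rw [h2 _ hc m (not_lt.1 hm)]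
    exact iff_of_false (Finset.notMem_empty _) (hw.not_G_le_F hN₂ (hk.trans (not_lt.1 hm)) a _)

/-- The extension of an embedding to the elements of `P₀`. -/
theorem exists_points [Finite N₂.P0] (hN₁ : N₁.KNegOneFin) (hN₂ : N₂.KNegOneFin) {k : ℕ}
    {B : ℕ → BooleanSubalgebra N₂.P1} {b : N₂.P1} (hw : N₂.IsWitness k B b) {T : Finset (Z ⊕ L)}
    (hT : ∀ c, c ∈ T ↔ c ∈ Set.range j.idx) {V : Finset L} {n : ℕ}
    (hg : CellGeneric H req T V n) (hk : k ≤ n) :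
    ∃ h0 : N₂.P0 → P, Function.Injective h0 ∧ (∀ a, h0 (i.f0 a) = j.pt a) ∧
      ∀ a m c, N₂.G a ≤ N₂.F m (i.f2 c) ↔ h0 a ∈ modelF H req (j.idx c) m := by
  obtain ⟨g, hgi, hg⟩ := exists_injective_of_forall_infinite _
    fun a : {a // a ∉ Set.range i.f0} => i.infinite_points j hN₁ hN₂ hw hT hg hk a.2
  obtain ⟨h0, h0i, h0j, h0g⟩ := exists_injective_extension i.inj0 j.pt_injective hgi
    fun a => (hg a).1
  refine ⟨h0, h0i, h0j, fun a m c => ?_⟩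
  by_cases ha : a ∈ Set.range i.f0
  · obtain ⟨a, rfl⟩ := ha
    rw [h0j, ← j.set_F, ← j.G_le_iff, ← i.map_G, ← i.map_F]
    refine ⟨fun h => ?_, fun h => OrderHomClass.mono i.f1 h⟩
    rw [← inf_eq_left, ← map_inf] at h
    exact inf_eq_left.1 (i.inj1 h)
  · rw [h0g ⟨a, ha⟩]
    exact ((hg ⟨a, ha⟩).2 c m).symm

end TauStr.Emb

/-- The new points are placed first, by genericity. A pattern for the new sequences is admissible at
a point p if, together with the pattern of p for the old ones, it gives a nonzero cell of `N₂`.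
`exists_extension` realizes exactly these patterns, which is what `exists_emb_of_cells` requires. -/
theorem genModel_rich (hH : GenericFamily H) (hreq : ∀ r, {l | req l = r}.Infinite) :
    (genModel H req).Rich := by
  classical
  rintro N₁ N₂ ⟨hN₁, k₁, B₁, b₁, hw₁⟩ ⟨hN₂, k₂, B₂, b₂, hw₂⟩ i j
  have := hw₁.finite_P0 hN₁
  have := hw₂.finite_P0 hN₂
  have := hN₁.P2_finite
  have := hN₂.P2_finite
  have := Fintype.ofFinite N₁.P0
  have := Fintype.ofFinite N₂.P0
  have := Fintype.ofFinite N₁.P2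
  have := Fintype.ofFinite N₂.P2
  let T : Finset (Z ⊕ L) := Finset.univ.image j.idx
  have hT : ∀ c, c ∈ T ↔ c ∈ Set.range j.idx := fun c => by simp [T]
  obtain ⟨V, n₀, hV, hg⟩ := exists_cellGeneric H req hH T
  set n := max n₀ k₂ with hn
  have hk₂ : k₂ ≤ n := le_max_right _ _
  have hg := hg n (le_max_left _ _)
  obtain ⟨h0, h0i, h0j, hA⟩ := i.exists_points j hN₁ hN₂ hw₂ hT hg hk₂
  let Q : Finset P := Finset.univ.image h0
  have hQ : ∀ p, p ∈ Q ↔ p ∈ Set.range h0 := fun p => by simp [Q]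
  have hQj : ∀ p, p ∉ Q → p ∉ Set.range j.pt := by
    rintro _ hp ⟨a, rfl⟩
    exact hp ((hQ _).2 ⟨_, h0j a⟩)
  -- the patterns of the new sequences
  let pat : P → ({d // d ∉ Set.range i.f2} → Fin n → Prop) → N₂.P2 → ℕ → Prop := fun p e c m =>
    (∃ c', i.f2 c' = c ∧ p ∈ modelF H req (j.idx c') m) ∨
      ∃ (hc : c ∉ Set.range i.f2) (hm : m < n), e ⟨c, hc⟩ ⟨m, hm⟩
  have hpat₁ : ∀ p e c m, pat p e (i.f2 c) m ↔ p ∈ modelF H req (j.idx c) m := by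
    intro p e c m
    constructor
    · rintro (⟨c', hc', hp⟩ | ⟨hc, -⟩)
      · rwa [← i.inj2 hc']
      · exact absurd ⟨c, rfl⟩ hc
    · exact fun hp => Or.inl ⟨c, rfl, hp⟩
  have hpat₂ : ∀ p e (d : {d // d ∉ Set.range i.f2}) (m : Fin n), pat p e d.1 m ↔ e d m := by
    intro p e d m
    constructor
    · rintro (⟨c', hc', -⟩ | ⟨_, _, he⟩)
      · exact absurd ⟨c', hc'⟩ d.2
      · exact he
    · exact fun he => Or.inr ⟨d.2, m.2, he⟩
  have hpat : ∀ {p e} {U : N₂.P2 → ℕ → Prop},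
      (∀ m < n, ∀ c, (p ∈ modelF H req (j.idx c) m ↔ U (i.f2 c) m)) →
      (∀ d (m : Fin n), e d m ↔ U d.1 m) → N₂.patCell n (pat p e) = N₂.patCell n U := by
    intro p e U hp he
    refine TauStr.patCell_congr fun m hm c => ?_
    by_cases hc : c ∈ Set.range i.f2
    · obtain ⟨c, rfl⟩ := hc
      exact (hpat₁ _ _ _ _).trans (hp m hm c)
    · exact (hpat₂ p e ⟨c, hc⟩ ⟨m, hm⟩).trans (he ⟨c, hc⟩ ⟨m, hm⟩)
  -- cells of `N₂` restrict to cells of `N₁`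
  have hres : ∀ U, N₂.patCell n U ≠ ⊥ →
      {p | ∀ m < n, ∀ c, (p ∈ modelF H req (j.idx c) m ↔ U (i.f2 c) m)}.Infinite := by
    intro U hU
    refine (j.infinite_of_patCell_ne_bot hN₁ (U := fun c m => U (i.f2 c) m) ?_).mono
      fun p hp => hp.2
    exact TauStr.Emb.patCell_ne_bot_of_le i hU (fun a => TauStr.patCell_le_compl_G _)
      fun m hm c => TauStr.patCell_le_F hm _
  have hgood : ∀ {U}, N₂.patCell n U ≠ ⊥ → ∀ {p},
      (∀ m < n, ∀ c, (p ∈ modelF H req (j.idx c) m ↔ U (i.f2 c) m)) →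
      N₂.patCell n (pat p fun d m => U d.1 m) ≠ ⊥ := by
    intro U hU p hp
    rwa [hpat hp fun _ _ => Iff.rfl]
  have hQinf : ∀ p ∉ Q, (cellOf (modelF H req) T n p).Infinite := by
    intro p hp
    refine (j.infinite_of_patCell_ne_bot hN₁
      (j.patCell_ne_bot_of_notMem_range (n := n) (hQj p hp))).mono ?_
    rintro p' ⟨-, hp'⟩ c hc m hm
    obtain ⟨c, rfl⟩ := (hT c).1 hc
    exact hp' m hm c
  -- The cell of p in `N₁` is not in `P₄`, so neither is its image in `N₂`. That image meets a
  -- nonzero cell of `N₂` avoiding `P₀`, which must agree with p on the old sequences.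
  have hne : ∀ p ∉ Q, {e | N₂.patCell n (pat p e) ≠ ⊥}.Nonempty := by
    intro p hp
    have h1 := j.patCell_ne_bot_of_notMem_range (n := n) (hQj p hp)
    rw [Ne, ← hN₁.patCell_mem_P4_iff, ← i.map_P4] at h1
    obtain ⟨U, hU⟩ := hN₂.exists_patCell h1 n
    refine ⟨fun d m => U d.1 m, hgood (ne_bot_of_le_ne_bot hU inf_le_right) fun m hm c => ?_⟩
    by_contra hcon
    refine hU (le_bot_iff.1 ?_)
    have h2 := OrderHomClass.mono i.f1
      (TauStr.patCell_le_F hm (U := fun c m => p ∈ modelF H req (j.idx c) m) c)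
    have h3 := TauStr.patCell_le_F hm (U := U) (i.f2 c)
    refine (inf_le_inf h2 h3).trans ?_
    by_cases hpc : p ∈ modelF H req (j.idx c) m <;> by_cases hUc : U (i.f2 c) m
    · exact absurd (iff_of_true hpc hUc) hcon
    · rw [if_pos hpc, if_neg hUc, i.map_F, inf_compl_self]
    · rw [if_neg hpc, if_pos hUc, map_compl', i.map_F, compl_inf_self]
    · exact absurd (iff_of_false hpc hUc) hcon
  have hinv : ∀ p p', p' ∈ cellOf (modelF H req) T n p →
      {e | N₂.patCell n (pat p' e) ≠ ⊥} = {e | N₂.patCell n (pat p e) ≠ ⊥} := by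
    intro p p' hpp
    ext e
    refine not_congr (Eq.congr_left (hpat (fun m hm c => ?_) fun d m => (hpat₂ p e d m).symm))
    exact (hpp _ ((hT _).2 ⟨c, rfl⟩) m hm).trans (hpat₁ _ _ _ _).symm
  have hind : ∀ (d : {d // d ∉ Set.range i.f2}) (η : Fin n → Prop),
      ∃ p ∉ Q, ∃ e ∈ {e | N₂.patCell n (pat p e) ≠ ⊥}, e d = η := by
    intro d η
    -- A single sequence of `N₂` is independent modulo `P₄`, so every initial pattern of it is part
    -- of a nonzero cell.
    obtain ⟨U, hU⟩ := hN₂.exists_patCell (hw₂.boolCell_F_notMem_P4 d.1 (Finset.range n)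
      fun m => decide (∃ hm : m < n, η ⟨m, hm⟩)) n
    have hU' := ne_bot_of_le_ne_bot hU inf_le_right
    obtain ⟨p, hp, hpQ⟩ := ((hres U hU').sdiff Q.finite_toSet).nonempty
    refine ⟨p, hpQ, fun d m => U d.1 m, hgood hU' hp, ?_⟩
    funext m
    refine propext ?_
    by_contra hcon
    refine hU (le_bot_iff.1 ?_)
    refine (inf_le_inf (boolCell_le _ (Finset.mem_range.2 m.2))
      (TauStr.patCell_le_F m.2 d.1)).trans ?_
    have hm : (∃ hm : m.1 < n, η ⟨m.1, hm⟩) ↔ η m := ⟨fun ⟨_, h⟩ => h, fun h => ⟨m.2, h⟩⟩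
    simp only [decide_eq_true_eq, hm]
    by_cases hη : η m <;> by_cases hUc : U d.1 m
    · exact absurd (iff_of_true hUc hη) hcon
    · rw [if_pos hη, if_neg hUc, inf_compl_self]
    · rw [if_neg hη, if_pos hUc, compl_inf_self]
    · exact absurd (iff_of_false hUc hη) hcon
  -- On the points of `N₂` the initial segments copy `N₂`. The tails contain none of these points,
  -- in accordance with `N₂`, where terms from `k₂` on are disjoint from `P₄`.
  obtain ⟨h, hinj, hnotin, honQ, hpatgood, hgen⟩ := exists_extension H req hreq hV hg Q hQinf
    (fun p => {e | N₂.patCell n (pat p e) ≠ ⊥}) hne hinv hind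
    (fun p d m => ∃ a, h0 a = p ∧ N₂.G a ≤ N₂.F m d.1)
  obtain ⟨h2, h2i, h2j, h2h⟩ := exists_injective_extension i.inj2 j.idx_injective
    (g := fun d => Sum.inr (h d)) (Sum.inr_injective.comp hinj)
    fun d hd => hnotin d ((hT _).2 hd)
  have hA' : ∀ a m c, N₂.G a ≤ N₂.F m c ↔ h0 a ∈ modelF H req (h2 c) m := by
    intro a m c
    by_cases hc : c ∈ Set.range i.f2
    · obtain ⟨c, rfl⟩ := hc
      rw [h2j]
      exact hA a m c
    · rw [h2h ⟨c, hc⟩]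
      obtain ⟨hlt, hge⟩ := honQ (h0 a) ((hQ _).2 ⟨a, rfl⟩) ⟨c, hc⟩
      by_cases hm : m < n
      · refine Iff.trans ⟨fun h => ⟨a, rfl, h⟩, ?_⟩ (hlt ⟨m, hm⟩).symm
        rintro ⟨a', ha', h⟩
        rwa [← h0i ha']
      · exact iff_of_false (hw₂.not_G_le_F hN₂ (hk₂.trans (not_lt.1 hm)) a c)
          (hge m (not_lt.1 hm))
  have hB : ∀ n' ≥ n, ∀ p ∉ Set.range h0,
      N₂.patCell n' (fun c m => p ∈ modelF H req (h2 c) m) ≠ ⊥ := by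
    intro n' _ p hp
    refine hw₂.patCell_ne_bot hN₂ hk₂ ?_
    have hgd := hpatgood p fun hpQ => hp ((hQ p).1 hpQ)
    refine (hpat (e := fun d m => p ∈ modelF H req (.inr (h d)) m)
      (U := fun c m => p ∈ modelF H req (h2 c) m) (fun m _ c => ?_) fun d m => ?_).symm.trans_ne hgd
    · rw [h2j]
    · rw [h2h]
  have hC : ∀ n' ≥ n, ∀ U, N₂.patCell n' U ≠ ⊥ → {p | p ∉ Set.range h0 ∧
      ∀ m < n', ∀ c, (p ∈ modelF H req (h2 c) m ↔ U c m)}.Infinite := by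
    intro n' hn' U hU
    have hU' := ne_bot_of_le_ne_bot hU (TauStr.patCell_anti hn' U)
    obtain ⟨p, hp, hpQ⟩ := ((hres U hU').sdiff Q.finite_toSet).nonempty
    let w : Z ⊕ L → Finset ℕ := Function.extend h2
      (fun c => (Finset.range n').filter fun m => U c m) fun _ => ∅
    have hw : ∀ {c m}, m < n' → (m ∈ w (h2 c) ↔ U c m) := by
      intro c m hm
      rw [show w (h2 c) = _ from h2i.extend_apply _ _ c, Finset.mem_filter, Finset.mem_range]
      exact and_iff_right hm
    refine ((hgen p hpQ (fun d m => U d.1 m) (hgood hU' hp) w).sdiff Q.finite_toSet).mono ?_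
    rintro p' ⟨⟨h₁, h₂, h₃, h₄⟩, hp'Q⟩
    refine ⟨fun hp0 => hp'Q ((hQ _).2 hp0), fun m hm c => ?_⟩
    by_cases hc : c ∈ Set.range i.f2
    · obtain ⟨c, rfl⟩ := hc
      have hcT := (hT _).2 ⟨c, rfl⟩
      by_cases hmn : m < n
      · rw [h2j]
        exact (h₁ _ hcT m hmn).trans (hp m hmn c)
      · rw [← hw hm, h2j]
        exact h₃ _ hcT m (not_lt.1 hmn)
    · by_cases hmn : m < n
      · rw [h2h ⟨c, hc⟩]
        exact h₂ ⟨c, hc⟩ ⟨m, hmn⟩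
      · rw [← hw hm, h2h ⟨c, hc⟩]
        exact h₄ ⟨c, hc⟩ m (not_lt.1 hmn)
  obtain ⟨f, hf0, hf2⟩ := exists_emb_of_cells (H := H) (req := req) hN₂ (hw₂.closure_gen hN₂)
    h0i h2i n hA' hB hC
  have e0 : ∀ a, f.f0 (i.f0 a) = j.f0 a := fun a => (congrFun hf0 _).trans (h0j a)
  have e2 : ∀ c, f.f2 (i.f2 c) = j.f2 c := fun c => (congrFun hf2 _).trans (h2j c)
  refine ⟨f, e0, fun b => ?_, e2⟩
  refine BoundedLatticeHom.ext_of_closure_eq_top (hw₁.closure_gen hN₁)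
    (f := f.f1.comp i.f1) (g := j.f1) ?_ b
  rintro _ ⟨a | ⟨m, c⟩, rfl⟩
  · change f.f1 (i.f1 (N₁.G a)) = j.f1 (N₁.G a)
    rw [i.map_G, f.map_G, j.map_G, e0]
  · change f.f1 (i.f1 (N₁.F m c)) = j.f1 (N₁.F m c)
    rw [i.map_F, f.map_F, j.map_F, e2]

end Rich

/-! ### P₀-maximality from uf(M) = ∅ -/

namespace TauStr

variable {M N : TauStr.{u}}

theorem KNegOneFin.R_compl (h : M.KNegOneFin) {a : M.P0} {b : M.P1} : M.R a bᶜ ↔ ¬ M.R a b := by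
  rw [h.R_iff, h.R_iff, (h.isAtom_G a).le_compl_iff]

theorem KNegOneFin.R_inf (h : M.KNegOneFin) {a : M.P0} {b b' : M.P1} :
    M.R a (b ⊓ b') ↔ M.R a b ∧ M.R a b' := by
  rw [h.R_iff, h.R_iff, h.R_iff, le_inf_iff]

theorem KOne.kNegOne (h : M.KOne) : M.KNegOne := by
  obtain ⟨𝒮, hne, hK, h⟩ := h
  exact ⟨𝒮, hne, fun S hS => (hK S hS).1, h⟩

namespace KNegOne

variable (h : N.KNegOne)
include h

theorem exists_sub (a : N.P0) (b b' : N.P1) (c : Option N.P2) : ∃ S : N.Sub, S.toStr.KNegOneFin ∧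
    a ∈ S.S0 ∧ b ∈ S.S1 ∧ b' ∈ S.S1 ∧ ∀ c' ∈ c, c' ∈ S.S2 := by
  obtain ⟨𝒮, -, hK, hdir, h0, h1, h2⟩ := h
  obtain ⟨S, hS, ha⟩ := h0 a
  obtain ⟨S', hS', hb⟩ := h1 b
  obtain ⟨S'', hS'', hb'⟩ := h1 b'
  obtain ⟨U, hU, hSU, hS'U⟩ := hdir S hS S' hS'
  obtain ⟨U', hU', hUU', hS''U'⟩ := hdir U hU S'' hS''
  have ha := hUU'.1 (hSU.1 ha)
  have hb := hUU'.2.1 (hS'U.2.1 hb)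
  have hb' := hS''U'.2.1 hb'
  cases c with
  | none => exact ⟨U', hK U' hU', ha, hb, hb', by simp⟩
  | some c =>
    obtain ⟨T, hT, hc⟩ := h2 c
    obtain ⟨V, hV, hUV, hTV⟩ := hdir U' hU' T hT
    exact ⟨V, hK V hV, hUV.1 ha, hUV.2.1 hb, hUV.2.1 hb', by simpa using hTV.2.2 hc⟩

theorem R_compl {a : N.P0} {b : N.P1} : N.R a bᶜ ↔ ¬ N.R a b := by
  obtain ⟨S, hS, ha, hb, -⟩ := h.exists_sub a b b none
  exact hS.R_compl (a := ⟨a, ha⟩) (b := ⟨b, hb⟩)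

theorem R_inf {a : N.P0} {b b' : N.P1} : N.R a (b ⊓ b') ↔ N.R a b ∧ N.R a b' := by
  obtain ⟨S, hS, ha, hb, hb', -⟩ := h.exists_sub a b b' none
  exact hS.R_inf (a := ⟨a, ha⟩) (b := ⟨b, hb⟩) (b' := ⟨b', hb'⟩)

theorem R_top (a : N.P0) : N.R a ⊤ := by
  obtain ⟨S, hS, ha, -⟩ := h.exists_sub a ⊤ ⊤ none
  exact (hS.R_iff (a := ⟨a, ha⟩) (b := ⊤)).2 le_top

theorem eq_of_R_G {a a' : N.P0} (haa : N.R a (N.G a')) : a = a' := by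
  by_contra hne
  obtain ⟨𝒮, -, hK, hdir, h0, -⟩ := h
  obtain ⟨S, hS, ha⟩ := h0 a
  obtain ⟨S', hS', ha'⟩ := h0 a'
  obtain ⟨U, hU, hSU, hS'U⟩ := hdir S hS S' hS'
  have h1 : (⟨a, hSU.1 ha⟩ : U.S0) ∈ ({⟨a', hS'U.1 ha'⟩} : Set U.S0) :=
    ((hK U hU).R_G ⟨a', hS'U.1 ha'⟩).le haa
  exact hne (congrArg Subtype.val h1)

theorem finite_R_F (a : N.P0) (c : N.P2) : {n | N.R a (N.F n c)}.Finite := by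
  obtain ⟨S, hS, ha, -, -, hc⟩ := h.exists_sub a ⊤ ⊤ (some c)
  refine (hS.incomplete _ (hS.G_bij.mapsTo (Set.mem_univ ⟨a, ha⟩))
    ⟨c, hc c rfl⟩).subset fun n hn => ?_
  exact hS.R_iff.1 hn

theorem exists_G_eq {b : N.P1} (hb : IsAtom b) : ∃ a, N.G a = b := by
  obtain ⟨𝒮, -, hK, hdir, -, h1, -⟩ := h
  obtain ⟨S, hS, hbS⟩ := h1 b
  have hat : IsAtom (⟨b, hbS⟩ : S.toStr.P1) := by
    refine ⟨fun h => hb.1 (congrArg Subtype.val h), fun x hx => Subtype.ext (hb.2 x.1 hx)⟩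
  obtain ⟨a, ha⟩ := (hK S hS).exists_G_eq hat
  exact ⟨a.1, congrArg Subtype.val ha⟩

/-- A structure over which no ultrafilter of the prescribed kind exists is `P₀`-maximal. -/
theorem p0Maximal (huf : N.uf = ∅) : N.P0Maximal := by
  refine ⟨h, fun M hM f a => ?_⟩
  by_contra ha
  have hle : ∀ {b b' : M.P1}, b ≤ b' → M.R a b → M.R a b' := by
    intro b b' hb hR
    rw [← inf_eq_left] at hb
    rw [← hb] at hR
    exact (hM.R_inf.1 hR).2
  -- The trace on the smaller algebra of the ultrafilter determined by the new point `a`.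
  have hD : Order.IsPFilter {b : N.P1 | M.R a (f.f1 b)} := by
    refine Order.IsPFilter.of_def ⟨⊤, ?_⟩ ?_ ?_
    · change M.R a (f.f1 ⊤)
      rw [map_top]
      exact hM.R_top a
    · intro b hb b' hb'
      refine ⟨b ⊓ b', ?_, inf_le_left, inf_le_right⟩
      change M.R a (f.f1 (b ⊓ b'))
      rw [map_inf]
      exact hM.R_inf.2 ⟨hb, hb'⟩
    · intro b b' hb hR
      exact hle (OrderHomClass.mono f.f1 hb) hR
  have hmem : ∀ b, b ∈ hD.toPFilter ↔ M.R a (f.f1 b) := fun b => Iff.rfl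
  refine Set.eq_empty_iff_forall_notMem.1 huf hD.toPFilter
    ⟨fun b => ?_, fun b hb => ?_, fun c => ?_⟩
  · rw [hmem, hmem, map_compl', hM.R_compl, not_not]
  · obtain ⟨p, rfl⟩ := h.exists_G_eq (mem_P4n_one.1 hb)
    rw [hmem, f.map_G]
    exact fun hR => ha ⟨p, (hM.eq_of_R_G hR).symm⟩
  · simp only [hmem, f.map_F]
    exact hM.finite_R_F a _

end KNegOne

end TauStr

/-! ### Emptiness of uf for the model -/

section Ultrafilters

variable {P Z L : Type u} {H : Z ⊕ L → ℕ → Set P} {req : L → List (genAlg H) × Finset P}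

theorem genModel_isAtom_G (p : P) : IsAtom ((genModel H req).G p) := by
  have hat : IsAtom (⟨{p}, singleton_mem_genAlg H p⟩ : genAlg H) := by
    refine ⟨fun h => ?_, fun b hb => Subtype.ext ?_⟩
    · exact Set.singleton_ne_empty p (congrArg Subtype.val h)
    · refine (Set.isAtom_singleton p).2 b.1 ⟨hb.1, hb.2⟩
  exact hat

/-- If the sequences `H (inl ζ)` capture all nonprincipal ultrafilters of sets of points, then
there is no ultrafilter in `uf`. -/
theorem genModel_uf_eq_empty (hkill : ∀ U : Ultrafilter P, (∀ p, {p} ∉ U) →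
    ∃ ζ, ∀ m, H (.inl ζ) m ∈ U) : (genModel H req).uf = ∅ := by
  refine Set.eq_empty_iff_forall_notMem.2 fun D hD => ?_
  obtain ⟨hcompl, hatom, hF⟩ := hD
  -- D lives only on the algebra. The filter it generates extends to an ultrafilter on all sets of
  -- points, whose trace on the algebra is again D.
  let 𝓕 : Filter P :=
    { sets := {s | ∃ b ∈ D, genAlgSet H b ⊆ s}
      univ_sets := by
        obtain ⟨b, hb⟩ := D.nonempty
        exact ⟨b, hb, Set.subset_univ _⟩
      sets_of_superset := fun ⟨b, hb, hbs⟩ hst => ⟨b, hb, hbs.trans hst⟩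
      inter_sets := fun ⟨b, hb, hbs⟩ ⟨b', hb', hbs'⟩ =>
        ⟨b ⊓ b', Order.PFilter.inf_mem hb hb', Set.inter_subset_inter hbs hbs'⟩ }
  have hmem : ∀ b ∈ D, genAlgSet H b ∈ 𝓕 := fun b hb => ⟨b, hb, subset_rfl⟩
  have hne : 𝓕.NeBot := by
    rw [Filter.neBot_iff, Ne, ← Filter.empty_mem_iff_bot]
    rintro ⟨b, hb, hbe⟩
    refine (hcompl b).1 hb (D.mem_of_le ?_ hb)
    change genAlgSet H b ⊆ _
    exact hbe.trans (Set.empty_subset _)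
  let U := Ultrafilter.of 𝓕
  have hU : ∀ b : (genModel H req).P1, genAlgSet H b ∈ U ↔ b ∈ D := by
    intro b
    refine ⟨fun hb => ?_, fun hb => Ultrafilter.of_le 𝓕 (hmem b hb)⟩
    rw [hcompl]
    intro hbc
    have := Ultrafilter.of_le 𝓕 (hmem _ hbc)
    exact Ultrafilter.compl_mem_iff_notMem.1 this hb
  obtain ⟨ζ, hζ⟩ := hkill U fun p hp => by
    refine hatom ((genModel H req).G p) (TauStr.mem_P4n_one.2 (genModel_isAtom_G p))
      ((hU _).1 hp)
  exact Set.infinite_univ ((hF (.inl ζ)).subset fun m _ => (hU _).1 (hζ m))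

end Ultrafilters

/-! ### Cardinalities -/

section Cardinality

theorem exists_infinite_fibers {α β : Type u} [Nonempty β] [Infinite α] (h : #β ≤ #α) :
    ∃ f : α → β, ∀ b, {a | f a = b}.Infinite := by
  have hle : #(β × ℕ) ≤ #α := by
    rw [mk_prod, lift_id', mk_nat, lift_aleph0]
    exact mul_le_of_le (aleph0_le_mk α) h (aleph0_le_mk α)
  obtain ⟨g⟩ := hle
  refine ⟨fun a => (Function.invFun g a).1, fun b => ?_⟩
  refine (Set.infinite_range_of_injective (f := fun n : ℕ => g (b, n))
    fun n n' hn => congrArg Prod.snd (g.injective hn)).mono ?_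
  rintro _ ⟨n, rfl⟩
  exact congrArg Prod.fst (Function.leftInverse_invFun g.injective (b, n))

variable {X : Type u}

theorem mk_tameFun_le [Infinite X] : #{f : List X → ℕ // TameFun f} ≤ 2 ^ #X := by
  refine (mk_subtype_le _).trans ?_
  rw [mk_arrow, mk_nat, lift_id', lift_aleph0, mk_list_eq_mk]
  exact (power_le_power_right (aleph0_le_mk X)).trans (power_self_eq (aleph0_le_mk X)).le

theorem mk_killIdx_le [Infinite X] : #(KillIdx X) ≤ 2 ^ #X := by
  have h2 : ℵ₀ ≤ (2 : Cardinal.{u}) ^ #X := (aleph0_le_mk X).trans (cantor _).le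
  rw [mk_prod, lift_uzero]
  refine mul_le_of_le h2 mk_tameFun_le ?_
  rw [mk_arrow, lift_power, lift_lift, lift_lift, mk_bool, mk_nat, lift_two, lift_aleph0]
  exact power_le_power_left two_ne_zero (aleph0_le_mk X)

theorem mk_genAlg_le {Z L : Type u} [Infinite X] (H : Z ⊕ L → ℕ → Set (List X)) :
    #(genAlg H) ≤ 2 ^ #X := by
  refine (mk_subtype_le _).trans ?_
  rw [mk_set, mk_list_eq_mk]

theorem card_genModel {Z L : Type u} [Infinite X] (H : Z ⊕ L → ℕ → Set (List X))
    (req : L → List (genAlg H) × Finset (List X)) (hZ : #Z ≤ 2 ^ #X) (hL : #L = 2 ^ #X) :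
    (genModel H req).card = 2 ^ #X := by
  have h2 : ℵ₀ ≤ (2 : Cardinal.{u}) ^ #X := (aleph0_le_mk X).trans (cantor _).le
  change #(List X ⊕ genAlg H ⊕ Z ⊕ L) = _
  simp only [mk_sum, lift_id]
  refine le_antisymm (add_le_of_le h2 ?_ (add_le_of_le h2 ?_ (add_le_of_le h2 hZ hL.le))) ?_
  · rw [mk_list_eq_mk]
    exact (cantor _).le
  · exact mk_genAlg_le H
  · rw [hL]
    exact self_le_add_left .. |>.trans (self_le_add_left ..) |>.trans (self_le_add_left ..)

end Cardinality

/-- If `lam` is less than the first measurable cardinal (i.e. than every measurable cardinal),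
`2 ^ ℵ₀ < lam` and `lam = 2 ^ μ` for some `μ`, then there is a `P₀`-maximal model in `K₂` of
cardinality `lam`, and it satisfies `uf(M) = ∅`. -/
theorem mainTheorem2 (lam : Cardinal.{u})
    (hmeas : ∀ κ : Cardinal.{u}, IsMeasurableCardinal κ → lam < κ)
    (hcont : (2 : Cardinal.{u}) ^ (ℵ₀ : Cardinal.{u}) < lam)
    (hpow : ∃ μ : Cardinal.{u}, lam = (2 : Cardinal.{u}) ^ μ) :
    ∃ M : TauStr.{u}, M.KTwo ∧ M.P0Maximal ∧ M.uf = ∅ ∧ M.card = lam := by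
  obtain ⟨μ, rfl⟩ := hpow
  have hμ : ℵ₀ ≤ μ := by
    -- For finite μ the power 2^μ would be finite, below the continuum.
    by_contra h
    exact (power_lt_aleph0 (ofNat_lt_aleph0 (n := 2)) (not_le.1 h)).not_ge
      ((cantor ℵ₀).le.trans hcont.le)
  let X : Type u := μ.out
  have hX : #X = μ := mk_out μ
  have hXinf : Infinite X := by rwa [← hX, ← infinite_iff] at hμ
  let L : Type u := Set X
  have hL : #L = 2 ^ #X := mk_set
  have h2 : ℵ₀ ≤ (2 : Cardinal.{u}) ^ #X := (aleph0_le_mk X).trans (cantor _).le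
  have hLinf : Infinite L := infinite_iff.2 (hL ▸ h2)
  obtain ⟨pat, hpat⟩ := exists_independent_patterns
    (X := X) (I := {f : List X → ℕ // TameFun f} ⊕ L) (by
      rw [mk_sum, lift_id, lift_id]
      exact add_le_of_le h2 mk_tameFun_le hL.le)
  let H : KillIdx X ⊕ L → ℕ → Set (List X) := genSet pat
  have hH : GenericFamily H :=
    { finite := genSet_finite pat
      seqIndep := genSet_seqIndep pat hpat
      generic := genSet_generic pat hpat }
  -- There are at most 2^μ requests, so `L` can list each of them infinitely often. The algebra does
  -- not depend on `req`, so there is no circularity.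
  obtain ⟨req, hreq⟩ := exists_infinite_fibers
    (α := L) (β := List (genAlg H) × Finset (List X)) (by
      rw [mk_prod, lift_id, lift_id, hL]
      refine mul_le_of_le h2 ((mk_list_le_max _).trans (max_le h2 (mk_genAlg_le H))) ?_
      rw [mk_finset_of_infinite, mk_list_eq_mk]
      exact (cantor _).le)
  have hkill : ∀ U : Ultrafilter (List X), (∀ p, {p} ∉ U) → ∃ ζ, ∀ m, H (.inl ζ) m ∈ U :=
    exists_genSet_mem_ultrafilter pat fun κ hκ => by
      rw [hX]
      exact (cantor μ).trans (hmeas κ hκ)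
  have hK := genModel_kOne hH hreq
  have huf := genModel_uf_eq_empty (req := req) hkill
  refine ⟨genModel H req, ⟨hK, genModel_rich hH hreq⟩, hK.kNegOne.p0Maximal huf, huf, ?_⟩
  rw [card_genModel H req mk_killIdx_le hL, hX]
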